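/- **Setting.** Graphs are finite and loopless; parallel edges are allowed. Let $c\ge 1$ be an integer. An instance of Planar Disjoint Paths is a tuple $(G,S,T,g,k)$ where $G$ is a plane graph (not necessarily connected), $S,T\subseteq V(G)$, $k=|S|$ and $g:S\to T$ is a bijection. A sequence $C_1,\dots,C_t$ of cycles of $G$ (two parallel edges count as a cycle) is concentric if each $C_i$ is drawn in the strict interior of $C_{i+1}$; it is $S\cup T$-free if no vertex of $S\cup T$ is drawn in the strict interior of $C_t$. The instance is *good* (with respect to $c$) if $S\cap T=\emptyset$, every vertex of $S\cup T$ has degree $1$ in $G$, some $t^\star\in T$ lies on the outer face of $G$ (the radial completion is drawn so that $t^\star$ lies on its outer face too), the treewidth of $G$ is at most $2^{ck}$, and every $S\cup T$-free sequence of concentric cycles of $G$ has length at most $2^{ck}$. Let $H$ be the radial completion of $G$, with one copy of each edge: its vertices are those of $G$ and one vertex $v_f$ for each face $f$, and its edges are those of $G$ and all $uv_f$ with $u$ on the boundary of $f$. A *Steiner tree* is a subtree of $H$ whose set of leaves is exactly $S\cup T$. A *maximal degree-2 path* of a tree $R$ is a path of $R$ whose endpoints have degree $1$ or at least $3$ in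 $R$ and none of whose internal vertices has degree at least $3$ in $R$; it is *long* if its length is at least $10^4\cdot 2^{ck}$, and *short* otherwise. The tree $R$ *has a detour* if for some maximal degree-2 path $P$ of $R$, with endpoints $u,v$, there is in $H$ a path shorter than $P$ from the component of $u$ to the component of $v$ in the graph obtained from $R$ by deleting the edges and the internal vertices of $P$. A set $X$ of vertices *separates* $A$ from $B$ in $H$ if $H-X$ has no path with one endpoint in $A$ and the other in $B$. **Separators.** Let $R^2$ be a Steiner tree without detours. For a long maximal degree-2 path $P$ of $R^2$ and an endpoint $u$ of $P$, let $P'_u$ and $P''_u$ consist of the $100\cdot 2^{ck}$, respectively $50\cdot 2^{ck}$, vertices of $P$ closest to $u$. Let $A_{P,u}$ be the union of $V(P''_u)$ and of the vertex set of the component of $R^2-(V(P'_u)\setminus\{u\})$ containing $u$, and let $B_{P,u}=V(R^2)\setminus(A_{P,u}\cup V(P'_u))$. Let $\mathsf{Sep}(P,u)$ be any subset of $V(H)\setminus(A_{P,u}\cup B_{P,u})$ of minimum size that separates $A_{P,u}$ from $B_{P,u}$ in $H$. Let $u'_P$ be the vertex of $\mathsf{Sep}(P,u)\cap V(P)$ that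 is closest to $u$ along $P$. If $v$ is the other endpoint of $P$, write $P_{u,u'_P}$, $P_{u'_P,v'_P}$, $P_{v'_P,v}$ for the corresponding subpaths of $P$, and let $C_{P,u}$, $C_{P,v}$ be the vertex sets of the connected components of $H-(\mathsf{Sep}(P,u)\cup\mathsf{Sep}(P,v))$ containing $u$ and $v$. The *middle region* of $P$ is $M_P=V(H)\setminus(C_{P,u}\cup C_{P,v})$. **Rerouting.** For every long maximal degree-2 path $P$ of $R^2$ with endpoints $u,v$, let $\mathcal F_P$ be any collection of pairwise vertex-disjoint paths of $G$, each with one endpoint in $\mathsf{Sep}(P,u)$ and the other in $\mathsf{Sep}(P,v)$ and with all its vertices in $M_P$ (for instance, one of maximum size that is optimal with respect to some secondary criterion), and let $P^\star$ be any path in $H[M_P]$ from $u'_P$ to $v'_P$ that respects $\mathcal F_P$, that is, $P^\star$ does not visit vertices $x,y,z$ in this order such that $x,z$ lie on one path of $\mathcal F_P$ and $y$ lies on a different path of $\mathcal F_P$. Let $R^3$ be the subgraph of $H$ obtained from $R^2$ by replacing $P_{u'_P,v'_P}$ by $P^\star$, simultaneously for all long maximal degree-2 paths $P$. **Claim.**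 Let $(G,S,T,g,k)$ be a good instance and let $R^2$ be a Steiner tree without detours. 1. For any two distinct long maximal degree-2 paths $P,\widehat P$ of $R^2$, with $\widehat u,\widehat v$ the endpoints of $\widehat P$, the middle regions $M_P$ and $M_{\widehat P}$ are disjoint; moreover $M_P\subseteq C_{\widehat P,\widehat u}$ or $M_P\subseteq C_{\widehat P,\widehat v}$. 2. $R^3$ is a Steiner tree. It has the same vertices of degree at least $3$ as $R^2$. Every short maximal degree-2 path of $R^2$ is a short maximal degree-2 path of $R^3$. For every long maximal degree-2 path $P$ of $R^2$ with endpoints $u,v$, the paths $P_{u,u'_P}$ and $P_{v,v'_P}$ are subpaths of the maximal degree-2 path of $R^3$ with endpoints $u,v$. 3. Let $\widehat P$ be a long maximal degree-2 path of $R^3$ and $u$ an endpoint of $\widehat P$. Then there is exactly one long maximal degree-2 path $P$ of $R^2$ with the same endpoints as $\widehat P$, and $\mathsf{Sep}(P,u)$ separates $A^\star$ from $V(R^3)\setminus A^\star$ in $H$, where $A^\star$ is the union of $V(P_{u,u'_P})$ and of the vertex set of the component of $R^3-(V(P_{u,u'_P})\setminus\{u\})$ containing $u$. -/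

import Mathlib

namespace PDP

/-! ## Plane graphs -/

/-- The data of a (finite, loopless) multigraph drawn on an oriented surface, possibly
disconnected, with vertices `V`, faces `F` and darts (edges with a direction) `D`.
`rot` sends a dart to the next dart in clockwise order around its tail, `face d` is the face on
the left-hand side of `d`, and `isoFace v` is the face that contains `v` when `v` is an isolated
vertex (the value at other vertices is not used). Two different darts `d`, `rev d` make up one
edge, so parallel edges are allowed. -/
structure PlaneMap (V D F : Type*) where
  tail : D → V
  rev : D → D
  rot : Equiv.Perm D
  face : D → F
  isoFace : V → F
  outer : F
  rev_rev : ∀ d, rev (rev d) = d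
  loopless : ∀ d, tail (rev d) ≠ tail d
  rot_orbit : ∀ d e, rot.SameCycle d e ↔ tail d = tail e
  face_next : ∀ d, face (rot (rev d)) = face d

namespace PlaneMap

variable {V D F : Type*} (G : PlaneMap V D F)

/-- The end of a dart. -/
def head (d : D) : V := G.tail (G.rev d)

/-- The vertex `v` lies on the boundary of the face `f`. -/
def Inc (v : V) (f : F) : Prop :=
  (∃ d, G.tail d = v ∧ G.face d = f) ∨ ((∀ d, G.tail d ≠ v) ∧ G.isoFace v = f)

/-- The degree of a vertex, parallel edges counted. -/
noncomputable def degree (v : V) : ℕ := {d | G.tail d = v}.ncard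

/-- The underlying simple graph. -/
def graph : SimpleGraph V where
  Adj a b := ∃ d, G.tail d = a ∧ G.head d = b
  symm := ⟨by
    rintro a b ⟨d, h1, h2⟩
    exact ⟨G.rev d, h2, by rw [head, G.rev_rev]; exact h1⟩⟩
  loopless := ⟨by
    rintro a ⟨d, h1, h2⟩
    exact G.loopless d (h2.trans h1.symm)⟩

/-- Adjacency in the radial completion: the vertices are those of `G` and one for each face,
the edges are those of `G` together with the vertex-face incidences. -/
def RadialAdj : V ⊕ F → V ⊕ F → Prop
  | .inl a, .inl b => G.graph.Adj a b
  | .inl a, .inr f => G.Inc a f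
  | .inr f, .inl a => G.Inc a f
  | .inr _, .inr _ => False

/-- The radial completion of `G`, with one copy of each edge. -/
def radial : SimpleGraph (V ⊕ F) where
  Adj := G.RadialAdj
  symm := ⟨by
    rintro (a | f) (b | f') h
    · exact SimpleGraph.Adj.symm (G := G.graph) h
    · exact h
    · exact h
    · exact h⟩
  loopless := ⟨by
    rintro (a | f) h
    · exact G.graph.loopless.irrefl a h
    · exact h⟩

/-- A cycle of `G`: a cyclic sequence of darts, each ending where the next one starts, that
repeats no vertex and no edge. Two parallel edges form a cycle of length two. -/
structure Cyc where
  len : ℕ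
  pos : 0 < len
  dart : ZMod len → D
  next : ∀ i, G.head (dart i) = G.tail (dart (i + 1))
  inj : Function.Injective fun i => G.tail (dart i)
  edge : ∀ i j, dart i ≠ G.rev (dart j)

namespace Cyc

variable {G} (C : G.Cyc)

/-- The vertices of the cycle. -/
def verts : Set V := Set.range fun i => G.tail (C.dart i)

/-- The edge underlying the dart `d` is an edge of the cycle. -/
def Uses (d : D) : Prop := ∃ i, d = C.dart i ∨ d = G.rev (C.dart i)

/-- The face `f` lies outside the cycle: it can be reached from the outer face by crossing
edges that are not edges of the cycle. -/
def ExteriorFace (f : F) : Prop :=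
  Relation.ReflTransGen (fun a b => ∃ d, ¬ C.Uses d ∧ G.face d = a ∧ G.face (G.rev d) = b)
    G.outer f

/-- The vertex `v` is drawn in the strict interior of the cycle. -/
def Interior (v : V) : Prop := v ∉ C.verts ∧ ∀ f, G.Inc v f → ¬ C.ExteriorFace f

/-- The cycle `C` is drawn in the strict interior of the cycle `C'`. -/
def InsideOf (C' : G.Cyc) : Prop := ∀ v ∈ C.verts, C'.Interior v

end Cyc

end PlaneMap

/-- A plane graph, as a combinatorial map of genus zero with a designated outer face.
For a map given by its rotations, with boundary walks merged into faces, the connectedness of the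
incidence structure together with Euler's formula `|V| - |E| + |F| = 1 + (number of components)`
(here multiplied by two, as `|D| = 2 |E|`) says exactly that it is a drawing on the sphere; the
outer face turns this into a drawing in the plane. -/
structure PlaneGraph (V D F : Type*) extends PlaneMap V D F where
  connected : toPlaneMap.radial.Connected
  euler : 2 * Nat.card V + 2 * Nat.card F =
    Nat.card D + 2 * Nat.card toPlaneMap.graph.ConnectedComponent + 2

/-- The graph `G` has a tree decomposition of width at most `w`. -/
def TreewidthLE {V : Type*} (G : SimpleGraph V) (w : ℕ) : Prop :=
  ∃ (n : ℕ) (T : SimpleGraph (Fin n)) (bag : Fin n → Finset V),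
    T.IsTree ∧
    (∀ x y, G.Adj x y → ∃ i, x ∈ bag i ∧ y ∈ bag i) ∧
    (∀ x, (T.induce {i | x ∈ bag i}).IsTree) ∧
    ∀ i, (bag i).card ≤ w + 1

/-! ## Instances -/

/-- An instance `(G, S, T, g, k)` of Planar Disjoint Paths. -/
structure PDPInstance (V D F : Type*) where
  G : PlaneGraph V D F
  S : Finset V
  T : Finset V
  g : S ≃ T

namespace PDPInstance

variable {V D F : Type*} (I : PDPInstance V D F)

/-- The number of terminal pairs. -/
def k : ℕ := I.S.card

/-- The radial completion of the graph of the instance. -/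
abbrev H : SimpleGraph (V ⊕ F) := I.G.toPlaneMap.radial

/-- The set of terminals, as vertices of `G`. -/
def terminals : Set V := {v | v ∈ I.S ∨ v ∈ I.T}

/-- Every terminal has degree one, and no vertex is both a source and a target. -/
def Nice : Prop := (∀ v ∈ I.terminals, I.G.degree v = 1) ∧ Disjoint I.S I.T

/-- Good instances, with respect to the constant `c`. (Once a terminal lies on the outer face of
`G`, the radial completion can be drawn, without changing the drawing of `G`, so that this terminal
lies on its outer face as well; nothing else depends on the drawing of the radial completion.) -/
structure Good (c : ℕ) : Prop where
  nice : I.Nice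
  outer : ∃ t ∈ I.T, I.G.Inc t I.G.outer
  treewidth : TreewidthLE I.G.graph (2 ^ (c * I.k))
  concentric : ∀ cs : List I.G.Cyc,
    cs.IsChain (fun C C' => C.InsideOf C') →
    (∀ C ∈ cs.getLast?, ∀ v ∈ I.terminals, ¬ C.Interior v) →
    cs.length ≤ 2 ^ (c * I.k)

end PDPInstance

/-! ## Subtrees -/

section Trees

variable {W : Type*} {H : SimpleGraph W}

/-- The degree of `v` in the subgraph `R`. -/
noncomputable def deg (R : H.Subgraph) (v : W) : ℕ := (R.neighborSet v).ncard

/-- `R` is a subtree of `H` whose set of leaves is exactly `X`. -/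
def IsSteinerTree (R : H.Subgraph) (X : Set W) : Prop :=
  R.coe.IsTree ∧ {v | v ∈ R.verts ∧ deg R v = 1} = X

/-- The vertex set of the connected component of `R` that contains `a`. -/
def component (R : H.Subgraph) (a : W) : Set W := {x | ∃ p : H.Walk a x, p.toSubgraph ≤ R}

/-- `p` is a maximal degree-2 path of `R`, traversed from one of its endpoints to the other:
a path of `R` whose endpoints have degree one or at least three in `R` and whose internal vertices
do not have degree at least three. -/
def IsMaxDegTwoPath (R : H.Subgraph) {a b : W} (p : H.Walk a b) : Prop :=
  p.IsPath ∧ p.toSubgraph ≤ R ∧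
  (deg R a = 1 ∨ 3 ≤ deg R a) ∧ (deg R b = 1 ∨ 3 ≤ deg R b) ∧
  ∀ w ∈ p.support, w ≠ a → w ≠ b → ¬ 3 ≤ deg R w

/-- `R` without the edges and the internal vertices of `p`. -/
def deletePath (R : H.Subgraph) {a b : W} (p : H.Walk a b) : H.Subgraph :=
  (R.deleteVerts {w | w ∈ p.support ∧ w ≠ a ∧ w ≠ b}).deleteEdges {e | e ∈ p.edges}

/-- `R` has a detour: for some maximal degree-2 path `p` of `R` from `a` to `b`, there is a
shorter path in `H` between the two parts into which `R` falls when the edges and internal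
vertices of `p` are deleted. -/
def HasDetour (R : H.Subgraph) : Prop :=
  ∃ (a b : W) (p : H.Walk a b), IsMaxDegTwoPath R p ∧
    ∃ (x y : W) (q : H.Walk x y), q.IsPath ∧ q.length < p.length ∧
      x ∈ component (deletePath R p) a ∧ y ∈ component (deletePath R p) b

/-- `S` separates `A` from `B` in `H`: there is no path from `A` to `B` in `H - S`. -/
def Separates (H : SimpleGraph W) (S A B : Set W) : Prop :=
  ∀ a ∈ A, ∀ b ∈ B, ∀ p : H.Walk a b, p.IsPath → ∃ s ∈ S, s ∈ p.support

/-- `S` is a subset of `V(H) \ (A ∪ B)` of minimum size that separates `A` from `B`. -/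
def IsMinSeparator (H : SimpleGraph W) (S : Finset W) (A B : Set W) : Prop :=
  Disjoint (S : Set W) (A ∪ B) ∧ Separates H S A B ∧
  ∀ S' : Finset W, Disjoint (S' : Set W) (A ∪ B) → Separates H S' A B → S.card ≤ S'.card

/-- A maximal degree-2 path of `R` of length at least `L`, together with a choice of one of its
endpoints, `src`, from which it is traversed. -/
structure LongPath (R : H.Subgraph) (L : ℕ) where
  src : W
  tgt : W
  walk : H.Walk src tgt
  maxDegTwo : IsMaxDegTwoPath R walk
  long : L ≤ walk.length

namespace LongPath

variable {R : H.Subgraph} {L : ℕ}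

/-- The same path, with the other endpoint chosen. -/
def rev (P : LongPath R L) : LongPath R L where
  src := P.tgt
  tgt := P.src
  walk := P.walk.reverse
  maxDegTwo := by
    obtain ⟨h1, h2, h3, h4, h5⟩ := P.maxDegTwo
    refine ⟨h1.reverse, by simpa using h2, h4, h3, ?_⟩
    intro w hw ha hb
    exact h5 w (by simpa using hw) hb ha
  long := by simpa using P.long

/-- The set of the `m` vertices of the path that are closest to its source. -/
def first (P : LongPath R L) (m : ℕ) : Set W := {w | w ∈ P.walk.support.take m}

/-- The union of the first `m / 2` vertices of the path and the vertex set of the component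
of the source `u` after the other ones among the first `m` vertices are deleted from `R`. -/
def partA (P : LongPath R L) (m : ℕ) : Set W :=
  P.first (m / 2) ∪ component (R.deleteVerts (P.first m \ {P.src})) P.src

/-- The vertices of `R` that are neither in `partA` nor among the first `m` of the path. -/
def partB (P : LongPath R L) (m : ℕ) : Set W := R.verts \ (P.partA m ∪ P.first m)

section

variable (sep : LongPath R L → Finset W) (P : LongPath R L)

open Classical in
/-- The position of `u'`, the first vertex of the path, seen from its source `u`, that belongs to
the separator of `u`. -/
noncomputable def cutIdx : ℕ := P.walk.support.findIdx (fun w => decide (w ∈ sep P))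

/-- The vertex `u'`. -/
noncomputable def cut : W := P.walk.getVert (P.cutIdx sep)

/-- The subpath between `u` and `u'`. -/
noncomputable def startPath : H.Walk P.src (P.cut sep) := P.walk.take (P.cutIdx sep)

/-- The subpath between `u'` and `v'`, where `v` is the other endpoint. -/
noncomputable def midPath :=
  (P.walk.drop (P.cutIdx sep)).take (P.walk.length - P.cutIdx sep - P.rev.cutIdx sep)

/-- The edges of the subpath between `u'` and `v'`. -/
def midEdges : Set (Sym2 W) := {e | e ∈ (P.midPath sep).edges}

/-- The internal vertices of the subpath between `u'` and `v'`. -/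
def midInternal : Set W :=
  {w | w ∈ (P.midPath sep).support ∧ w ≠ P.cut sep ∧ w ≠ P.rev.cut sep}

/-- The vertex set of the connected component containing `u` of the graph obtained from `H` by
deleting the two separators of the path. -/
def comp : Set W :=
  {x | ∃ p : H.Walk P.src x, ∀ y ∈ p.support, y ∉ sep P ∧ y ∉ sep P.rev}

/-- The middle region of the path: all vertices that lie in neither of the components containing
its two endpoints. -/
def midRegion : Set W := (P.comp sep ∪ P.rev.comp sep)ᶜ

end

end LongPath

end Trees

/-! ## The construction -/

namespace PDPInstance

variable {V D F : Type*} (I : PDPInstance V D F) (c : ℕ)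

/-- Paths are long when their length is at least this number. -/
def alphaLong : ℕ := 10 ^ 4 * 2 ^ (c * I.k)

/-- The number of vertices, counted from an endpoint, near which the separators are placed. -/
def alphaPat : ℕ := 100 * 2 ^ (c * I.k)

/-- A Steiner tree of the instance: a subtree of the radial completion whose leaves are exactly
the terminals. -/
def IsSteiner (R : I.H.Subgraph) : Prop := IsSteinerTree R (Sum.inl '' I.terminals)

variable {I} in
/-- A choice of a minimum separator for every long maximal degree-2 path and each of its
endpoints. -/
def IsSeparatorChoice {R : I.H.Subgraph}
    (sep : LongPath R (I.alphaLong c) → Finset (V ⊕ F)) : Prop :=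
  ∀ P, IsMinSeparator I.H (sep P) (P.partA (I.alphaPat c)) (P.partB (I.alphaPat c))

/-- A path of `G`, given by its sequence of vertices. -/
structure GPath where
  src : V
  tgt : V
  walk : I.G.graph.Walk src tgt
  isPath : walk.IsPath

variable {I} in
/-- `x` is a vertex of the path `Q` of `G`, seen in the radial completion. -/
def GPath.Contains (Q : I.GPath) (x : V ⊕ F) : Prop := ∃ v ∈ Q.walk.support, Sum.inl v = x

variable {I} {c} in
/-- A flow for the long path `P`: a collection of pairwise vertex-disjoint paths of `G`, each with
one endpoint in each of the two separators of `P`, that stay in the middle region. -/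
def IsFlow {R : I.H.Subgraph} (sep : LongPath R (I.alphaLong c) → Finset (V ⊕ F))
    (P : LongPath R (I.alphaLong c)) (flow : Set I.GPath) : Prop :=
  (∀ Q ∈ flow, (Sum.inl Q.src ∈ sep P ∧ Sum.inl Q.tgt ∈ sep P.rev ∨
      Sum.inl Q.src ∈ sep P.rev ∧ Sum.inl Q.tgt ∈ sep P) ∧
    ∀ x, Q.Contains x → x ∈ P.midRegion sep) ∧
  ∀ Q ∈ flow, ∀ Q' ∈ flow, Q ≠ Q' → ∀ x, ¬ (Q.Contains x ∧ Q'.Contains x)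

variable {I} in
/-- The path `p` respects the flow: it never visits a flow path, then a different one, and then
the first one again. -/
def RespectsFlow {a b : V ⊕ F} (p : I.H.Walk a b) (flow : Set I.GPath) : Prop :=
  ¬ ∃ i j l : ℕ, i < j ∧ j < l ∧ l ≤ p.length ∧
    ∃ Q ∈ flow, ∃ Q' ∈ flow, Q ≠ Q' ∧
      Q.Contains (p.getVert i) ∧ Q'.Contains (p.getVert j) ∧ Q.Contains (p.getVert l)

variable {I} {c} in
/-- A choice, for every long maximal degree-2 path, of a flow and of a flow-respecting path
between `u'` and `v'` that stays in the middle region. Every flow is allowed, in particular one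
that has maximum size and, subject to this, optimises any secondary criterion. -/
structure Rerouting {R : I.H.Subgraph}
    (sep : LongPath R (I.alphaLong c) → Finset (V ⊕ F)) where
  flow : LongPath R (I.alphaLong c) → Set I.GPath
  flow_rev : ∀ P, flow P.rev = flow P
  isFlow : ∀ P, IsFlow sep P (flow P)
  star : LongPath R (I.alphaLong c) → I.H.Subgraph
  star_rev : ∀ P, star P.rev = star P
  star_spec : ∀ P, ∃ p : I.H.Walk (P.cut sep) (P.rev.cut sep),
    p.IsPath ∧ star P = p.toSubgraph ∧ (∀ x ∈ p.support, x ∈ P.midRegion sep) ∧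
    RespectsFlow p (flow P)

variable {I} {c} in
/-- The result of replacing in `R`, for every long maximal degree-2 path, the subpath between
`u'` and `v'` by the chosen path. -/
def Rerouting.result {R : I.H.Subgraph} {sep : LongPath R (I.alphaLong c) → Finset (V ⊕ F)}
    (X : Rerouting sep) : I.H.Subgraph :=
  (R.deleteVerts (⋃ P, LongPath.midInternal sep P)).deleteEdges (⋃ P, LongPath.midEdges sep P) ⊔
    ⨆ P, X.star P

variable {I} {c} in
/-- The union of the vertex set of the subpath between `u` and `u'` and of the vertex set of the
component of `u` in `R'` after the other vertices of this subpath are deleted. -/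
def partAStar {R : I.H.Subgraph} (sep : LongPath R (I.alphaLong c) → Finset (V ⊕ F))
    (R' : I.H.Subgraph) (P : LongPath R (I.alphaLong c)) : Set (V ⊕ F) :=
  {w | w ∈ (P.startPath sep).support} ∪
    component (R'.deleteVerts ({w | w ∈ (P.startPath sep).support} \ {P.src})) P.src

end PDPInstance

end PDP

/-! ### Vanishing of the first cohomology of the sphere, over the field with two elements. -/

namespace PDP

open Module

namespace PlaneMap

variable {V D F : Type*} (G : PlaneMap V D F)

/-! Write `N = 2 ^ (c * k)`. Everything rests on two properties of the chosen separators: each has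
at most `2 * N + 3` vertices and induces a connected subgraph of `H`. Hence a separator lies within
distance `2 * N + 2` of its cut vertex on the path. In a tree without detours, distances in `H` are
at least differences of positions along a long path (`LongPath.pos_le_pos_add`), so separators
belonging to different ends or different paths are disjoint.

Planarity enters only through the vanishing of the first cohomology of the sphere with coefficients
in `ZMod 2`. Vertices and faces, corners, and edges form a cochain complex, and Euler's formula
gives exactness at the corners by a dimension count (`PlaneGraph.exists_potential`). Three facts
follow by writing down suitable cocycles: a minimal separator of two connected sets is connected
(`IsMinimalSeparator.connected`); two boundary vertices of a face that are connected off the face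
lie on one boundary walk (`PlaneGraph.exists_boundary_walk`); and a minimal separator of two
vertices has at most one more face than it has vertices of `G` (`PlaneGraph.card_faces_le`).

The size bound is `PlaneGraph.exists_small_separator`. Suppose every separator of two distant
connected sets is large. Each distance level between them contains a minimal separator, a connected
ring. For any bag of a tree decomposition, all rings that keep away from the bag lie in one
component of `G` minus the bag, since otherwise the bag and at most one more face than it has
vertices would give a small separator. Any two bags leave a common ring free, so these components
form a haven, contradicting the treewidth bound (`false_of_haven`).

The middle region of `P` is connected and misses the separators of every other long path `Q`, so it
lies in one component left by the separators of `Q`. The cut vertex of `P` identifies it as the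
component of an endpoint of `Q`. This is part 1 (`SmallSeparators.midRegion_subset_comp`).

For the rerouted graph, a tree vertex in the middle region of `P` lies on the part of `P` between
the two cuts. So the new path of `P` meets the kept part of the tree only at the cuts and meets no
other new path. Connectivity is carried over along walks of the old tree, and acyclicity is shown by
giving, for each edge, a two-colouring that changes only along this edge (`isTree_coe_of_cuts`).
Degrees can change only between 0 and 2 (`ReroutingPaths.deg_cases`), which preserves leaves, branch
vertices and maximal degree-2 paths. The vertices of the new tree in the component of the source are
exactly those of the start part other than the cut vertex, which gives the separation in part 3. -/

theorem rev_ne (d : D) : G.rev d ≠ d := fun h => G.loopless d (by rw [h])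

theorem face_rot (d : D) : G.face (G.rot d) = G.face (G.rev d) := by
  have := G.face_next (G.rev d)
  rwa [G.rev_rev] at this

theorem tail_rot (d : D) : G.tail (G.rot d) = G.tail d := by
  rw [← G.rot_orbit]
  exact Equiv.Perm.SameCycle.symm ⟨1, by simp⟩

theorem tail_next (d : D) : G.tail (G.rot (G.rev d)) = G.head d := G.tail_rot _

theorem head_rev (d : D) : G.head (G.rev d) = G.tail d := by rw [head, G.rev_rev]

/-- The non-isolated connected components. -/
abbrev DartComponent :=
  {K : G.graph.ConnectedComponent // ∃ d, G.graph.connectedComponentMk (G.tail d) = K}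

/-- The isolated vertices. -/
abbrev Isolated := {v : V // ∀ d, G.tail d ≠ v}

/-- An isolated vertex is a component by itself and is the tail of no dart, so the two families
inject disjointly into the components. -/
theorem card_dartComponent_add_card_isolated [Finite V] :
    Nat.card G.DartComponent + Nat.card G.Isolated ≤ Nat.card G.graph.ConnectedComponent := by
  have : Finite G.DartComponent := Subtype.finite
  have : Finite G.Isolated := Subtype.finite
  rw [← Nat.card_sum]
  have key : ∀ v : V, (∀ d, G.tail d ≠ v) → ∀ w, G.graph.Reachable v w → v = w := by
    rintro v hv w ⟨p⟩
    cases p with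
    | nil => rfl
    | cons h _ =>
      obtain ⟨d, hd, -⟩ := h
      exact absurd hd (hv d)
  refine Nat.card_le_card_of_injective
    (Sum.elim (fun K => K.1) fun v => G.graph.connectedComponentMk v.1) ?_
  rintro (⟨K, d, rfl⟩ | ⟨v, hv⟩) (⟨K', d', rfl⟩ | ⟨v', hv'⟩) h
  · simp only [Sum.elim_inl] at h
    congr 1
    exact Subtype.ext h
  · simp only [Sum.elim_inl, Sum.elim_inr, SimpleGraph.ConnectedComponent.eq] at h
    exact absurd (key v' hv' _ h.symm).symm (hv' d)
  · simp only [Sum.elim_inl, Sum.elim_inr, SimpleGraph.ConnectedComponent.eq] at h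
    exact absurd (key v hv _ h).symm (hv d')
  · simp only [Sum.elim_inr, SimpleGraph.ConnectedComponent.eq] at h
    congr 1
    exact Subtype.ext (key v hv _ h)

/-- Since `rev` is an involution without fixed points, any linear order on the darts selects one
dart of each edge. -/
theorem exists_orientation [Finite D] :
    ∃ E : Set D, (∀ d, d ∈ E ↔ G.rev d ∉ E) ∧ Nat.card D = 2 * Nat.card E := by
  obtain ⟨e⟩ : Nonempty (D ≃ Fin (Nat.card D)) := ⟨Finite.equivFin D⟩
  have hE : ∀ d, d ∈ {d | e d < e (G.rev d)} ↔ G.rev d ∉ {d | e d < e (G.rev d)} := by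
    intro d
    have h1 : e d ≠ e (G.rev d) := fun h => G.rev_ne d (e.injective h).symm
    simp only [Set.mem_ofPred_eq, G.rev_rev, not_lt]
    exact ⟨le_of_lt, fun h => lt_of_le_of_ne h h1⟩
  refine ⟨{d | e d < e (G.rev d)}, hE, ?_⟩
  set E := {d | e d < e (G.rev d)}
  have h1 : (Eᶜ).ncard = E.ncard := by
    have : Eᶜ = G.rev '' E := by
      ext d
      constructor
      · intro hd
        refine ⟨G.rev d, ?_, G.rev_rev d⟩
        by_contra h
        exact hd ((hE d).2 h)
      · rintro ⟨x, hx, rfl⟩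
        exact (hE x).1 hx
    rw [this, Set.ncard_image_of_injective]
    intro a b h
    rw [← G.rev_rev a, ← G.rev_rev b, h]
  have h2 := Set.ncard_add_ncard_compl E
  rw [h1] at h2
  rw [Nat.card_coe_set_eq, ← h2]
  ring

/-- The coboundary of a function on the vertices and faces, as a function on the corners. -/
def coboundary : (V ⊕ F → ZMod 2) →ₗ[ZMod 2] (D → ZMod 2) where
  toFun ψ d := ψ (.inl (G.tail d)) + ψ (.inr (G.face d))
  map_add' _ _ := by ext; simp only [Pi.add_apply]; ring
  map_smul' _ _ := by ext; simp only [Pi.smul_apply, smul_eq_mul, RingHom.id_apply]; ring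

/-- The sum of a function over the four corners at an edge, for one dart of each edge. -/
def edgeSum (E : Set D) : (D → ZMod 2) →ₗ[ZMod 2] (E → ZMod 2) where
  toFun c d := c d + c (G.rot (G.rev d)) + c (G.rev d) + c (G.rot d)
  map_add' _ _ := by ext; simp only [Pi.add_apply]; ring
  map_smul' _ _ := by ext; simp only [Pi.smul_apply, smul_eq_mul, RingHom.id_apply]; ring

/-- The two corners lie in the same face, whose value cancels. The two sides of an edge thus give
the same sum, which is why `edgeSum` kills coboundaries. -/
theorem coboundary_add_next (ψ : V ⊕ F → ZMod 2) (d : D) :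
    G.coboundary ψ d + G.coboundary ψ (G.rot (G.rev d)) =
      ψ (.inl (G.tail d)) + ψ (.inl (G.head d)) := by
  simp only [coboundary, LinearMap.coe_mk, AddHom.coe_mk, G.tail_next, G.face_next]
  have : ψ (.inr (G.face d)) + ψ (.inr (G.face d)) = 0 := CharTwo.add_self_eq_zero _
  linear_combination this

theorem range_coboundary_le (E : Set D) :
    LinearMap.range G.coboundary ≤ LinearMap.ker (G.edgeSum E) := by
  rintro _ ⟨ψ, rfl⟩
  rw [LinearMap.mem_ker]
  ext d
  have h1 := G.coboundary_add_next ψ d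
  have h2 := G.coboundary_add_next ψ (G.rev d)
  rw [G.rev_rev, G.head_rev] at h2
  have h3 : ∀ x : ZMod 2, x + x = 0 := CharTwo.add_self_eq_zero
  simp only [edgeSum, LinearMap.coe_mk, AddHom.coe_mk, Pi.zero_apply]
  rw [h1, add_assoc, h2]
  simp only [head]
  linear_combination h3 (ψ (.inl (G.tail d))) + h3 (ψ (.inl (G.tail (G.rev d))))

-- A functional that annihilates the range takes equal values on consecutive edges around a vertex,
-- hence is constant on the edges of each component. One value per component with an edge determines
-- it.
open Classical in
theorem finrank_dualAnnihilator_range_edgeSum_le [Finite V] [Finite D] (E : Set D)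
    (hE : ∀ d, d ∈ E ↔ G.rev d ∉ E) :
    finrank (ZMod 2) (LinearMap.range (G.edgeSum E)).dualAnnihilator ≤
      Nat.card G.DartComponent := by
  have : Fintype D := Fintype.ofFinite D
  have : Finite G.DartComponent := Subtype.finite
  have : Fintype G.DartComponent := Fintype.ofFinite _
  -- the function on the darts that a functional induces
  let σ : D → (E → ZMod 2) := fun d e =>
    (Pi.single d 1 : D → ZMod 2) e + (Pi.single (G.rev d) 1 : D → ZMod 2) e
  have hσ : ∀ d, σ (G.rev d) = σ d := by
    intro d
    ext e
    simp only [σ, G.rev_rev]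
    exact add_comm _ _
  -- The corner between `d` and `rot d` lies on the quadrilaterals of the edges of `d` and of `rot
  -- d`; `σ` is the indicator of an edge.
  have hM : ∀ d, G.edgeSum E (Pi.single (G.rot d) 1) = σ (G.rot d) + σ d := by
    intro d
    ext e
    have e1 : G.rot (G.rev e) = G.rot d ↔ (e : D) = G.rev d := by
      rw [G.rot.injective.eq_iff]
      exact ⟨fun h => by rw [← h, G.rev_rev], fun h => by rw [h, G.rev_rev]⟩
    have e2 : G.rot e = G.rot d ↔ (e : D) = d := G.rot.injective.eq_iff
    have e3 : G.rev e = G.rot d ↔ (e : D) = G.rev (G.rot d) :=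
      ⟨fun h => by rw [← h, G.rev_rev], fun h => by rw [h, G.rev_rev]⟩
    simp only [edgeSum, LinearMap.coe_mk, AddHom.coe_mk, Pi.single_apply, σ, Pi.add_apply, e1, e2,
      e3]
    ring
  let ev : (LinearMap.range (G.edgeSum E)).dualAnnihilator →ₗ[ZMod 2]
      (G.DartComponent → ZMod 2) :=
    { toFun := fun f K => f.1 (σ K.2.choose)
      map_add' := fun _ _ => rfl
      map_smul' := fun _ _ => rfl }
  have hinj : Function.Injective ev := by
    rw [← LinearMap.ker_eq_bot, LinearMap.ker_eq_bot']
    intro f hf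
    have hrot : ∀ d, f.1 (σ (G.rot d)) = f.1 (σ d) := by
      intro d
      have h := (Submodule.mem_dualAnnihilator f.1).1 f.2 _ ⟨_, hM d⟩
      rw [map_add] at h
      exact (CharTwo.add_eq_zero).1 h
    have hcyc : ∀ d e, G.tail d = G.tail e → f.1 (σ d) = f.1 (σ e) := by
      intro d e h
      rw [← G.rot_orbit] at h
      obtain ⟨n, -, rfl⟩ := h.exists_pow_eq'
      clear h
      induction n with
      | zero => rfl
      | succ n ih => rw [pow_succ', Equiv.Perm.mul_apply, hrot, ← ih]
    have hreach : ∀ v w, G.graph.Walk v w → ∀ d e, G.tail d = v → G.tail e = w →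
        f.1 (σ d) = f.1 (σ e) := by
      intro v w p
      induction p with
      | nil => exact fun d e hd he => hcyc d e (hd.trans he.symm)
      | cons h _ ih =>
        obtain ⟨x, hx, hx'⟩ := h
        intro d e hd he
        rw [hcyc d x (hd.trans hx.symm), ← hσ, ih (G.rev x) e hx' he]
    have hzero : ∀ d, f.1 (σ d) = 0 := by
      intro d
      let K : G.DartComponent := ⟨_, d, rfl⟩
      have h1 := congrFun hf K
      have h2 : G.graph.Reachable (G.tail K.2.choose) (G.tail d) :=
        SimpleGraph.ConnectedComponent.exact K.2.choose_spec
      obtain ⟨p⟩ := h2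
      rw [← hreach _ _ p _ d rfl rfl]
      exact h1
    apply Subtype.ext
    refine LinearMap.pi_ext' fun e => LinearMap.ext_ring ?_
    have h1 : σ e = Pi.single e 1 := by
      ext x
      have h2 : (x : D) ≠ G.rev e := by
        intro h
        have := (hE e).1 e.2
        rw [← h] at this
        exact this x.2
      simp only [σ, Pi.single_apply, h2, if_false, add_zero, Subtype.ext_iff]
    have := hzero e
    rw [h1] at this
    simpa using this
  have := LinearMap.finrank_le_finrank_of_injective hinj
  rwa [finrank_fintype_fun_eq_card, ← Nat.card_eq_fintype_card] at this

/-- A cocycle agrees across every corner. Isolated vertices have no corners, so each contributes one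
free jump; apart from that, connectedness leaves a single constant. -/
theorem finrank_ker_coboundary_le [Finite V] [Finite F] (hconn : G.radial.Connected) :
    finrank (ZMod 2) (LinearMap.ker G.coboundary) ≤ 1 + Nat.card G.Isolated := by
  have : Finite G.Isolated := Subtype.finite
  have : Fintype G.Isolated := Fintype.ofFinite _
  let ev : LinearMap.ker G.coboundary →ₗ[ZMod 2] (ZMod 2 × (G.Isolated → ZMod 2)) :=
    { toFun := fun ψ => (ψ.1 (.inr G.outer),
        fun v => ψ.1 (.inl v.1) + ψ.1 (.inr (G.isoFace v.1)))
      map_add' := fun a b => by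
        ext
        · rfl
        · simp only [Submodule.coe_add, Pi.add_apply, Prod.mk_add_mk]; ring
      map_smul' := fun a b => by
        ext
        · rfl
        · simp only [Submodule.coe_smul, Pi.smul_apply, Prod.smul_mk, RingHom.id_apply,
            smul_eq_mul]; ring }
  have hinj : Function.Injective ev := by
    rw [← LinearMap.ker_eq_bot, LinearMap.ker_eq_bot']
    intro ψ hψ
    have h1 : ψ.1 (.inr G.outer) = 0 := congrArg Prod.fst hψ
    have h2 : ∀ v : G.Isolated, ψ.1 (.inl v.1) + ψ.1 (.inr (G.isoFace v.1)) = 0 :=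
      fun v => congrFun (congrArg Prod.snd hψ) v
    have h3 : ∀ d, ψ.1 (.inl (G.tail d)) + ψ.1 (.inr (G.face d)) = 0 :=
      fun d => congrFun (LinearMap.mem_ker.1 ψ.2) d
    have hinc : ∀ v f, G.Inc v f → ψ.1 (.inl v) = ψ.1 (.inr f) := by
      rintro v f (⟨d, rfl, rfl⟩ | ⟨hv, rfl⟩)
      · exact CharTwo.add_eq_zero.1 (h3 d)
      · exact CharTwo.add_eq_zero.1 (h2 ⟨v, hv⟩)
    have hadj : ∀ a b, G.radial.Adj a b → ψ.1 a = ψ.1 b := by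
      rintro (a | f) (b | f') h
      · obtain ⟨d, rfl, rfl⟩ := h
        rw [hinc _ (G.face d) (Or.inl ⟨d, rfl, rfl⟩),
          hinc _ (G.face d) (Or.inl ⟨G.rot (G.rev d), G.tail_next d, G.face_next d⟩)]
      · exact hinc _ _ h
      · exact (hinc _ _ h).symm
      · exact h.elim
    have hwalk : ∀ a b, G.radial.Walk a b → ψ.1 a = ψ.1 b := by
      intro a b p
      induction p with
      | nil => rfl
      | cons h _ ih => exact (hadj _ _ h).trans ih
    apply Subtype.ext
    funext x
    obtain ⟨p⟩ := hconn.preconnected x (.inr G.outer)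
    rw [hwalk _ _ p, h1]
    rfl
  have := LinearMap.finrank_le_finrank_of_injective hinj
  rwa [finrank_prod, finrank_self, finrank_fintype_fun_eq_card, ← Nat.card_eq_fintype_card] at this

end PlaneMap

namespace PlaneGraph

variable {V D F : Type*} [Finite V] [Finite D] [Finite F] (G : PlaneGraph V D F)

/-- A function on the corners whose sum over the four corners at every edge vanishes is a
coboundary: the first cohomology group of the sphere vanishes. -/
theorem exists_potential_corner (c : D → ZMod 2)
    (hc : ∀ d, c d + c (G.rot (G.rev d)) = c (G.rev d) + c (G.rot d)) :
    ∃ ψ : V ⊕ F → ZMod 2, ∀ d, c d = ψ (.inl (G.tail d)) + ψ (.inr (G.face d)) := by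
  have : Fintype V := Fintype.ofFinite V
  have : Fintype D := Fintype.ofFinite D
  have : Fintype F := Fintype.ofFinite F
  obtain ⟨E, hE, hcard⟩ := G.exists_orientation
  have : Fintype E := Fintype.ofFinite E
  have h1 := G.finrank_dualAnnihilator_range_edgeSum_le E hE
  have h2 := G.finrank_ker_coboundary_le G.connected
  have h3 := G.card_dartComponent_add_card_isolated
  have h4 := LinearMap.finrank_range_add_finrank_ker (G.edgeSum E)
  have h5 := LinearMap.finrank_range_add_finrank_ker G.coboundary
  have h6 := Subspace.finrank_add_finrank_dualAnnihilator_eq (LinearMap.range (G.edgeSum E))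
  have h7 := G.euler
  simp only [finrank_fintype_fun_eq_card, ← Nat.card_eq_fintype_card, Nat.card_sum]
    at h4 h5 h6
  have h8 : LinearMap.range G.coboundary = LinearMap.ker (G.edgeSum E) := by
    -- The range has dimension at least `|V| + |F| - 1` minus the number of isolated vertices, the
    -- kernel at most `|E|` plus the number of components with an edge. By Euler's formula the first
    -- bound is at least the second.
    apply Submodule.eq_of_le_of_finrank_le (G.range_coboundary_le E)
    omega
  have h9 : c ∈ LinearMap.ker (G.edgeSum E) := by
    rw [LinearMap.mem_ker]
    ext d
    simp only [PlaneMap.edgeSum, LinearMap.coe_mk, AddHom.coe_mk, Pi.zero_apply]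
    rw [hc, add_assoc]
    exact CharTwo.add_self_eq_zero _
  rw [← h8] at h9
  obtain ⟨ψ, rfl⟩ := h9
  exact ⟨ψ, fun d => rfl⟩

/-- A version of `exists_potential_corner` that prescribes values at the isolated vertices. -/
theorem exists_potential (c : D → ZMod 2)
    (hc : ∀ d, c d + c (G.rot (G.rev d)) = c (G.rev d) + c (G.rot d)) (t : V → ZMod 2) :
    ∃ ψ : V ⊕ F → ZMod 2, (∀ d, c d = ψ (.inl (G.tail d)) + ψ (.inr (G.face d))) ∧
      ∀ v, (∀ d, G.tail d ≠ v) → t v = ψ (.inl v) + ψ (.inr (G.isoFace v)) := by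
  classical
  obtain ⟨ψ, hψ⟩ := G.exists_potential_corner c hc
  refine ⟨Sum.elim (fun v => if ∀ d, G.tail d ≠ v then t v + ψ (.inr (G.isoFace v))
    else ψ (.inl v)) fun f => ψ (.inr f), ?_, ?_⟩
  · intro d
    have : ¬ ∀ e, G.tail e ≠ G.tail d := fun h => h d rfl
    simp only [Sum.elim_inl, Sum.elim_inr, if_neg this]
    exact hψ d
  · intro v hv
    simp only [Sum.elim_inl, Sum.elim_inr]
    rw [if_pos hv, add_assoc, CharTwo.add_self_eq_zero, add_zero]

end PlaneGraph

end PDP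

/-! ### Minimal separators and their structure in the radial completion. -/

namespace PDP

open Module

section Separators

variable {W : Type*} {H : SimpleGraph W}

/-- There is a walk from `a` to `b` in `H - S`. -/
def Avoid (H : SimpleGraph W) (S : Set W) (a b : W) : Prop :=
  ∃ p : H.Walk a b, ∀ x ∈ p.support, x ∉ S

namespace Avoid

variable {S S' : Set W} {a b c : W}

theorem refl (h : a ∉ S) : Avoid H S a a := ⟨.nil, by simpa using h⟩

theorem left (h : Avoid H S a b) : a ∉ S := by
  obtain ⟨p, hp⟩ := h
  exact hp _ p.start_mem_support

theorem right (h : Avoid H S a b) : b ∉ S := by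
  obtain ⟨p, hp⟩ := h
  exact hp _ p.end_mem_support

theorem symm (h : Avoid H S a b) : Avoid H S b a := by
  obtain ⟨p, hp⟩ := h
  exact ⟨p.reverse, by simpa using hp⟩

theorem trans (h : Avoid H S a b) (h' : Avoid H S b c) : Avoid H S a c := by
  obtain ⟨p, hp⟩ := h
  obtain ⟨q, hq⟩ := h'
  refine ⟨p.append q, fun x hx => ?_⟩
  rw [SimpleGraph.Walk.mem_support_append_iff] at hx
  exact hx.elim (hp x) (hq x)

theorem of_adj (h : H.Adj a b) (ha : a ∉ S) (hb : b ∉ S) : Avoid H S a b :=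
  ⟨h.toWalk, by
    intro x hx
    simp only [SimpleGraph.Adj.toWalk, SimpleGraph.Walk.support_cons,
      SimpleGraph.Walk.support_nil, List.mem_cons, List.not_mem_nil, or_false] at hx
    rcases hx with rfl | rfl <;> assumption⟩

theorem mono (hS : S' ⊆ S) (h : Avoid H S a b) : Avoid H S' a b := by
  obtain ⟨p, hp⟩ := h
  exact ⟨p, fun x hx hx' => hp x hx (hS hx')⟩

theorem induct {P : W → Prop} (h : Avoid H S a b)
    (hP : ∀ x y, H.Adj x y → x ∉ S → y ∉ S → P x → P y) (ha : P a) : P b := by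
  obtain ⟨p, hp⟩ := h
  induction p with
  | nil => exact ha
  | cons h q ih =>
    refine ih (hP _ _ h (hp _ (by simp)) (hp _ (by simp)) ha) fun x hx => hp x (by simp [hx])

theorem mem_of_disjoint {T : Set W} (h : Avoid H S a b) (h' : ∀ x, Avoid H S a x → x ∉ T) :
    Avoid H T a b := by
  have : Avoid H S a b ∧ Avoid H T a b := by
    refine h.induct (P := fun x => Avoid H S a x ∧ Avoid H T a x) ?_
      ⟨refl h.left, refl (h' _ (refl h.left))⟩
    rintro x y hxy hx hy ⟨h1, h2⟩
    have h3 := h1.trans (of_adj hxy hx hy)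
    exact ⟨h3, h2.trans (of_adj hxy (h' x h1) (h' y h3))⟩
  exact this.2

end Avoid

theorem separates_iff {S A B : Set W} :
    Separates H S A B ↔ ∀ a ∈ A, ∀ b ∈ B, ¬ Avoid H S a b := by
  classical
  constructor
  · rintro h a ha b hb ⟨p, hp⟩
    obtain ⟨s, hs, hs'⟩ := h a ha b hb p.bypass p.bypass_isPath
    exact hp s (p.support_bypass_subset_support hs') hs
  · intro h a ha b hb p _
    by_contra! hcon
    exact h a ha b hb ⟨p, fun x hx hx' => hcon x hx' hx⟩

/-- `S` is an inclusion-minimal separator of `A` from `B`, and each of `A` and `B` lies in one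
component of `H - S`. -/
structure IsMinimalSeparator (H : SimpleGraph W) (S A B : Set W) : Prop where
  separates : ∀ a ∈ A, ∀ b ∈ B, ¬ Avoid H S a b
  minimal : ∀ s ∈ S, ∃ a ∈ A, ∃ b ∈ B, Avoid H (S \ {s}) a b
  left : ∀ a ∈ A, ∀ a' ∈ A, Avoid H S a a'
  right : ∀ b ∈ B, ∀ b' ∈ B, Avoid H S b b'

/-- Deleting fewer vertices keeps `A` and `B` each within one component, so an inclusion-minimal
separating subset of `N` inherits all requirements. -/
theorem exists_isMinimalSeparator [Finite W] {N A B : Set W}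
    (hN : ∀ a ∈ A, ∀ b ∈ B, ¬ Avoid H N a b)
    (hA : ∀ a ∈ A, ∀ a' ∈ A, Avoid H N a a') (hB : ∀ b ∈ B, ∀ b' ∈ B, Avoid H N b b') :
    ∃ S ⊆ N, IsMinimalSeparator H S A B := by
  obtain ⟨S, hSN, hS⟩ := exists_minimal_le_of_wellFoundedLT
    (fun S : Set W => ∀ a ∈ A, ∀ b ∈ B, ¬ Avoid H S a b) N hN
  refine ⟨S, hSN, hS.1, fun s hs => ?_, fun a ha a' ha' => (hA a ha a' ha').mono hSN,
    fun a ha a' ha' => (hB a ha a' ha').mono hSN⟩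
  by_contra! hcon
  exact (hS.2 (y := S \ {s}) (fun a ha b hb => hcon a ha b hb) Set.sdiff_subset hs).2 rfl

namespace IsMinimalSeparator

variable {S A B : Set W}

theorem symm (h : IsMinimalSeparator H S A B) : IsMinimalSeparator H S B A where
  separates b hb a ha hab := h.separates a ha b hb hab.symm
  minimal s hs := by
    obtain ⟨a, ha, b, hb, hab⟩ := h.minimal s hs
    exact ⟨b, hb, a, ha, hab.symm⟩
  left := h.right
  right := h.left

/-- Restoring `s` opens a walk from `A` to `B`. Up to its first visit of `S`, which must be at `s`,
this walk stays in the component of `A`. -/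
theorem exists_adj (h : IsMinimalSeparator H S A B) {a : W} (ha : a ∈ A) {s : W} (hs : s ∈ S) :
    ∃ x, H.Adj x s ∧ Avoid H S a x := by
  obtain ⟨a', ha', b, hb, p, hp⟩ := h.minimal s hs
  have key : ∀ x y (q : H.Walk x y), (∀ z ∈ q.support, z ∉ S \ {s}) → x ∉ S → ¬ Avoid H S x y →
      ∃ z, H.Adj z s ∧ Avoid H S x z := by
    intro x y q
    induction q with
    | nil => exact fun _ hx hxy => absurd (Avoid.refl hx) hxy
    | @cons x y z hxy q ih =>
      intro hq hx hxz
      by_cases hy : y ∈ S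
      · have : y = s := by
          by_contra hne
          exact hq y (by simp) ⟨hy, hne⟩
        exact ⟨x, this ▸ hxy, Avoid.refl hx⟩
      · have h1 := Avoid.of_adj hxy hx hy
        obtain ⟨w, hw, hw'⟩ := ih (fun z hz => hq z (by simp [hz])) hy
          fun h => hxz (h1.trans h)
        exact ⟨w, hw, h1.trans hw'⟩
  obtain ⟨x, hx, hx'⟩ := key a' b p hp (h.left a' ha' a' ha').left (h.separates a' ha' b hb)
  exact ⟨x, hx, (h.left a ha a' ha').trans hx'⟩

theorem exists_adj' (h : IsMinimalSeparator H S A B) {b : W} (hb : b ∈ B) {s : W} (hs : s ∈ S) :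
    ∃ x, H.Adj x s ∧ Avoid H S b x := h.symm.exists_adj hb hs

end IsMinimalSeparator

/-- Every function on the edges of `H` that sums to zero on every triangle is a coboundary. -/
def TriangleExact (H : SimpleGraph W) : Prop :=
  ∀ φ : W → W → ZMod 2, (∀ a b, φ a b = φ b a) →
    (∀ a b c, H.Adj a b → H.Adj b c → H.Adj a c → φ a b + φ b c = φ a c) →
    ∃ ψ : W → ZMod 2, ∀ a b, H.Adj a b → φ a b = ψ a + ψ b

open Classical in
/-- A minimal separator of two connected sets induces a connected graph. -/
theorem IsMinimalSeparator.connected (hH : TriangleExact H) {S A B : Set W}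
    (h : IsMinimalSeparator H S A B) {s t : W} (hs : s ∈ S) (ht : t ∈ S) : Avoid H Sᶜ s t := by
  by_contra hst
  obtain ⟨a, ha, b, hb, -⟩ := h.minimal s hs
  let C : W → Prop := fun x => Avoid H S a x
  let S₁ : W → Prop := fun x => Avoid H Sᶜ s x
  have hS₁ : ∀ x, S₁ x → x ∈ S := fun x hx => not_not.1 hx.right
  have hC : ∀ x, C x → x ∉ S := fun x hx => hx.right
  have hstep : ∀ x y, H.Adj x y → C x → y ∉ S → C y :=
    fun x y hxy hx hy => hx.trans (Avoid.of_adj hxy (hC x hx) hy)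
  have hstep' : ∀ x y, H.Adj x y → S₁ x → y ∈ S → S₁ y :=
    fun x y hxy hx hy => hx.trans (Avoid.of_adj hxy (not_not.2 (hS₁ x hx)) (not_not.2 hy))
  -- The indicator of the edges between the component `C` of `A` and the part `S₁` of the separator
  -- connected to `s`. It sums to zero on triangles: by `h3`, a third vertex adjacent to both ends
  -- of such an edge lies in `S₁` or in `C`, so exactly two edges count.
  let φ : W → W → ZMod 2 := fun x y => if S₁ x ∧ C y ∨ S₁ y ∧ C x then 1 else 0
  have key : ∀ x, (S₁ x ∧ ¬ C x ∧ x ∈ S) ∨ (¬ S₁ x ∧ C x ∧ x ∉ S) ∨ (¬ S₁ x ∧ ¬ C x) := by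
    intro x
    by_cases h1 : S₁ x
    · exact Or.inl ⟨h1, fun h2 => hC x h2 (hS₁ x h1), hS₁ x h1⟩
    · by_cases h2 : C x
      · exact Or.inr (Or.inl ⟨h1, h2, hC x h2⟩)
      · exact Or.inr (Or.inr ⟨h1, h2⟩)
  have h3 : ∀ x y z, H.Adj x z → H.Adj y z → S₁ x → C y → ¬ S₁ z → ¬ C z → False := by
    intro x y z hxz hyz hx hy hz hz'
    by_cases hzS : z ∈ S
    · exact hz (hstep' _ _ hxz hx hzS)
    · exact hz' (hstep _ _ hyz hy hzS)
  obtain ⟨ψ, hψ⟩ := hH φ (fun x y => by simp only [φ, or_comm]) (by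
    intro x y z hxy hyz hxz
    have e : (1 : ZMod 2) + 1 = 0 := by decide
    rcases key x with ⟨x1, x2, x3⟩ | ⟨x1, x2, x3⟩ | ⟨x1, x2⟩ <;>
    rcases key y with ⟨y1, y2, y3⟩ | ⟨y1, y2, y3⟩ | ⟨y1, y2⟩ <;>
    rcases key z with ⟨z1, z2, z3⟩ | ⟨z1, z2, z3⟩ | ⟨z1, z2⟩ <;>
    simp only [φ, x1, x2, y1, y2, z1, z2, and_self, and_true, and_false, or_self, or_true,
      or_false, if_true, if_false, add_zero, zero_add, e]
    · exact (h3 x y z hxz hyz x1 y2 z1 z2).elim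
    · exact (h3 x z y hxy hyz.symm x1 z2 y1 y2).elim
    · exact (h3 y x z hyz hxz y1 x2 z1 z2).elim
    · exact (h3 z x y hyz.symm hxy z1 x2 y1 y2).elim
    · exact (h3 y z x hxy.symm hxz.symm y1 z2 x1 x2).elim
    · exact (h3 z y x hxz.symm hxy.symm z1 y2 x1 x2).elim)
  have hconst : ∀ x y, Avoid H S x y → ψ x = ψ y := by
    intro x y hxy
    refine hxy.induct (P := fun z => ψ x = ψ z) ?_ rfl
    intro u v huv hu hv hx
    rw [hx]
    have h1 : φ u v = 0 := by
      simp only [φ]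
      rw [if_neg]
      rintro (⟨h1, -⟩ | ⟨h1, -⟩)
      · exact hu (hS₁ _ h1)
      · exact hv (hS₁ _ h1)
    have h2 := hψ u v huv
    rw [h1] at h2
    exact CharTwo.add_eq_zero.1 h2.symm
  have hCB : ∀ y, Avoid H S b y → ¬ C y :=
    fun y hy hCy => h.separates a ha b hb (hCy.trans hy.symm)
  -- Go from `a` to `b` through `r`: only the edge entering `r` from `C` can carry weight. The value
  -- would then be 1 through `s` and 0 through `t`.
  have hval : ∀ r ∈ S, ψ a + ψ b = if S₁ r then 1 else 0 := by
    intro r hr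
    obtain ⟨x, hxr, hx⟩ := h.exists_adj ha hr
    obtain ⟨y, hyr, hy⟩ := h.exists_adj' hb hr
    have h1 := hψ x r hxr
    have h2 := hψ y r hyr
    have hx1 : ¬ S₁ x := fun h => hC x hx (hS₁ x h)
    have hy1 : ¬ S₁ y := fun h => hy.right (hS₁ y h)
    have hx2 : C x := hx
    have hr2 : ¬ C r := fun h => hC r h hr
    simp only [φ, hx1, hx2, hr2, and_true, and_false, false_or] at h1
    simp only [φ, hy1, hCB y hy, hr2, and_false, or_self, if_false] at h2
    rw [h1, hconst a x hx, hconst b y hy, CharTwo.add_eq_zero.1 h2.symm]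
  have h1 := hval s hs
  have h2 := hval t ht
  rw [if_pos (show S₁ s from Avoid.refl (not_not.2 hs))] at h1
  rw [if_neg (show ¬ S₁ t from hst), h1] at h2
  exact absurd h2 (by decide)

end Separators

namespace PlaneMap

variable {V D F : Type*} (G : PlaneMap V D F)

theorem inc_tail (d : D) : G.Inc (G.tail d) (G.face d) := Or.inl ⟨d, rfl, rfl⟩

theorem inc_head (d : D) : G.Inc (G.head d) (G.face d) :=
  Or.inl ⟨G.rot (G.rev d), G.tail_next d, G.face_next d⟩

/-- A function on the darts is the increment of a function along the rotations, if its sum over the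
darts at each vertex vanishes. -/
theorem exists_rot_primitive [Fintype V] [Fintype D] [DecidableEq V] (h : D → ZMod 2)
    (hh : ∀ v, ∑ d with G.tail d = v, h d = 0) :
    ∃ e : D → ZMod 2, ∀ d, e (G.rot d) = e d + h d := by
  classical
  let L : (D → ZMod 2) →ₗ[ZMod 2] (D → ZMod 2) :=
    { toFun := fun e d => e (G.rot d) + e d
      map_add' := fun _ _ => by ext; simp only [Pi.add_apply]; ring
      map_smul' := fun _ _ => by
        ext; simp only [Pi.smul_apply, smul_eq_mul, RingHom.id_apply]; ring }
  have : h ∈ LinearMap.range L := by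
    -- By duality it suffices to test functionals that vanish on the range. They are constant on
    -- rotation orbits, so they only see the sums of `h` around the vertices.
    rw [← Subspace.forall_mem_dualAnnihilator_apply_eq_zero_iff]
    intro f hf
    rw [Submodule.mem_dualAnnihilator] at hf
    have h1 : ∀ d, f (Pi.single (G.rot d) 1) = f (Pi.single d 1) := by
      intro d
      have h2 : L (Pi.single (G.rot d) 1) = Pi.single d 1 + Pi.single (G.rot d) 1 := by
        ext x
        simp only [L, LinearMap.coe_mk, AddHom.coe_mk, Pi.add_apply, Pi.single_apply,
          G.rot.injective.eq_iff]
      have h3 := hf _ ⟨_, h2⟩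
      rw [map_add] at h3
      exact (CharTwo.add_eq_zero.1 h3).symm
    have h2 : ∀ d e, G.tail d = G.tail e → f (Pi.single d 1) = f (Pi.single e 1) := by
      intro d e hde
      rw [← G.rot_orbit] at hde
      obtain ⟨n, -, rfl⟩ := hde.exists_pow_eq'
      clear hde
      induction n with
      | zero => rfl
      | succ n ih => rw [pow_succ', Equiv.Perm.mul_apply, h1, ← ih]
    have h3 : f h = ∑ d, h d * f (Pi.single d 1) := by
      conv_lhs => rw [← Finset.univ_sum_single h]
      rw [map_sum]
      refine Finset.sum_congr rfl fun d _ => ?_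
      rw [← smul_eq_mul, ← map_smul, ← Pi.single_smul, smul_eq_mul, mul_one]
    rw [h3, ← Finset.sum_fiberwise Finset.univ G.tail]
    refine Finset.sum_eq_zero fun v _ => ?_
    by_cases hv : ∃ d, G.tail d = v
    · obtain ⟨d₀, hd₀⟩ := hv
      rw [Finset.sum_congr rfl (g := fun d => h d * f (Pi.single d₀ 1)), ← Finset.sum_mul, hh,
        zero_mul]
      intro d hd
      rw [h2 d d₀ ((Finset.mem_filter.1 hd).2.trans hd₀.symm)]
    · refine Finset.sum_eq_zero fun d hd => ?_
      exact absurd ⟨d, (Finset.mem_filter.1 hd).2⟩ hv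
  obtain ⟨e, rfl⟩ := this
  refine ⟨e, fun d => ?_⟩
  have : e d + e d = 0 := CharTwo.add_self_eq_zero _
  simp only [L, LinearMap.coe_mk, AddHom.coe_mk]
  linear_combination -this

end PlaneMap

namespace PlaneGraph

variable {V D F : Type*} [Finite V] [Finite D] [Finite F] (G : PlaneGraph V D F)

/-- An edge of `G` forms a triangle with the face on either side. Comparing these two triangles
gives the quadrilateral condition for the restriction to corners, so `exists_potential` applies; the
triangles then recover the values on the edges of `G`. -/
theorem triangleExact : TriangleExact G.radial := by
  intro φ hsymm htri
  have h2 : ∀ d, φ (.inl (G.tail d)) (.inr (G.face d)) +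
      φ (.inl (G.tail (G.rot (G.rev d)))) (.inr (G.face (G.rot (G.rev d)))) =
      φ (.inl (G.tail d)) (.inl (G.head d)) := by
    intro d
    rw [G.tail_next, G.face_next, hsymm (.inl (G.head d))]
    exact htri _ _ _ (G.inc_tail d) (G.inc_head d) ⟨d, rfl, rfl⟩
  obtain ⟨ψ, hψ, hiso⟩ := G.exists_potential (fun d => φ (.inl (G.tail d)) (.inr (G.face d)))
    (by
      intro d
      have h3 := h2 (G.rev d)
      rw [G.rev_rev] at h3
      rw [h2 d, h3, G.head_rev, hsymm]
      rfl)
    (fun v => φ (.inl v) (.inr (G.isoFace v)))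
  have hinc : ∀ v f, G.Inc v f → φ (.inl v) (.inr f) = ψ (.inl v) + ψ (.inr f) := by
    rintro v f (⟨d, rfl, rfl⟩ | ⟨hv, rfl⟩)
    · exact hψ d
    · exact hiso v hv
  refine ⟨ψ, ?_⟩
  rintro (a | f) (b | f') h
  · obtain ⟨d, rfl, rfl⟩ := h
    rw [← h2 d, hψ d, hψ, G.tail_next, G.face_next]
    have : ψ (.inr (G.face d)) + ψ (.inr (G.face d)) = 0 := CharTwo.add_self_eq_zero _
    linear_combination this
  · exact hinc _ _ h
  · rw [hsymm, add_comm]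
    exact hinc _ _ h
  · exact h.elim

/-- Two vertices on the boundary of a face that are connected in the complement of this face are
joined by a walk along the boundary of the face. -/
theorem exists_boundary_walk {a b : V} {f : F} (ha : G.Inc a f) (hb : G.Inc b f)
    (hab : Avoid G.radial {.inr f} (.inl a) (.inl b)) :
    ∃ p : G.graph.Walk a b, ∀ v ∈ p.support, G.Inc v f := by
  classical
  have hiso : ∀ v w, (∀ d, G.tail d ≠ v) → G.Inc v f →
      Avoid G.radial {.inr f} (.inl v) (.inl w) → v = w := by
    rintro v w hv hvf ⟨p, hp⟩
    cases p with
    | nil => rfl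
    | @cons _ x _ h q =>
      have hx := hp x (by simp)
      rcases x with x | g
      · obtain ⟨d, hd, -⟩ := h
        exact absurd hd (hv d)
      · rcases h with ⟨d, hd, -⟩ | ⟨-, rfl⟩
        · exact absurd hd (hv d)
        · rcases hvf with ⟨d, hd, -⟩ | ⟨-, h⟩
          · exact absurd hd (hv d)
          · exact (hx (by rw [h]; rfl)).elim
  rcases ha with ⟨d, rfl, rfl⟩ | ⟨hv, rfl⟩
  swap
  · obtain rfl := hiso a b hv (Or.inr ⟨hv, rfl⟩) hab
    exact ⟨.nil, by simpa using hb⟩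
  rcases hb with ⟨e, rfl, hef⟩ | ⟨hv, hbf⟩
  swap
  · obtain rfl := hiso b _ hv (Or.inr ⟨hv, hbf⟩) hab.symm
    exact absurd rfl (hv d)
  let next : D → D := fun d => G.rot (G.rev d)
  -- the boundary walk that contains `d`
  let O : D → Prop := fun x => ∃ n, next^[n] d = x
  have hnext : ∀ x, O x → O (next x) := by
    rintro x ⟨n, rfl⟩
    exact ⟨n + 1, Function.iterate_succ_apply' _ _ _⟩
  have hinj : Function.Injective next := fun x y h => by
    rw [← G.rev_rev x, ← G.rev_rev y, G.rot.injective h]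
  have hnext' : ∀ x, O (next x) → O x := by
    rintro x ⟨n, hn⟩
    -- An injective map of a finite set is periodic, so a boundary walk can also be followed
    -- backwards.
    obtain ⟨m, hm, hper⟩ := (Function.mem_periodicPts.1 (hinj.mem_periodicPts x))
    refine ⟨n + (m - 1), ?_⟩
    rw [add_comm, Function.iterate_add_apply, hn, ← Function.iterate_succ_apply,
      Nat.succ_eq_add_one, Nat.sub_add_cancel hm]
    exact hper
  have hface : ∀ x, O x → G.face x = G.face d := by
    rintro x ⟨n, rfl⟩
    induction n with
    | zero => rfl
    | succ n ih => rw [Function.iterate_succ_apply', G.face_next, ih]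
  have hwalk : ∀ x, O x → ∃ p : G.graph.Walk (G.tail d) (G.tail x), ∀ v ∈ p.support,
      G.Inc v (G.face d) := by
    rintro x ⟨n, rfl⟩
    induction n with
    | zero => exact ⟨.nil, by simpa using G.inc_tail d⟩
    | succ n ih =>
      obtain ⟨p, hp⟩ := ih
      rw [Function.iterate_succ_apply']
      have h1 : G.graph.Adj (G.tail (next^[n] d)) (G.tail (next (next^[n] d))) :=
        ⟨_, rfl, (G.tail_next _).symm⟩
      refine ⟨p.concat h1, ?_⟩
      intro v hv
      rw [SimpleGraph.Walk.support_concat, List.mem_append,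
        List.mem_singleton] at hv
      rcases hv with hv | rfl
      · exact hp v hv
      · exact Or.inl ⟨_, rfl, hface _ ⟨n + 1, Function.iterate_succ_apply' _ _ _⟩⟩
  have hOn : ∀ x, O (G.rot (G.rev x)) ↔ O x := fun x => ⟨hnext' x, hnext x⟩
  -- The indicator of one boundary walk is a cocycle, because consecutive corners of a face lie on
  -- the same walk. Its potential is constant along walks off the face, so it cannot distinguish the
  -- tails of `d` and `e`; hence `e` is on the walk of `d`.
  obtain ⟨ψ, hψ, hψ'⟩ := G.exists_potential (fun x => if O x then 1 else 0) (by
    intro x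
    have h1 := hOn (G.rev x)
    rw [G.rev_rev] at h1
    simp only [hOn, h1, CharTwo.add_self_eq_zero]) (fun _ => 0)
  have hinc : ∀ v g, G.Inc v g → g ≠ G.face d → ψ (.inl v) = ψ (.inr g) := by
    rintro v g (⟨x, rfl, rfl⟩ | ⟨hv, rfl⟩) hg
    · have h1 := hψ x
      rw [if_neg fun h => hg (hface x h)] at h1
      exact CharTwo.add_eq_zero.1 h1.symm
    · exact CharTwo.add_eq_zero.1 (hψ' v hv).symm
  have hconst : ψ (.inl (G.tail d)) = ψ (.inl (G.tail e)) := by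
    refine hab.induct (P := fun x => ψ (.inl (G.tail d)) = ψ x) ?_ rfl
    rintro (v | g) (w | g') h h1 h2 h3
    · obtain ⟨x, rfl, rfl⟩ := h
      have h4 := hψ x
      have h5 := hψ (G.rot (G.rev x))
      simp only [hOn] at h5
      rw [h4, G.tail_next, G.face_next] at h5
      rw [h3]
      exact add_right_cancel h5
    · rw [h3]
      exact hinc v g' h fun h => h2 (by rw [h]; rfl)
    · rw [h3]
      exact (hinc w g h fun h => h1 (by rw [h]; rfl)).symm
    · exact h.elim
  have he := hψ e
  have hd := hψ d
  rw [if_pos (show O d from ⟨0, rfl⟩)] at hd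
  rw [hef, ← hconst, ← hd] at he
  have : O e := by
    by_contra h
    rw [if_neg h] at he
    exact absurd he (by decide)
  exact hwalk e this

/-- A minimal separator of two vertices contains at most one face more than it contains
vertices of the graph. -/
theorem card_faces_le {a b : V} {Z : Set (V ⊕ F)}
    (h : IsMinimalSeparator G.radial Z {.inl a} {.inl b}) :
    {f | Sum.inr f ∈ Z}.ncard ≤ {v | Sum.inl v ∈ Z}.ncard + 1 := by
  classical
  have : Fintype V := Fintype.ofFinite V
  have : Fintype D := Fintype.ofFinite D
  have : Fintype F := Fintype.ofFinite F
  by_contra! hcon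
  let J := {f : F // Sum.inr f ∈ Z}
  let Y := {v : V // Sum.inl v ∈ Z}
  have hJ : Fintype.card J = {f : F | Sum.inr f ∈ Z}.ncard := by
    rw [← Nat.card_eq_fintype_card]
    exact Nat.card_coe_set_eq _
  have hY : Fintype.card Y = {v : V | Sum.inl v ∈ Z}.ncard := by
    rw [← Nat.card_eq_fintype_card]
    exact Nat.card_coe_set_eq _
  obtain ⟨f₀⟩ : Nonempty J := by
    rw [← Fintype.card_pos_iff]
    omega
  let C : V → ZMod 2 := fun v => if Avoid G.radial Z (.inl a) (.inl v) then 1 else 0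
  let ext : (J → ZMod 2) →ₗ[ZMod 2] (F → ZMod 2) :=
    { toFun := fun j f => if hf : Sum.inr f ∈ Z then j ⟨f, hf⟩ else 0
      map_add' := fun x y => by
        ext f
        by_cases hf : Sum.inr f ∈ Z <;> simp [hf]
      map_smul' := fun x y => by
        ext f
        by_cases hf : Sum.inr f ∈ Z <;> simp [hf] }
  -- The change that the quadrilateral condition forces, at a tail in `Z`, when the rotation passes
  -- the dart `d`.
  let incr : (J → ZMod 2) → D → ZMod 2 := fun j d =>
    C (G.head d) * (ext j (G.face d) + ext j (G.face (G.rev d)))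
  let obs : (J → ZMod 2) →ₗ[ZMod 2] ((Y → ZMod 2) × ZMod 2) :=
    { toFun := fun j => (fun y => ∑ d with G.tail d = y.1, incr j d, j f₀)
      map_add' := fun x y => by
        refine Prod.ext ?_ rfl
        ext v
        simp only [Prod.mk_add_mk, Pi.add_apply, ← Finset.sum_add_distrib, incr, map_add]
        exact Finset.sum_congr rfl fun d _ => by ring
      map_smul' := fun x y => by
        refine Prod.ext ?_ rfl
        ext v
        simp only [Prod.smul_mk, Pi.smul_apply, smul_eq_mul, RingHom.id_apply, incr, map_smul,
          Finset.mul_sum]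
        exact Finset.sum_congr rfl fun d _ => by ring }
  -- There are `|Y| + 1` linear conditions: the increments sum to zero around each vertex of `Z`,
  -- and `j` vanishes at `f₀`. By assumption there are more unknowns, so some nonzero `j` satisfies
  -- all of them.
  have hker : LinearMap.ker obs ≠ ⊥ := by
    apply LinearMap.ker_ne_bot_of_finrank_lt
    rw [finrank_prod, finrank_self, finrank_fintype_fun_eq_card, finrank_fintype_fun_eq_card, hJ,
      hY]
    exact hcon
  obtain ⟨j, hj, hj0⟩ := (Submodule.ne_bot_iff _).1 hker
  rw [LinearMap.mem_ker] at hj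
  have hjf₀ : j f₀ = 0 := congrArg Prod.snd hj
  have hobs : ∀ y : Y, ∑ d with G.tail d = y.1, incr j d = 0 :=
    fun y => congrFun (congrArg Prod.fst hj) y
  obtain ⟨f₁, hf₁⟩ : ∃ f₁, j f₁ ≠ 0 := by
    by_contra! h
    exact hj0 (funext h)
  obtain ⟨e, he⟩ := G.exists_rot_primitive
    (fun d => if Sum.inl (G.tail d) ∈ Z then incr j d else 0) (by
      intro v
      by_cases hv : (Sum.inl v : V ⊕ F) ∈ Z
      · rw [← hobs ⟨v, hv⟩]
        refine Finset.sum_congr rfl fun d hd => ?_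
        rw [(Finset.mem_filter.1 hd).2, if_pos hv]
      · refine Finset.sum_eq_zero fun d hd => ?_
        rw [(Finset.mem_filter.1 hd).2, if_neg hv])
  have hCadj : ∀ d, Sum.inl (G.tail d) ∉ Z → Sum.inl (G.head d) ∉ Z →
      C (G.tail d) = C (G.head d) := by
    intro d h1 h2
    have h3 : G.radial.Adj (.inl (G.tail d)) (.inl (G.head d)) := ⟨d, rfl, rfl⟩
    have h4 := Avoid.of_adj h3 h1 h2
    simp only [C]
    congr 1
    exact propext ⟨fun h => h.trans h4, fun h => h.trans h4.symm⟩
  have hCZ : ∀ v, Sum.inl v ∈ Z → C v = 0 := fun v hv => if_neg fun h => h.right hv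
  have two : ∀ x : ZMod 2, x + x = 0 := CharTwo.add_self_eq_zero
  -- At vertices outside `Z` the cocycle is `j` restricted to the component of `a`; at vertices of
  -- `Z` it is the rotation primitive `e`.
  obtain ⟨ψ, hψ, hψ'⟩ := G.exists_potential
    (fun d => if Sum.inl (G.tail d) ∈ Z then e d else C (G.tail d) * ext j (G.face d))
    (by
      intro d
      have h1 := he d
      have h2 := he (G.rev d)
      have ht : G.tail (G.rev d) = G.head d := rfl
      simp only [incr, G.rev_rev, G.head_rev, ht] at h1 h2
      simp only [G.tail_next, G.face_next, G.tail_rot, G.face_rot, ht]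
      by_cases h3 : (Sum.inl (G.tail d) : V ⊕ F) ∈ Z <;>
      by_cases h4 : (Sum.inl (G.head d) : V ⊕ F) ∈ Z <;>
      simp only [h3, h4, if_true, if_false] at h1 h2 ⊢
      · rw [hCZ _ h3] at h2
        rw [hCZ _ h4] at h1
        rw [h1, h2]
        ring
      · rw [h1]
        linear_combination -two (C (G.head d) * ext j (G.face (G.rev d)))
      · rw [h2]
        linear_combination two (C (G.tail d) * ext j (G.face d))
      · rw [hCadj d h3 h4]
        linear_combination two (C (G.head d) * ext j (G.face d)) -
          two (C (G.head d) * ext j (G.face (G.rev d))))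
    (fun v => C v * ext j (G.isoFace v))
  have hinc : ∀ v f, G.Inc v f → Sum.inl v ∉ Z → C v * ext j f = ψ (.inl v) + ψ (.inr f) := by
    rintro v f (⟨d, rfl, rfl⟩ | ⟨hv, rfl⟩) hvZ
    · have := hψ d
      rwa [if_neg hvZ] at this
    · exact hψ' v hv
  have hext : ∀ f, Sum.inr f ∉ Z → ext j f = 0 := fun f hf => dif_neg hf
  have hinc0 : ∀ v f, G.Inc v f → Sum.inl v ∉ Z → Sum.inr f ∉ Z → ψ (.inl v) = ψ (.inr f) := by
    intro v f hvf hv hf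
    have := hinc v f hvf hv
    rw [hext f hf, mul_zero] at this
    exact CharTwo.add_eq_zero.1 this.symm
  have hconst : ∀ x y, Avoid G.radial Z x y → ψ x = ψ y := by
    intro x y hxy
    refine hxy.induct (P := fun z => ψ x = ψ z) ?_ rfl
    rintro (v | g) (w | g') h h1 h2 h3
    · obtain ⟨d, rfl, rfl⟩ := h
      have h4 := hinc _ _ (G.inc_tail d) h1
      have h5 := hinc _ _ (G.inc_head d) h2
      rw [hCadj d h1 h2, h5] at h4
      rw [h3]
      exact (add_right_cancel h4).symm
    · rw [h3]
      exact hinc0 v g' h h1 h2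
    · rw [h3]
      exact (hinc0 w g h h2 h1).symm
    · exact h.elim
  -- By minimality each face of `Z` has a neighbour on the side of `a`, where the cocycle is `j f`,
  -- and one on the side of `b`, where it is 0. So `j` is constant, and `j f₀ = 0` makes it zero.
  have hval : ∀ f : J, ψ (.inl a) + ψ (.inl b) = j f := by
    rintro ⟨f, hf⟩
    obtain ⟨x, hxf, hx⟩ := h.exists_adj rfl hf
    obtain ⟨y, hyf, hy⟩ := h.exists_adj' rfl hf
    rcases x with x | g
    swap
    · exact hxf.elim
    rcases y with y | g
    swap
    · exact hyf.elim
    have h1 := hinc x f hxf hx.right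
    have h2 := hinc y f hyf hy.right
    have hCx : C x = 1 := if_pos hx
    have hCy : C y = 0 := if_neg fun h' => h.separates _ rfl _ rfl (h'.trans hy.symm)
    have hjf : ext j f = j ⟨f, hf⟩ := dif_pos hf
    rw [hCx, one_mul, hjf] at h1
    rw [hCy, zero_mul] at h2
    rw [hconst _ _ hx, hconst _ _ hy, CharTwo.add_eq_zero.1 h2.symm, h1]
  exact hf₁ ((hval f₁).symm.trans ((hval f₀).trans hjf₀))

end PlaneGraph

end PDP

/-! ### Small separators from small treewidth. -/

namespace PDP

section Separators

variable {W : Type*} {H : SimpleGraph W}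

theorem Avoid.of_getVert {S : Set W} {a b : W} (p : H.Walk a b) {s t : ℕ} (hst : s ≤ t)
    (ht : t ≤ p.length) (h : ∀ r, s ≤ r → r ≤ t → p.getVert r ∉ S) :
    Avoid H S (p.getVert s) (p.getVert t) := by
  induction t, hst using Nat.le_induction with
  | base => exact .refl (h s le_rfl le_rfl)
  | succ t hst ih =>
    refine (ih (by omega) fun r h1 h2 => h r h1 (by omega)).trans
      (.of_adj (p.adj_getVert_succ (by omega)) (h _ hst (by omega)) (h _ (by omega) le_rfl))

theorem Avoid.exists_adj_of_ne {S : Set W} {a b : W} (h : Avoid H S a b) (hab : a ≠ b) :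
    ∃ c, H.Adj a c ∧ c ∉ S := by
  obtain ⟨p, hp⟩ := h
  cases p with
  | nil => exact absurd rfl hab
  | cons h q => exact ⟨_, h, hp _ (by simp)⟩

/-- If `L` and `L'` separate `A` from `B`, then so does, outside of `A ∪ B`, every set that
separates `L` from `L'`. -/
theorem not_avoid_diff {A B L L' Z : Set W} (hL : ∀ a ∈ A, ∀ b ∈ B, ¬ Avoid H L a b)
    (hL' : ∀ a ∈ A, ∀ b ∈ B, ¬ Avoid H L' a b) (hd : Disjoint L (A ∪ B))
    (hd' : Disjoint L' (A ∪ B)) (hZ : ∀ x ∈ L, ∀ y ∈ L', ¬ Avoid H Z x y) :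
    ∀ a ∈ A, ∀ b ∈ B, ¬ Avoid H (Z \ (A ∪ B)) a b := by
  have key : ∀ (N : ℕ) (a b : W) (p : H.Walk a b), a ∈ A → b ∈ B → p.length = N →
      ¬ ∀ x ∈ p.support, x ∉ Z \ (A ∪ B) := by
    intro N
    induction N using Nat.strong_induction_on with
    | _ N ih =>
      intro a b p ha hb hN hp
      -- In a shortest counterexample the internal vertices avoid `A ∪ B`. Since `L` and `L'` avoid
      -- it too, they are met at internal vertices, and the stretch between two such vertices avoids
      -- `Z`.
      have hinner : ∀ i, 0 < i → i < p.length → p.getVert i ∉ A ∪ B := by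
        rintro i hi hi' (h | h)
        · refine ih (p.drop i).length (by simp; omega) _ _ (p.drop i) h hb rfl fun x hx => ?_
          exact hp x ((p.isSubwalk_drop i).support_subset hx)
        · refine ih (p.take i).length (by simp; omega) _ _ (p.take i) ha h rfl fun x hx => ?_
          exact hp x ((p.isSubwalk_take i).support_subset hx)
      have hmem : ∀ K : Set W, (∀ a ∈ A, ∀ b ∈ B, ¬ Avoid H K a b) → Disjoint K (A ∪ B) →
          ∃ i, 0 < i ∧ i < p.length ∧ p.getVert i ∈ K := by
        intro K hK hKd
        by_contra! hcon
        refine hK a ha b hb ⟨p, fun x hx hxK => ?_⟩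
        obtain ⟨i, rfl, hi⟩ := SimpleGraph.Walk.mem_support_iff_exists_getVert.1 hx
        have h1 := Set.disjoint_left.1 hKd hxK
        rcases Nat.eq_zero_or_pos i with rfl | h0
        · exact h1 (Or.inl (by simpa using ha))
        rcases hi.eq_or_lt with rfl | h2
        · exact h1 (Or.inr (by simpa using hb))
        · exact hcon i h0 h2 hxK
      obtain ⟨s, hs, hs', hsL⟩ := hmem L hL hd
      obtain ⟨t, ht, ht', htL⟩ := hmem L' hL' hd'
      have hfree : ∀ r, 0 < r → r < p.length → p.getVert r ∉ Z := fun r h1 h2 h3 =>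
        hp _ (p.getVert_mem_support r) ⟨h3, hinner r h1 h2⟩
      rcases le_total s t with hst | hst
      · exact hZ _ hsL _ htL (.of_getVert p hst ht'.le fun r h1 h2 => hfree r (by omega) (by omega))
      · exact hZ _ hsL _ htL
          (Avoid.of_getVert p hst hs'.le fun r h1 h2 => hfree r (by omega) (by omega)).symm
  rintro a ha b hb ⟨p, hp⟩
  exact key _ a b p ha hb rfl hp

theorem Avoid.of_induce_connected {S : Set W} (h : (H.induce S).Connected) {a b : W} (ha : a ∈ S)
    (hb : b ∈ S) : Avoid H Sᶜ a b := by
  obtain ⟨p⟩ := h.preconnected ⟨a, ha⟩ ⟨b, hb⟩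
  have : ∀ (x y : S), (H.induce S).Walk x y → Avoid H Sᶜ x y := by
    intro x y p
    induction p with
    | nil => exact .refl (not_not.2 (Subtype.mem _))
    | cons h _ ih =>
      have h' : H.Adj _ _ := h
      exact (Avoid.of_adj h' (not_not.2 (Subtype.mem _)) (not_not.2 (Subtype.mem _))).trans ih
  exact this _ _ p

end Separators

/-- The bags of a tree decomposition do not define a haven. -/
theorem false_of_haven {V : Type*} {G : SimpleGraph V} {N : ℕ} {T : SimpleGraph (Fin N)}
    (hT : T.IsTree) {bag : Fin N → Finset V} (hedge : ∀ x y, G.Adj x y → ∃ i, x ∈ bag i ∧ y ∈ bag i)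
    (hsub : ∀ x, (T.induce {i | x ∈ bag i}).IsTree) (v : Fin N → V) (hv : ∀ t, v t ∉ bag t)
    (h : ∀ t t', ∃ u, Avoid G (bag t) (v t) u ∧ Avoid G (bag t') (v t') u) : False := by
  classical
  -- The branch of `T - t` that holds `v t`; by `hcomp` it holds every bag meeting the component of
  -- `v t` in `G - bag t`.
  let comp : Fin N → Set (Fin N) := fun t => {s | ∃ s₀, v t ∈ bag s₀ ∧ Avoid T {t} s₀ s}
  have hbag : ∀ x i j t, x ∈ bag i → x ∈ bag j → x ∉ bag t → Avoid T {t} i j := by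
    intro x i j t hi hj ht
    refine (Avoid.of_induce_connected (hsub x).connected hi hj).mono ?_
    rintro _ rfl
    exact ht
  have hexists : ∀ x, ∃ i, x ∈ bag i := by
    intro x
    obtain ⟨⟨i, hi⟩⟩ := (hsub x).connected.nonempty
    exact ⟨i, hi⟩
  have hcomp : ∀ t u, Avoid G (bag t) (v t) u → ∀ s, u ∈ bag s → s ∈ comp t := by
    intro t u hu
    refine hu.induct (P := fun u => ∀ s, u ∈ bag s → s ∈ comp t) ?_ ?_
    · intro x y hxy _ hy hP s hs
      obtain ⟨i, hi, hi'⟩ := hedge x y hxy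
      obtain ⟨s₀, h1, h2⟩ := hP i hi
      exact ⟨s₀, h1, h2.trans (hbag y i s t hi' hs hy)⟩
    · intro s hs
      exact ⟨s, hs, hbag _ s s t hs hs (hv t)⟩
  have hcomp' : ∀ t s s', s ∈ comp t → s' ∈ comp t → Avoid T {t} s s' := by
    rintro t s s' ⟨s₀, h1, h2⟩ ⟨s₁, h3, h4⟩
    exact h2.symm.trans ((hbag _ _ _ t h1 h3 (hv t)).trans h4)
  obtain ⟨t₀⟩ := hT.connected.nonempty
  -- Take a node with the smallest branch and step to the neighbour `t'` inside it. If the branch of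
  -- `t'` points back to `t`, a node common to both branches yields two different paths to `t'`;
  -- otherwise it is strictly smaller.
  obtain ⟨t, -, htmin⟩ := Set.exists_min_image (Set.univ : Set (Fin N)) (fun t => (comp t).ncard)
    Set.finite_univ ⟨t₀, trivial⟩
  obtain ⟨s₀, hs₀⟩ := hexists (v t)
  obtain ⟨t', htt', ht'⟩ : ∃ t', T.Adj t t' ∧ t' ∈ comp t := by
    obtain ⟨p, hp⟩ := hT.connected.exists_isPath t s₀
    cases p with
    | nil => exact absurd hs₀ (hv t)
    | @cons _ t' _ hadj q =>
      refine ⟨t', hadj, s₀, hs₀, ?_⟩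
      rw [SimpleGraph.Walk.cons_isPath_iff] at hp
      exact Avoid.symm ⟨q, fun x hx hxt => hp.2 (hxt ▸ hx)⟩
  obtain ⟨u, hu, hu'⟩ := h t t'
  obtain ⟨s, hs⟩ := hexists u
  have hst := hcomp t u hu s hs
  have hst' := hcomp t' u hu' s hs
  by_cases hc : t ∈ comp t'
  · obtain ⟨p, hp⟩ := hcomp' t' s t hst' hc
    obtain ⟨q, hq⟩ := hcomp' t s t' hst ht'
    have hp' : t' ∉ p.bypass.support := fun h =>
      hp _ (p.support_bypass_subset_support h) rfl
    have h1 : (p.bypass.concat htt').IsPath := p.bypass_isPath.concat hp' htt'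
    have h2 := (hT.isAcyclic.subsingleton_path s t').elim ⟨_, h1⟩ ⟨_, q.bypass_isPath⟩
    have h3 : t ∈ (p.bypass.concat htt').support := by
      rw [SimpleGraph.Walk.support_concat]
      simp
    have h4 : p.bypass.concat htt' = q.bypass := congrArg Subtype.val h2
    rw [h4] at h3
    exact hq _ (q.support_bypass_subset_support h3) rfl
  · refine absurd (htmin t' trivial) (not_le.2 (Set.ncard_lt_ncard ⟨?_, ?_⟩ (Set.toFinite _)))
    · intro x hx
      have h1 : Avoid T {t} s x := by
        refine (hcomp' t' s x hst' hx).mem_of_disjoint fun y hy hyt => ?_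
        obtain ⟨s₁, h1, h2⟩ := hst'
        exact hc ⟨s₁, h1, (h2.trans hy).trans (hyt ▸ .refl hy.right)⟩
      obtain ⟨s₁, h2, h3⟩ := hst
      exact ⟨s₁, h2, h3.trans h1⟩
    · intro hsub
      obtain ⟨_, _, h⟩ := hsub ht'
      exact h.right rfl

/-- Each element of `Y` blocks at most three values, in total `6 * n + 6`, out of at least `6 * n +
7` candidates. -/
theorem exists_mem_Ico_far {n M : ℕ} (Y : Finset ℕ) (hY : Y.card ≤ 2 * n + 2)
    (hM : 6 * n + 8 ≤ M) : ∃ i, 1 ≤ i ∧ i < M ∧ ∀ y ∈ Y, y + 1 < i ∨ i + 1 < y := by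
  by_contra! hcon
  have h1 : Finset.Ico 1 M ⊆ Y.biUnion fun y => Finset.Icc (y - 1) (y + 1) := by
    intro i hi
    rw [Finset.mem_Ico] at hi
    obtain ⟨y, hy, h1, h2⟩ := hcon i hi.1 hi.2
    rw [Finset.mem_biUnion]
    exact ⟨y, hy, Finset.mem_Icc.2 ⟨by omega, by omega⟩⟩
  have h2 := (Finset.card_le_card h1).trans (Finset.card_biUnion_le_card_mul _ _ 3 fun y _ => by
    rw [Nat.card_Icc]; omega)
  rw [Nat.card_Ico] at h2
  omega

namespace PlaneGraph

variable {V D F : Type*} [Finite V] [Finite D] [Finite F] (G : PlaneGraph V D F)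

/-- Connected sets that are far apart in the radial completion of a plane graph of small treewidth
have a small separator. -/
theorem exists_small_separator {n M : ℕ} (htw : TreewidthLE G.graph n) (hM : 6 * n + 8 ≤ M)
    {A B : Set (V ⊕ F)} (hA : A.Nonempty)
    (hAc : ∀ a ∈ A, ∀ a' ∈ A, Avoid G.radial Aᶜ a a')
    (hBc : ∀ b ∈ B, ∀ b' ∈ B, Avoid G.radial Bᶜ b b') (d : V ⊕ F → ℕ)
    (hd : ∀ x y, G.radial.Adj x y → d y ≤ d x + 1) (hdA : ∀ a ∈ A, d a = 0)
    (hdB : ∀ b ∈ B, M ≤ d b) :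
    ∃ S : Set (V ⊕ F), Disjoint S (A ∪ B) ∧ (∀ a ∈ A, ∀ b ∈ B, ¬ Avoid G.radial S a b) ∧
      S.ncard ≤ 2 * n + 3 := by
  classical
  by_contra! hbig
  -- rings
  have hring : ∀ i, ∃ L : Set (V ⊕ F), 1 ≤ i → i < M → (∀ x ∈ L, d x = i) ∧
      IsMinimalSeparator G.radial L A B := by
    intro i
    by_cases hi : 1 ≤ i ∧ i < M
    swap
    · exact ⟨∅, fun h1 h2 => absurd ⟨h1, h2⟩ hi⟩
    -- Since `d` grows by at most one along an edge, a walk from level 0 to a level at least `M`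
    -- cannot skip level `i`.
    obtain ⟨L, hL, hL'⟩ := exists_isMinimalSeparator (H := G.radial) (N := {x | d x = i}) (A := A)
      (B := B) (by
        intro a ha b hb hab
        have : d b < i := by
          refine hab.induct (P := fun x => d x < i) (fun x y hxy _ hy hx => ?_)
            (by rw [hdA a ha]; omega)
          have h1 := hd x y hxy
          have h2 : d y ≠ i := hy
          omega
        have := hdB b hb
        omega)
      (fun a ha a' ha' => by
        refine (hAc a ha a' ha').mono ?_
        intro x hx hxA
        have h1 := hdA x hxA
        have h2 : d x = i := hx
        omega)
      (fun b hb b' hb' => by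
        refine (hBc b hb b' hb').mono ?_
        intro x hx hxB
        have h1 := hdB x hxB
        have h2 : d x = i := hx
        omega)
    exact ⟨L, fun _ _ => ⟨fun x hx => hL hx, hL'⟩⟩
  choose L hL using hring
  obtain ⟨a₀, ha₀⟩ := hA
  have hdisj : ∀ i, 1 ≤ i → i < M → Disjoint (L i) (A ∪ B) := by
    intro i h1 h2
    rw [Set.disjoint_left]
    rintro x hx (h | h)
    · have h3 := hdA x h
      have h4 := (hL i h1 h2).1 x hx
      omega
    · have h3 := hdB x h
      have h4 := (hL i h1 h2).1 x hx
      omega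
  have hcard : ∀ i, 1 ≤ i → i < M → 1 < (L i).ncard := by
    intro i h1 h2
    have := hbig (L i) (hdisj i h1 h2) (hL i h1 h2).2.separates
    omega
  -- A ring is connected and has more than one element, and faces are pairwise nonadjacent.
  have hface : ∀ i, 1 ≤ i → i < M → ∀ f, Sum.inr f ∈ L i → ∃ v, Sum.inl v ∈ L i ∧ G.Inc v f := by
    intro i h1 h2 f hf
    obtain ⟨t, ht, htf⟩ := Set.exists_ne_of_one_lt_ncard (hcard i h1 h2) (Sum.inr f)
    obtain ⟨c, hc, hc'⟩ :=
      ((hL i h1 h2).2.connected G.triangleExact hf ht).exists_adj_of_ne htf.symm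
    rcases c with v | g
    · exact ⟨v, not_not.1 hc', hc⟩
    · exact hc.elim
  have hvert : ∀ i, 1 ≤ i → i < M → ∃ v, Sum.inl v ∈ L i := by
    intro i h1 h2
    obtain ⟨x, hx⟩ : (L i).Nonempty := by
      rw [← Set.ncard_pos]
      have := hcard i h1 h2
      omega
    rcases x with v | f
    · exact ⟨v, hx⟩
    · obtain ⟨v, hv, -⟩ := hface i h1 h2 f hx
      exact ⟨v, hv⟩
  -- a ring that keeps its distance from `X` lies in one component of `G - X`
  have hone : ∀ i, 1 ≤ i → i < M → ∀ X : Set V,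
      (∀ x ∈ X, d (.inl x) + 1 < i ∨ i + 1 < d (.inl x)) → ∀ v w, Sum.inl v ∈ L i →
      Sum.inl w ∈ L i → Avoid G.graph X v w := by
    intro i h1 h2 X hX v w hv hw
    have hXv : ∀ x, d (.inl x) ≤ i + 1 → i ≤ d (.inl x) + 1 → x ∉ X := by
      intro x h3 h4 h5
      have := hX x h5
      omega
    obtain ⟨hLd, hLm⟩ := hL i h1 h2
    have hXL : ∀ x, Sum.inl x ∈ L i → x ∉ X := fun x hx =>
      hXv x (by rw [hLd _ hx]; omega) (by rw [hLd _ hx]; omega)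
    have := (hLm.connected G.triangleExact hv hw).induct (P := fun x => match x with
      | .inl u => Avoid G.graph X v u
      | .inr f => ∀ u, Sum.inl u ∈ L i → G.Inc u f → Avoid G.graph X v u) ?_ (.refl (hXL v hv))
    · exact this
    rintro (u | f) (u' | f') hadj hu hu' hP
    · exact hP.trans (.of_adj hadj (hXL u (not_not.1 hu)) (hXL u' (not_not.1 hu')))
    · intro u' hu'L hinc
      refine hP.trans ?_
      have huL := not_not.1 hu
      have hfL := not_not.1 hu'
      obtain ⟨x, hx, hx'⟩ := hLm.exists_adj ha₀ huL
      obtain ⟨y, hy, hy'⟩ := hLm.exists_adj ha₀ hu'L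
      have hsub : {Sum.inr f'} ⊆ L i := by
        rintro _ rfl
        exact hfL
      -- Both ring vertices have neighbours in the component of `A` off the ring, so they are
      -- connected without the face `f'` and share a boundary walk of it. All vertices on that walk
      -- have level within one of `i`, so `X` misses them.
      have hxy := (hx'.symm.trans hy').mono hsub
      obtain ⟨p, hp⟩ := G.exists_boundary_walk hadj hinc
        ((Avoid.of_adj hx.symm (by simp) hxy.left).trans (hxy.trans
          (.of_adj hy hxy.right (by simp))))
      refine ⟨p, fun z hz => ?_⟩
      have hzf : G.radial.Adj (.inl z) (.inr f') := hp z hz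
      have h3 := hd _ _ hzf
      have h4 := hd _ _ hzf.symm
      rw [hLd _ hfL] at h3 h4
      exact hXv z h4 h3
    · exact hP u' (not_not.1 hu') hadj
    · exact hadj.elim
  -- all rings that keep their distance from `X` lie in the same component of `G - X`
  have htwo : ∀ i j, 1 ≤ i → i < M → 1 ≤ j → j < M → ∀ X : Set V, X.ncard ≤ n + 1 →
      (∀ x ∈ X, d (.inl x) + 1 < i ∨ i + 1 < d (.inl x)) →
      (∀ x ∈ X, d (.inl x) + 1 < j ∨ j + 1 < d (.inl x)) → ∀ v w, Sum.inl v ∈ L i →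
      Sum.inl w ∈ L j → Avoid G.graph X v w := by
    intro i j hi hi' hj hj' X hXn hXi hXj v w hv hw
    by_contra hvw
    have hXL : ∀ i, 1 ≤ i → i < M → (∀ x ∈ X, d (.inl x) + 1 < i ∨ i + 1 < d (.inl x)) →
        ∀ x, Sum.inl x ∈ L i → x ∉ X := by
      intro i hi hi' hXi x hx hxX
      have h1 := (hL i hi hi').1 _ hx
      have h2 := hXi x hxX
      omega
    -- All faces together with `X`: a walk in `H` that starts at a vertex of `G` and avoids this set
    -- is a walk in `G - X`.
    let Z₀ : Set (V ⊕ F) := {x | ∀ u, x = .inl u → u ∈ X}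
    obtain ⟨Z, hZ₀, hZ⟩ := exists_isMinimalSeparator (H := G.radial) (N := Z₀)
      (A := {.inl v}) (B := {.inl w}) (by
        rintro _ rfl _ rfl hcon
        refine hvw ?_
        have := hcon.induct (P := fun x => ∃ u, x = .inl u ∧ Avoid G.graph X v u) ?_
          ⟨v, rfl, .refl (hXL i hi hi' hXi v hv)⟩
        · obtain ⟨u, hu, hu'⟩ := this
          rw [Sum.inl.injEq] at hu
          rwa [hu]
        · rintro _ (u' | f) hadj _ hy ⟨u, rfl, hu⟩
          · refine ⟨u', rfl, hu.trans (.of_adj hadj hu.right fun h => hy ?_)⟩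
            rintro _ ⟨⟩
            exact h
          · exact absurd (fun _ h => by cases h) hy)
      (by
        rintro _ rfl _ rfl
        exact .refl fun h => hXL i hi hi' hXi v hv (h v rfl))
      (by
        rintro _ rfl _ rfl
        exact .refl fun h => hXL j hj hj' hXj w hw (h w rfl))
    have hZX : ∀ u, Sum.inl u ∈ Z → u ∈ X := fun u hu => hZ₀ hu u rfl
    -- At most `n + 1` vertices from `X`, and at most one more face than vertices.
    have hZcard : Z.ncard ≤ 2 * n + 3 := by
      have h1 := G.card_faces_le hZ
      have h2 : {u : V | Sum.inl u ∈ Z}.ncard ≤ X.ncard := Set.ncard_le_ncard hZX (Set.toFinite _)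
      have h3 : Z = Sum.inl '' {u : V | Sum.inl u ∈ Z} ∪ Sum.inr '' {f : F | Sum.inr f ∈ Z} := by
        ext (u | f) <;> simp
      have h4 : Z.ncard ≤ {u : V | Sum.inl u ∈ Z}.ncard + {f : F | Sum.inr f ∈ Z}.ncard := by
        conv_lhs => rw [h3]
        refine (Set.ncard_union_le _ _).trans ?_
        rw [Set.ncard_image_of_injective _ Sum.inl_injective,
          Set.ncard_image_of_injective _ Sum.inr_injective]
      omega
    have hlift : ∀ u u', Avoid G.graph X u u' → Avoid G.radial Z (.inl u) (.inl u') := by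
      intro u u' huu'
      refine huu'.induct (P := fun x => Avoid G.radial Z (.inl u) (.inl x)) ?_
        (.refl fun h => huu'.left (hZX _ h))
      intro x y hxy _ hy hP
      have : G.radial.Adj (.inl x) (.inl y) := hxy
      exact hP.trans (.of_adj this hP.right fun h => hy (hZX _ h))
    have hreach : ∀ i, 1 ≤ i → i < M → (∀ x ∈ X, d (.inl x) + 1 < i ∨ i + 1 < d (.inl x)) →
        ∀ v, Sum.inl v ∈ L i → ∀ x ∈ L i, x ∉ Z → Avoid G.radial Z (.inl v) x := by
      rintro i hi hi' hXi v hv (u | f) hx hxZ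
      · exact hlift v u (hone i hi hi' X hXi v u hv hx)
      · obtain ⟨u, hu, huf⟩ := hface i hi hi' f hx
        have h1 := hlift v u (hone i hi hi' X hXi v u hv hu)
        have : G.radial.Adj (.inl u) (.inr f) := huf
        exact h1.trans (.of_adj this h1.right hxZ)
    -- What remains of ring `i` is joined to `v` off `Z`, what remains of ring `j` to `w`. Thus `Z`
    -- separates the rings, hence `A` from `B`, while being too small.
    have hsep := not_avoid_diff (hL i hi hi').2.separates (hL j hj hj').2.separates
      (hdisj i hi hi') (hdisj j hj hj') (Z := Z) (by
        intro x hx y hy hxy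
        exact hZ.separates _ rfl _ rfl ((hreach i hi hi' hXi v hv x hx hxy.left).trans
          (hxy.trans (hreach j hj hj' hXj w hw y hy hxy.right).symm)))
    have h1 := hbig (Z \ (A ∪ B)) Set.disjoint_sdiff_left hsep
    have h2 := Set.ncard_le_ncard (Set.sdiff_subset (s := Z) (t := A ∪ B)) (Set.toFinite _)
    omega
  -- the haven
  obtain ⟨N, T, bag, hT, hedge, hsub, hwidth⟩ := htw
  have hcardX : ∀ t, (bag t : Set V).ncard ≤ n + 1 := fun t => by
    rw [Set.ncard_coe_finset]
    exact hwidth t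
  -- Two bags together occupy at most `2 * n + 2` levels.
  have hfar : ∀ t t', ∃ i, 1 ≤ i ∧ i < M ∧
      (∀ x ∈ bag t, d (.inl x) + 1 < i ∨ i + 1 < d (.inl x)) ∧
      ∀ x ∈ bag t', d (.inl x) + 1 < i ∨ i + 1 < d (.inl x) := by
    intro t t'
    obtain ⟨i, h1, h2, h3⟩ := exists_mem_Ico_far ((bag t ∪ bag t').image fun x => d (.inl x))
      (n := n) (by
        have h3 := Finset.card_image_le (s := bag t ∪ bag t') (f := fun x => d (.inl x : V ⊕ F))
        have h4 := Finset.card_union_le (bag t) (bag t')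
        have h5 := hwidth t
        have h6 := hwidth t'
        omega) hM
    exact ⟨i, h1, h2, fun x hx => h3 _ (Finset.mem_image_of_mem _ (Finset.mem_union_left _ hx)),
      fun x hx => h3 _ (Finset.mem_image_of_mem _ (Finset.mem_union_right _ hx))⟩
  choose i hi using fun t => hfar t t
  choose v hv using fun t => hvert (i t) (hi t).1 (hi t).2.1
  refine false_of_haven hT hedge hsub v ?_ ?_
  · intro t ht
    have h1 := (hi t).2.2.1 _ ht
    have h2 := (hL _ (hi t).1 (hi t).2.1).1 _ (hv t)
    omega
  · intro t t'
    obtain ⟨j, h1, h2, h3, h4⟩ := hfar t t'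
    obtain ⟨u, hu⟩ := hvert j h1 h2
    exact ⟨u, htwo _ j (hi t).1 (hi t).2.1 h1 h2 _ (hcardX t) (hi t).2.2.1 h3 _ _ (hv t) hu,
      htwo _ j (hi t').1 (hi t').2.1 h1 h2 _ (hcardX t') (hi t').2.2.1 h4 _ _ (hv t') hu⟩

end PlaneGraph

end PDP

/-! ### Subtrees, cuts of trees, and maximal degree-2 paths. -/

namespace PDP

open SimpleGraph

section Subtrees

variable {W : Type*} {H : SimpleGraph W}

/-! ### Subgraphs and walks -/

theorem toSubgraph_le_iff_getVert {R : H.Subgraph} {a b : W} {p : H.Walk a b} :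
    p.toSubgraph ≤ R ↔
      (∀ x ∈ p.support, x ∈ R.verts) ∧ ∀ i < p.length, R.Adj (p.getVert i) (p.getVert (i + 1)) := by
  constructor
  · intro h
    exact ⟨fun x hx => h.1 (p.mem_verts_toSubgraph.2 hx),
      fun i hi => h.2 (p.toSubgraph_adj_getVert hi)⟩
  · rintro ⟨h1, h2⟩
    refine ⟨fun x hx => h1 x (p.mem_verts_toSubgraph.1 hx), fun x y hxy => ?_⟩
    obtain ⟨i, hi, hi'⟩ := p.toSubgraph_adj_iff.1 hxy
    rcases Sym2.eq_iff.1 hi with ⟨rfl, rfl⟩ | ⟨rfl, rfl⟩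
    · exact h2 i hi'
    · exact (h2 i hi').symm

theorem mem_component_iff {R : H.Subgraph} {a x : W} :
    x ∈ component R a ↔ a ∈ R.verts ∧ Relation.ReflTransGen R.Adj a x := by
  constructor
  · rintro ⟨p, hp⟩
    induction p with
    | nil => exact ⟨hp.1 (by simp), .refl⟩
    | cons h q ih =>
      rw [Walk.toSubgraph, sup_le_iff] at hp
      exact ⟨hp.1.1 (by simp), .head (hp.1.2 (by simp)) (ih hp.2).2⟩
  · rintro ⟨ha, h⟩
    induction h with
    | refl => exact ⟨.nil, by simpa [Walk.toSubgraph] using ha⟩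
    | tail _ h ih =>
      obtain ⟨p, hp⟩ := ih
      refine ⟨p.concat h.adj_sub, ?_⟩
      rw [Walk.concat_eq_append, Walk.toSubgraph_append, sup_le_iff]
      exact ⟨hp, by
        rw [Walk.toSubgraph_cons_nil_eq_subgraphOfAdj]
        exact subgraphOfAdj_le_of_adj _ h⟩

theorem component_subset_verts {R : H.Subgraph} {a : W} : component R a ⊆ R.verts := by
  rintro x ⟨p, hp⟩
  exact hp.1 (by simp)

theorem mem_component_self {R : H.Subgraph} {a : W} (ha : a ∈ R.verts) : a ∈ component R a :=
  mem_component_iff.2 ⟨ha, .refl⟩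

theorem mem_component_of_adj {R : H.Subgraph} {a x y : W} (hx : x ∈ component R a)
    (h : R.Adj x y) : y ∈ component R a :=
  mem_component_iff.2 ⟨(mem_component_iff.1 hx).1, (mem_component_iff.1 hx).2.tail h⟩

theorem component_induct {R : H.Subgraph} {a x : W} {P : W → Prop} (hx : x ∈ component R a)
    (ha : P a) (hP : ∀ y z, R.Adj y z → P y → P z) : P x := by
  obtain ⟨-, h⟩ := mem_component_iff.1 hx
  induction h with
  | refl => exact ha
  | tail h1 h2 ih => exact hP _ _ h2 (ih (mem_component_iff.2 ⟨(mem_component_iff.1 hx).1, h1⟩))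

theorem reflTransGen_symm {R : H.Subgraph} {a b : W} (h : Relation.ReflTransGen R.Adj a b) :
    Relation.ReflTransGen R.Adj b a := by
  induction h with
  | refl => exact .refl
  | tail _ h ih => exact .head h.symm ih

/-! ### Subtrees -/

theorem reflTransGen_of_isTree {R : H.Subgraph} (hR : R.coe.IsTree) {a b : W} (ha : a ∈ R.verts)
    (hb : b ∈ R.verts) : Relation.ReflTransGen R.Adj a b := by
  obtain ⟨p, hp⟩ := ((Subgraph.connected_iff_forall_exists_walk_subgraph R).1
    (Subgraph.connected_iff'.2 hR.connected)).2 ha hb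
  exact (mem_component_iff.1 ⟨p, hp⟩).2

theorem path_unique_of_isTree {R : H.Subgraph} (hR : R.coe.IsTree) {a b : W} {p q : H.Walk a b}
    (hp : p.IsPath) (hq : q.IsPath) (hpR : p.toSubgraph ≤ R) (hqR : q.toSubgraph ≤ R) : p = q := by
  have key : ∀ (p : H.Walk a b) (hp : p.toSubgraph ≤ R),
      (p.mapToSubgraph.map (Subgraph.inclusion hp)).map R.hom = p := by
    intro p hp
    rw [Walk.map_map]
    exact p.map_mapToSubgraph_hom
  have hp' : (p.mapToSubgraph.map (Subgraph.inclusion hpR)).IsPath :=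
    Walk.IsPath.of_map (f := R.hom) (by rw [key]; exact hp)
  have hq' : (q.mapToSubgraph.map (Subgraph.inclusion hqR)).IsPath :=
    Walk.IsPath.of_map (f := R.hom) (by rw [key]; exact hq)
  have h := congrArg Subtype.val
    ((hR.isAcyclic.subsingleton_path _ _).elim ⟨_, hp'⟩ ⟨_, hq'⟩)
  rw [← key p hpR, ← key q hqR]
  exact congrArg (Walk.map R.hom) h

/-- Such a colouring is constant along walks that avoid the edge `ab`, so every edge is a bridge.
This form suits rerouting, where colourings are easier to transport than paths. -/
theorem isTree_coe_of_cuts {R : H.Subgraph} {r : W} (hr : r ∈ R.verts)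
    (hconn : ∀ x ∈ R.verts, Relation.ReflTransGen R.Adj r x)
    (hcut : ∀ a b, R.Adj a b → ∃ χ : W → Prop, (χ a ↔ ¬ χ b) ∧
      ∀ x y, R.Adj x y → s(x, y) ≠ s(a, b) → χ x → χ y) : R.coe.IsTree := by
  refine ⟨?_, ?_⟩
  · rw [← Subgraph.connected_iff', Subgraph.connected_iff_forall_exists_walk_subgraph]
    refine ⟨⟨r, hr⟩, fun {u v} hu hv => ?_⟩
    have : v ∈ component R u :=
      mem_component_iff.2 ⟨hu, (reflTransGen_symm (hconn u hu)).trans (hconn v hv)⟩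
    exact this
  · rw [isAcyclic_iff_forall_adj_isBridge]
    rintro ⟨a, ha⟩ ⟨b, hb⟩ hab
    rw [isBridge_iff]
    obtain ⟨χ, hχ, hχ'⟩ := hcut a b hab
    have key : ∀ x y : R.verts, (R.coe.deleteEdges {s(⟨a, ha⟩, ⟨b, hb⟩)}).Walk x y →
        (χ x ↔ χ y) := by
      intro x y p
      induction p with
      | nil => rfl
      | @cons u v w h q ih =>
        rw [← ih]
        rw [deleteEdges_adj] at h
        have h1 : R.Adj u v := h.1
        have h2 : s((u : W), (v : W)) ≠ s(a, b) := by
          intro h3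
          refine h.2 ?_
          rcases Sym2.eq_iff.1 h3 with ⟨h4, h5⟩ | ⟨h4, h5⟩
          · exact Sym2.eq_iff.2 (Or.inl ⟨Subtype.ext h4, Subtype.ext h5⟩)
          · exact Sym2.eq_iff.2 (Or.inr ⟨Subtype.ext h4, Subtype.ext h5⟩)
        exact ⟨hχ' u v h1 h2, hχ' v u h1.symm (by rwa [Sym2.eq_swap])⟩
    rintro ⟨p⟩
    have := key _ _ p
    simp only at this
    tauto

/-- The colour class is the component of `a` once the edge is removed; by uniqueness of paths it
does not contain `b`. -/
theorem exists_cut_of_isTree {R : H.Subgraph} (hR : R.coe.IsTree) {a b : W} (hab : R.Adj a b) :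
    ∃ χ : W → Prop, χ a ∧ ¬ χ b ∧ ∀ x y, R.Adj x y → s(x, y) ≠ s(a, b) → χ x → χ y := by
  classical
  let R' := R.deleteEdges {s(a, b)}
  refine ⟨fun x => x ∈ component R' a, mem_component_self hab.fst_mem, ?_, ?_⟩
  · rintro ⟨p, hp⟩
    have h1 : p.bypass.toSubgraph ≤ R' := Walk.toSubgraph_bypass_le_toSubgraph.trans hp
    have h2 : (Walk.cons hab.adj_sub .nil : H.Walk a b).IsPath := by
      simp [hab.ne]
    have h3 : p.bypass = Walk.cons hab.adj_sub .nil :=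
      path_unique_of_isTree hR p.bypass_isPath h2 (h1.trans (Subgraph.deleteEdges_le _))
        (by
          rw [Walk.toSubgraph_cons_nil_eq_subgraphOfAdj]
          exact subgraphOfAdj_le_of_adj _ hab)
    rw [h3, Walk.toSubgraph_cons_nil_eq_subgraphOfAdj] at h1
    have h4 : R'.Adj a b := h1.2 (by simp)
    rw [Subgraph.deleteEdges_adj] at h4
    exact h4.2 rfl
  · intro x y hxy hne hx
    refine mem_component_of_adj hx ?_
    rw [Subgraph.deleteEdges_adj]
    exact ⟨hxy, hne⟩

/-! ### Maximal degree-2 paths -/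

theorem getVert_inj {a b : W} {p : H.Walk a b} (hp : p.IsPath) {i j : ℕ} (hi : i ≤ p.length)
    (hj : j ≤ p.length) (h : p.getVert i = p.getVert j) : i = j :=
  hp.getVert_injOn hi hj h

theorem two_le_deg [Finite W] {R : H.Subgraph} {a b : W} {p : H.Walk a b} (hp : p.IsPath)
    (hpR : p.toSubgraph ≤ R) {i : ℕ} (hi : 0 < i) (hi' : i < p.length) :
    2 ≤ deg R (p.getVert i) := by
  have h1 := (toSubgraph_le_iff_getVert.1 hpR).2 i hi'
  have h2 := ((toSubgraph_le_iff_getVert.1 hpR).2 (i - 1) (by omega)).symm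
  rw [Nat.sub_add_cancel hi] at h2
  have h3 : p.getVert (i - 1) ≠ p.getVert (i + 1) := fun h => by
    have := getVert_inj hp (by omega) (by omega) h
    omega
  rw [← Set.ncard_pair h3]
  refine Set.ncard_le_ncard ?_ (Set.toFinite _)
  rintro _ (rfl | rfl)
  · exact h2
  · exact h1

namespace IsMaxDegTwoPath

variable {R : H.Subgraph} {a b c d : W} {p : H.Walk a b} {q : H.Walk c d}

theorem reverse (hp : IsMaxDegTwoPath R p) : IsMaxDegTwoPath R p.reverse := by
  obtain ⟨h1, h2, h3, h4, h5⟩ := hp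
  exact ⟨h1.reverse, by simpa using h2, h4, h3, fun w hw ha hb => h5 w (by simpa using hw) hb ha⟩

theorem adj (hp : IsMaxDegTwoPath R p) {i : ℕ} (hi : i < p.length) :
    R.Adj (p.getVert i) (p.getVert (i + 1)) := (toSubgraph_le_iff_getVert.1 hp.2.1).2 i hi

theorem getVert_mem_verts (hp : IsMaxDegTwoPath R p) (i : ℕ) : p.getVert i ∈ R.verts :=
  (toSubgraph_le_iff_getVert.1 hp.2.1).1 _ (p.getVert_mem_support i)

theorem getVert_ne_start (hp : IsMaxDegTwoPath R p) {i : ℕ} (hi : 0 < i) (hi' : i ≤ p.length) :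
    p.getVert i ≠ a := fun h => by
  have := (hp.1.getVert_eq_start_iff hi').1 h
  omega

theorem getVert_ne_end (hp : IsMaxDegTwoPath R p) {i : ℕ} (hi' : i < p.length) :
    p.getVert i ≠ b := fun h => by
  have := getVert_inj hp.1 hi'.le le_rfl (h.trans p.getVert_length.symm)
  omega

theorem deg_getVert [Finite W] (hp : IsMaxDegTwoPath R p) {i : ℕ} (hi : 0 < i)
    (hi' : i < p.length) : deg R (p.getVert i) = 2 := by
  have h1 := two_le_deg hp.1 hp.2.1 hi hi'
  have h2 := hp.2.2.2.2 _ (p.getVert_mem_support i) (hp.getVert_ne_start hi hi'.le)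
    (hp.getVert_ne_end hi')
  omega

theorem deg_start (hp : IsMaxDegTwoPath R p) : deg R a ≠ 2 := by
  have := hp.2.2.1
  omega

theorem deg_end (hp : IsMaxDegTwoPath R p) : deg R b ≠ 2 := by
  have := hp.2.2.2.1
  omega

theorem eq_or_eq_of_adj [Finite W] (hp : IsMaxDegTwoPath R p) {i : ℕ} (hi : 0 < i)
    (hi' : i < p.length) {y : W} (hy : R.Adj (p.getVert i) y) :
    y = p.getVert (i - 1) ∨ y = p.getVert (i + 1) := by
  have h1 := hp.adj hi'
  have h2 := (hp.adj (i := i - 1) (by omega)).symm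
  rw [Nat.sub_add_cancel hi] at h2
  have h3 : p.getVert (i - 1) ≠ p.getVert (i + 1) := fun h => by
    have := getVert_inj hp.1 (by omega) (by omega) h
    omega
  have h4 : {p.getVert (i - 1), p.getVert (i + 1)} = R.neighborSet (p.getVert i) := by
    refine Set.eq_of_subset_of_ncard_le ?_ ?_ (Set.toFinite _)
    · rintro _ (rfl | rfl)
      · exact h2
      · exact h1
    · rw [Set.ncard_pair h3]
      exact (hp.deg_getVert hi hi').le
  have h5 : y ∈ R.neighborSet (p.getVert i) := hy
  rw [← h4] at h5
  exact h5

/-- Internal vertices have degree two and endpoints do not, so the degree tells them apart. -/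
theorem interior_of_eq [Finite W] (hp : IsMaxDegTwoPath R p) (hq : IsMaxDegTwoPath R q) {i j : ℕ}
    (hi : 0 < i) (hi' : i < p.length) (hj : j ≤ q.length) (h : p.getVert i = q.getVert j) :
    0 < j ∧ j < q.length := by
  have h1 := hp.deg_getVert hi hi'
  rw [h] at h1
  constructor
  · rw [Nat.pos_iff_ne_zero]
    rintro rfl
    rw [q.getVert_zero] at h1
    exact hq.deg_start h1
  · refine lt_of_le_of_ne hj ?_
    rintro rfl
    rw [q.getVert_length] at h1
    exact hq.deg_end h1

/-- At an internal vertex the way onward is forced, so two such paths that share a directed edge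
continue together and end together. -/
theorem eq_forward [Finite W] (hp : IsMaxDegTwoPath R p) (hq : IsMaxDegTwoPath R q) (k : ℕ) :
    ∀ i j, i + 1 + k = p.length → j < q.length → p.getVert i = q.getVert j →
      p.getVert (i + 1) = q.getVert (j + 1) →
      j + 1 + k = q.length ∧ ∀ l ≤ k, p.getVert (i + 1 + l) = q.getVert (j + 1 + l) := by
  induction k with
  | zero =>
    intro i j hi hj h0 h1
    have : j + 1 = q.length := by
      by_contra hne
      have h2 := hq.interior_of_eq hp (i := j + 1) (j := i + 1) (by omega) (by omega) (by omega)
        h1.symm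
      omega
    refine ⟨this, fun l hl => ?_⟩
    obtain rfl : l = 0 := by omega
    exact h1
  | succ k ih =>
    intro i j hi hj h0 h1
    have h2 := hp.interior_of_eq hq (i := i + 1) (j := j + 1) (by omega) (by omega) (by omega) h1
    have h3 : p.getVert (i + 1 + 1) = q.getVert (j + 1 + 1) := by
      have h4 := hp.adj (i := i + 1) (by omega)
      rw [h1] at h4
      rcases hq.eq_or_eq_of_adj h2.1 h2.2 h4 with h5 | h5
      · rw [Nat.add_sub_cancel, ← h0] at h5
        have := getVert_inj hp.1 (by omega) (by omega) h5
        omega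
      · exact h5
    obtain ⟨h4, h5⟩ := ih (i + 1) (j + 1) (by omega) h2.2 h1 h3
    refine ⟨by omega, fun l hl => ?_⟩
    rcases l with _ | l
    · exact h1
    · have := h5 l (by omega)
      rwa [show i + 1 + (l + 1) = i + 1 + 1 + l by ring,
        show j + 1 + (l + 1) = j + 1 + 1 + l by ring]

theorem eq_of_eq_adjacent [Finite W] (hp : IsMaxDegTwoPath R p) (hq : IsMaxDegTwoPath R q)
    {i j : ℕ} (hi : 0 < i) (hi' : i < p.length) (hj : 0 < j) (hj' : j < q.length)
    (h : p.getVert i = q.getVert j) (h' : p.getVert (i + 1) = q.getVert (j + 1)) :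
    p.length = q.length ∧ ∀ k ≤ p.length, p.getVert k = q.getVert k := by
  have hprev : p.getVert (i - 1) = q.getVert (j - 1) := by
    have h4 := (hp.adj (i := i - 1) (by omega)).symm
    rw [Nat.sub_add_cancel hi, h] at h4
    rcases hq.eq_or_eq_of_adj hj hj' h4 with h5 | h5
    · exact h5
    · rw [← h'] at h5
      have := getVert_inj hp.1 (by omega) (by omega) h5
      omega
  obtain ⟨h1, h2⟩ := hp.eq_forward hq (p.length - (i + 1)) i j (by omega) hj' h h'
  obtain ⟨h3, h4⟩ := hp.reverse.eq_forward hq.reverse (i - 1) (p.length - i) (q.length - j)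
    (by rw [Walk.length_reverse]; omega) (by rw [Walk.length_reverse]; omega)
    (by
      rw [Walk.getVert_reverse, Walk.getVert_reverse, Nat.sub_sub_self hi'.le,
        Nat.sub_sub_self hj'.le, h])
    (by
      rw [Walk.getVert_reverse, Walk.getVert_reverse,
        show p.length - (p.length - i + 1) = i - 1 by omega,
        show q.length - (q.length - j + 1) = j - 1 by omega, hprev])
  rw [Walk.length_reverse] at h3
  have hij : i = j := by omega
  subst hij
  refine ⟨by omega, fun k hk => ?_⟩
  rcases lt_trichotomy k i with hki | rfl | hki
  · have := h4 (i - 1 - k) (by omega)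
    rw [Walk.getVert_reverse, Walk.getVert_reverse,
      show p.length - (p.length - i + 1 + (i - 1 - k)) = k by omega,
      show q.length - (q.length - i + 1 + (i - 1 - k)) = k by omega] at this
    exact this
  · exact h
  · have := h2 (k - (i + 1)) (by omega)
    rwa [Nat.add_sub_cancel' hki] at this

/-- A maximal degree-2 path is determined, up to its direction, by any of its internal vertices. -/
theorem eq_or_eq_reverse [Finite W] (hp : IsMaxDegTwoPath R p) (hq : IsMaxDegTwoPath R q)
    {i j : ℕ} (hi : 0 < i) (hi' : i < p.length) (hj : j ≤ q.length)
    (h : p.getVert i = q.getVert j) :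
    p.length = q.length ∧ ((∀ k ≤ p.length, p.getVert k = q.getVert k) ∨
      ∀ k ≤ p.length, p.getVert k = q.reverse.getVert k) := by
  obtain ⟨h1, h2⟩ := hp.interior_of_eq hq hi hi' hj h
  have h3 := hp.adj hi'
  rw [h] at h3
  rcases hq.eq_or_eq_of_adj h1 h2 h3 with h4 | h4
  · have := hp.eq_of_eq_adjacent hq.reverse (j := q.length - j) hi hi' (by omega)
      (by rw [Walk.length_reverse]; omega)
      (by rw [Walk.getVert_reverse, Nat.sub_sub_self hj, h])
      (by rw [Walk.getVert_reverse, show q.length - (q.length - j + 1) = j - 1 by omega, h4])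
    rw [Walk.length_reverse] at this
    exact ⟨this.1, Or.inr this.2⟩
  · have := hp.eq_of_eq_adjacent hq hi hi' h1 h2 h h4
    exact ⟨this.1, Or.inl this.2⟩

end IsMaxDegTwoPath

end Subtrees

end PDP

/-! ### Positions of tree vertices along a long path. -/

namespace PDP

open SimpleGraph

section Positions

variable {W : Type*} {H : SimpleGraph W} {R : H.Subgraph} {L : ℕ}

theorem deletePath_adj {a b : W} {p : H.Walk a b} {y z : W} :
    (deletePath R p).Adj y z ↔ R.Adj y z ∧ ¬ (y ∈ p.support ∧ y ≠ a ∧ y ≠ b) ∧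
      ¬ (z ∈ p.support ∧ z ≠ a ∧ z ≠ b) ∧ s(y, z) ∉ p.edges := by
  simp only [deletePath, Subgraph.deleteEdges_adj, Subgraph.deleteVerts_adj]
  exact ⟨fun h => ⟨h.1.2.2.2.2, h.1.2.1, h.1.2.2.2.1, h.2⟩,
    fun h => ⟨⟨h.1.fst_mem, h.2.1, h.1.snd_mem, h.2.2.1, h.1⟩, h.2.2.2⟩⟩

theorem mem_deletePath_verts {a b : W} {p : H.Walk a b} {y : W} :
    y ∈ (deletePath R p).verts ↔ y ∈ R.verts ∧ ¬ (y ∈ p.support ∧ y ≠ a ∧ y ≠ b) := Iff.rfl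

theorem deletePath_le {a b : W} {p : H.Walk a b} : deletePath R p ≤ R :=
  ⟨fun _ hx => (mem_deletePath_verts.1 hx).1, fun _ _ h => (deletePath_adj.1 h).1⟩

namespace LongPath

theorem ext_getVert {P Q : LongPath R L} (hlen : P.walk.length = Q.walk.length)
    (h : ∀ k ≤ P.walk.length, P.walk.getVert k = Q.walk.getVert k) : P = Q := by
  obtain ⟨a, b, p, hp, hp'⟩ := P
  obtain ⟨c, d, q, hq, hq'⟩ := Q
  simp only at hlen h
  have h0 := h 0 (Nat.zero_le _)
  rw [Walk.getVert_zero, Walk.getVert_zero] at h0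
  have h1 := h p.length le_rfl
  rw [Walk.getVert_length, hlen, Walk.getVert_length] at h1
  subst h0 h1
  obtain rfl : p = q := Walk.ext_getVert_le_length hlen h
  rfl

variable (P : LongPath R L)

@[simp] theorem rev_rev : P.rev.rev = P := by
  obtain ⟨a, b, p, hp, hp'⟩ := P
  simp [rev]

@[simp] theorem length_rev : P.rev.walk.length = P.walk.length := P.walk.length_reverse

theorem getVert_rev (i : ℕ) : P.rev.walk.getVert i = P.walk.getVert (P.walk.length - i) :=
  P.walk.getVert_reverse i

open Classical in
/-- The position of a vertex of the tree with respect to the path: the vertices that hang off the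
source or the target have the position of this endpoint. -/
noncomputable def pos (z : W) : ℕ :=
  if h : ∃ i ≤ P.walk.length, P.walk.getVert i = z then h.choose
  else if z ∈ component (deletePath R P.walk) P.tgt then P.walk.length else 0

theorem pos_getVert {i : ℕ} (hi : i ≤ P.walk.length) : P.pos (P.walk.getVert i) = i := by
  have h : ∃ j ≤ P.walk.length, P.walk.getVert j = P.walk.getVert i := ⟨i, hi, rfl⟩
  rw [pos, dif_pos h]
  exact getVert_inj P.maxDegTwo.1 h.choose_spec.1 hi h.choose_spec.2

theorem pos_src : P.pos P.src = 0 := by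
  have := P.pos_getVert (Nat.zero_le _)
  rwa [Walk.getVert_zero] at this

theorem pos_tgt : P.pos P.tgt = P.walk.length := by
  have := P.pos_getVert le_rfl
  rwa [Walk.getVert_length] at this

theorem pos_le (z : W) : P.pos z ≤ P.walk.length := by
  unfold pos
  split_ifs with h
  · exact h.choose_spec.1
  · exact le_rfl
  · exact Nat.zero_le _

theorem getVert_pos {z : W} (h0 : 0 < P.pos z) (h1 : P.pos z < P.walk.length) :
    P.walk.getVert (P.pos z) = z := by
  by_cases h : ∃ i ≤ P.walk.length, P.walk.getVert i = z
  · have : P.pos z = h.choose := dif_pos h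
    rw [this]
    exact h.choose_spec.2
  · rw [pos, dif_neg h] at h0 h1
    split_ifs at h0 h1 <;> omega

theorem getVert_mem (i : ℕ) : P.walk.getVert i ∈ R.verts := P.maxDegTwo.getVert_mem_verts i

theorem src_mem : P.src ∈ R.verts := by
  have := P.getVert_mem 0
  rwa [Walk.getVert_zero] at this

theorem tgt_mem : P.tgt ∈ R.verts := P.rev.src_mem

theorem src_mem_deletePath : P.src ∈ (deletePath R P.walk).verts :=
  mem_deletePath_verts.2 ⟨P.src_mem, fun h => h.2.1 rfl⟩

theorem tgt_mem_deletePath : P.tgt ∈ (deletePath R P.walk).verts :=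
  mem_deletePath_verts.2 ⟨P.tgt_mem, fun h => h.2.2 rfl⟩

theorem deletePath_rev : deletePath R P.rev.walk = deletePath R P.walk := by
  have h1 : {w | w ∈ P.rev.walk.support ∧ w ≠ P.rev.src ∧ w ≠ P.rev.tgt} =
      {w | w ∈ P.walk.support ∧ w ≠ P.src ∧ w ≠ P.tgt} := by
    ext w
    have : w ∈ P.rev.walk.support ↔ w ∈ P.walk.support := by
      simp [rev]
    exact ⟨fun h => ⟨this.1 h.1, h.2.2, h.2.1⟩, fun h => ⟨this.2 h.1, h.2.2, h.2.1⟩⟩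
  have h2 : {e | e ∈ P.rev.walk.edges} = {e | e ∈ P.walk.edges} := by
    ext e
    simp [rev]
  rw [deletePath, deletePath, h1, h2]

/-- A common vertex would give a path of the tree between the endpoints without the edges of `P`,
against uniqueness of paths. -/
theorem disjoint_components (hR : R.coe.IsTree) (hL : 1 ≤ L) :
    Disjoint (component (deletePath R P.walk) P.src) (component (deletePath R P.walk) P.tgt) := by
  classical
  rw [Set.disjoint_left]
  intro z hz hz'
  obtain ⟨h1, h2⟩ := mem_component_iff.1 hz
  obtain ⟨p, hp⟩ := mem_component_iff.2 ⟨h1,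
    h2.trans (reflTransGen_symm (mem_component_iff.1 hz').2)⟩
  have h3 : p.bypass.toSubgraph ≤ deletePath R P.walk :=
    Walk.toSubgraph_bypass_le_toSubgraph.trans hp
  rw [path_unique_of_isTree hR p.bypass_isPath P.maxDegTwo.1 (h3.trans deletePath_le)
    P.maxDegTwo.2.1] at h3
  have h4 : 0 < P.walk.length := lt_of_lt_of_le hL P.long
  have h5 := (toSubgraph_le_iff_getVert.1 h3).2 0 h4
  refine (deletePath_adj.1 h5).2.2.2 ?_
  rw [← Walk.mem_edges_toSubgraph]
  exact P.walk.toSubgraph_adj_getVert h4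

theorem pos_eq_of_mem_target {z : W} (hR : R.coe.IsTree) (hL : 1 ≤ L)
    (hz : z ∈ component (deletePath R P.walk) P.tgt) : P.pos z = P.walk.length := by
  by_cases h : ∃ i ≤ P.walk.length, P.walk.getVert i = z
  · obtain ⟨i, hi, rfl⟩ := h
    rw [P.pos_getVert hi]
    have h1 := (mem_deletePath_verts.1 (component_subset_verts hz)).2
    by_contra hne
    refine h1 ⟨P.walk.getVert_mem_support i, ?_,
      P.maxDegTwo.getVert_ne_end (lt_of_le_of_ne hi hne)⟩
    intro h2
    rw [h2] at hz
    exact Set.disjoint_left.1 (P.disjoint_components hR hL)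
      (mem_component_self P.src_mem_deletePath) hz
  · rw [pos, dif_neg h, if_pos hz]

theorem pos_eq_zero_of_mem_source {z : W} (hR : R.coe.IsTree) (hL : 1 ≤ L)
    (hz : z ∈ component (deletePath R P.walk) P.src) : P.pos z = 0 := by
  by_cases h : ∃ i ≤ P.walk.length, P.walk.getVert i = z
  · obtain ⟨i, hi, rfl⟩ := h
    rw [P.pos_getVert hi]
    have h1 := (mem_deletePath_verts.1 (component_subset_verts hz)).2
    by_contra hne
    refine h1 ⟨P.walk.getVert_mem_support i,
      P.maxDegTwo.getVert_ne_start (Nat.pos_of_ne_zero hne) hi, ?_⟩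
    intro h2
    rw [h2] at hz
    exact Set.disjoint_left.1 (P.disjoint_components hR hL) hz
      (mem_component_self P.tgt_mem_deletePath)
  · rw [pos, dif_neg h, if_neg (Set.disjoint_left.1 (P.disjoint_components hR hL) hz)]

theorem mem_edges_iff {y z : W} : s(y, z) ∈ P.walk.edges ↔
    ∃ i < P.walk.length, s(P.walk.getVert i, P.walk.getVert (i + 1)) = s(y, z) := by
  rw [← Walk.mem_edges_toSubgraph, Subgraph.mem_edgeSet, Walk.toSubgraph_adj_iff]
  exact ⟨fun ⟨i, h, h'⟩ => ⟨i, h', h⟩, fun ⟨i, h, h'⟩ => ⟨i, h', h⟩⟩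

theorem mem_edges_of_adj [Finite W] {y z : W} (h : R.Adj y z)
    (hy : y ∈ P.walk.support ∧ y ≠ P.src ∧ y ≠ P.tgt) : s(y, z) ∈ P.walk.edges := by
  obtain ⟨⟨i, rfl, hi⟩, h1, h2⟩ := And.imp_left Walk.mem_support_iff_exists_getVert.1 hy
  have hi0 : 0 < i := by
    rw [Nat.pos_iff_ne_zero]
    rintro rfl
    exact h1 P.walk.getVert_zero
  have hi1 : i < P.walk.length := by
    refine lt_of_le_of_ne hi ?_
    rintro rfl
    exact h2 P.walk.getVert_length
  rw [P.mem_edges_iff]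
  rcases P.maxDegTwo.eq_or_eq_of_adj hi0 hi1 h with rfl | rfl
  · exact ⟨i - 1, by omega, by rw [Nat.sub_add_cancel hi0, Sym2.eq_swap]⟩
  · exact ⟨i, hi1, rfl⟩

/-- A walk in the tree that enters or leaves the interior of `P` does so along `P`, since internal
vertices have no other edges. -/
theorem mem_components_or [Finite W] (hR : R.coe.IsTree) {z : W} (hz : z ∈ R.verts) :
    z ∈ component (deletePath R P.walk) P.src ∨ z ∈ component (deletePath R P.walk) P.tgt ∨
      (z ∈ P.walk.support ∧ z ≠ P.src ∧ z ≠ P.tgt) := by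
  have h := reflTransGen_of_isTree hR P.src_mem hz
  clear hz
  have hsupp : ∀ z ∈ P.walk.support, z ∈ component (deletePath R P.walk) P.src ∨
      z ∈ component (deletePath R P.walk) P.tgt ∨
      (z ∈ P.walk.support ∧ z ≠ P.src ∧ z ≠ P.tgt) := by
    intro z hz
    by_cases h1 : z = P.src
    · rw [h1]
      exact Or.inl (mem_component_self P.src_mem_deletePath)
    by_cases h2 : z = P.tgt
    · rw [h2]
      exact Or.inr (Or.inl (mem_component_self P.tgt_mem_deletePath))
    exact Or.inr (Or.inr ⟨hz, h1, h2⟩)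
  induction h with
  | refl => exact Or.inl (mem_component_self P.src_mem_deletePath)
  | @tail y z _ hyz ih =>
    by_cases hz : z ∈ P.walk.support
    · exact hsupp z hz
    have hedge : s(y, z) ∉ P.walk.edges := fun h => hz (P.walk.snd_mem_support_of_mem_edges h)
    have hy : ¬ (y ∈ P.walk.support ∧ y ≠ P.src ∧ y ≠ P.tgt) :=
      fun h => hedge (P.mem_edges_of_adj hyz h)
    have hadj : (deletePath R P.walk).Adj y z :=
      deletePath_adj.2 ⟨hyz, hy, fun h => hz h.1, hedge⟩
    rcases ih with h | h | h
    · exact Or.inl (mem_component_of_adj h hadj)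
    · exact Or.inr (Or.inl (mem_component_of_adj h hadj))
    · exact absurd h hy

theorem pos_interior {z : W} (hz : z ∈ P.walk.support ∧ z ≠ P.src ∧ z ≠ P.tgt) :
    0 < P.pos z ∧ P.pos z < P.walk.length := by
  obtain ⟨⟨i, rfl, hi⟩, h1, h2⟩ := And.imp_left Walk.mem_support_iff_exists_getVert.1 hz
  rw [P.pos_getVert hi]
  constructor
  · rw [Nat.pos_iff_ne_zero]
    rintro rfl
    exact h1 P.walk.getVert_zero
  · refine lt_of_le_of_ne hi ?_
    rintro rfl
    exact h2 P.walk.getVert_length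

theorem mem_source_of_pos_eq_zero [Finite W] (hR : R.coe.IsTree) (hL : 1 ≤ L) {z : W}
    (hz : z ∈ R.verts) (h : P.pos z = 0) : z ∈ component (deletePath R P.walk) P.src := by
  rcases P.mem_components_or hR hz with h1 | h1 | h1
  · exact h1
  · have := P.pos_eq_of_mem_target hR hL h1
    have := P.long
    omega
  · have := P.pos_interior h1
    omega

theorem pos_rev [Finite W] (hR : R.coe.IsTree) (hL : 1 ≤ L) {z : W} (hz : z ∈ R.verts) :
    P.rev.pos z = P.walk.length - P.pos z := by
  rcases P.mem_components_or hR hz with h1 | h1 | h1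
  · rw [P.pos_eq_zero_of_mem_source hR hL h1]
    rw [← P.deletePath_rev] at h1
    rw [P.rev.pos_eq_of_mem_target hR hL h1, length_rev, Nat.sub_zero]
  · rw [P.pos_eq_of_mem_target hR hL h1]
    rw [← P.deletePath_rev] at h1
    rw [P.rev.pos_eq_zero_of_mem_source hR hL h1, Nat.sub_self]
  · obtain ⟨h2, h3⟩ := P.pos_interior h1
    have h4 := P.getVert_rev (P.walk.length - P.pos z)
    rw [Nat.sub_sub_self h3.le, P.getVert_pos h2 h3] at h4
    conv_lhs => rw [← h4]
    exact P.rev.pos_getVert (by rw [length_rev]; omega)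

/-- Along an edge of the tree, the position stays the same at one of the ends of the path, or
the edge is an edge of the path. -/
theorem pos_of_adj [Finite W] (hR : R.coe.IsTree) (hL : 1 ≤ L) {y z : W} (h : R.Adj y z) :
    (P.pos y = P.pos z ∧ (P.pos y = 0 ∨ P.pos y = P.walk.length)) ∨
    (P.pos z = P.pos y + 1 ∧ P.walk.getVert (P.pos y) = y ∧ P.walk.getVert (P.pos z) = z) ∨
    (P.pos y = P.pos z + 1 ∧ P.walk.getVert (P.pos y) = y ∧ P.walk.getVert (P.pos z) = z) := by
  by_cases hedge : s(y, z) ∈ P.walk.edges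
  · obtain ⟨i, hi, hi'⟩ := P.mem_edges_iff.1 hedge
    rcases Sym2.eq_iff.1 hi' with ⟨rfl, rfl⟩ | ⟨rfl, rfl⟩
    · rw [P.pos_getVert hi.le, P.pos_getVert hi]
      exact Or.inr (Or.inl ⟨rfl, rfl, rfl⟩)
    · rw [P.pos_getVert hi.le, P.pos_getVert hi]
      exact Or.inr (Or.inr ⟨rfl, rfl, rfl⟩)
  · have hy : ¬ (y ∈ P.walk.support ∧ y ≠ P.src ∧ y ≠ P.tgt) :=
      fun h' => hedge (P.mem_edges_of_adj h h')
    have hz : ¬ (z ∈ P.walk.support ∧ z ≠ P.src ∧ z ≠ P.tgt) :=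
      fun h' => hedge (by rw [Sym2.eq_swap]; exact P.mem_edges_of_adj h.symm h')
    have hadj : (deletePath R P.walk).Adj y z := deletePath_adj.2 ⟨h, hy, hz, hedge⟩
    left
    rcases P.mem_components_or hR h.fst_mem with h1 | h1 | h1
    · rw [P.pos_eq_zero_of_mem_source hR hL h1,
        P.pos_eq_zero_of_mem_source hR hL (mem_component_of_adj h1 hadj)]
      exact ⟨rfl, Or.inl rfl⟩
    · rw [P.pos_eq_of_mem_target hR hL h1,
        P.pos_eq_of_mem_target hR hL (mem_component_of_adj h1 hadj)]
      exact ⟨rfl, Or.inr rfl⟩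
    · exact absurd h1 hy

theorem exists_walk_from_source [Finite W] (hR : R.coe.IsTree) (hL : 1 ≤ L) {x : W}
    (hx : x ∈ R.verts) (hpos : P.pos x < P.walk.length) :
    ∃ u ∈ component (deletePath R P.walk) P.src, ∃ r : H.Walk u x, r.length ≤ P.pos x := by
  by_cases h0 : P.pos x = 0
  · exact ⟨x, P.mem_source_of_pos_eq_zero hR hL hx h0, .nil, by simp⟩
  · have h2 := P.getVert_pos (Nat.pos_of_ne_zero h0) hpos
    refine ⟨P.src, mem_component_self P.src_mem_deletePath,
      (P.walk.take (P.pos x)).copy rfl h2, ?_⟩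
    simp

/-- In the absence of detours, distances in `H` are at least the differences of positions. -/
theorem pos_le_pos_add [Finite W] (hR : R.coe.IsTree) (hL : 1 ≤ L) (hdet : ¬ HasDetour R)
    {y z : W} (hy : y ∈ R.verts) (hz : z ∈ R.verts) (q : H.Walk y z) :
    P.pos z ≤ P.pos y + q.length := by
  classical
  rcases (P.pos_le y).eq_or_lt with h | hy'
  · have := P.pos_le z
    omega
  rcases Nat.eq_zero_or_pos (P.pos z) with h | hz'
  · omega
  have hzr := P.pos_rev hR hL hz
  have hzl := P.pos_le z
  obtain ⟨u, hu, r, hr⟩ := P.exists_walk_from_source hR hL hy hy'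
  obtain ⟨w, hw, t, ht⟩ := P.rev.exists_walk_from_source hR hL hz (by rw [length_rev]; omega)
  rw [P.deletePath_rev] at hw
  by_contra! hcon
  -- From the source side along `P` to `y`, across to `z` by `q`, and along `P` to the target side.
  -- If `q` were too short, this would be a detour.
  let s : H.Walk u w := r.append (q.append t.reverse)
  have hs : s.length < P.walk.length := by
    simp only [s, Walk.length_append, Walk.length_reverse]
    omega
  exact hdet ⟨_, _, P.walk, P.maxDegTwo, u, w, s.bypass, s.bypass_isPath,
    lt_of_le_of_lt (s.length_bypass_le_length) hs, hu, hw⟩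

/-! ### The two parts of the tree around the start of a path -/

theorem mem_first {m : ℕ} (hm : m ≤ P.walk.length + 1) {x : W} :
    x ∈ P.first m ↔ ∃ i < m, P.walk.getVert i = x := by
  simp only [first, Set.mem_ofPred_eq, List.mem_take_iff_getElem, Walk.length_support,
    Walk.support_getElem_eq_getVert, min_eq_left hm]
  exact ⟨fun ⟨i, h, h'⟩ => ⟨i, h, h'⟩, fun ⟨i, h, h'⟩ => ⟨i, h, h'⟩⟩

/-- With `2 ≤ m` the second vertex of the path is deleted, so the component cannot move past
position 0. -/
theorem mem_component_deleteVerts_first [Finite W] (hR : R.coe.IsTree) (hL : 1 ≤ L) {m : ℕ}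
    (hm : 2 ≤ m) (hm' : m ≤ P.walk.length) {x : W} :
    x ∈ component (R.deleteVerts (P.first m \ {P.src})) P.src ↔ x ∈ R.verts ∧ P.pos x = 0 := by
  constructor
  · intro hx
    refine ⟨(component_subset_verts hx).1, ?_⟩
    refine component_induct (P := fun y => P.pos y = 0) hx P.pos_src fun y z hyz hy => ?_
    rw [Subgraph.deleteVerts_adj] at hyz
    obtain ⟨-, -, -, hz, hadj⟩ := hyz
    rcases P.pos_of_adj hR hL hadj with ⟨h1, -⟩ | ⟨h1, -, h2⟩ | ⟨h1, -⟩
    · omega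
    · refine absurd ⟨(P.mem_first (by omega)).2 ⟨P.pos z, by omega, h2⟩, ?_⟩ hz
      rintro rfl
      rw [P.pos_src] at h1
      omega
    · omega
  · rintro ⟨hx, h0⟩
    have hle : deletePath R P.walk ≤ R.deleteVerts (P.first m \ {P.src}) := by
      have hinner : ∀ y, ¬ (y ∈ P.walk.support ∧ y ≠ P.src ∧ y ≠ P.tgt) →
          y ∉ P.first m \ {P.src} := by
        rintro y hy ⟨h1, h2⟩
        obtain ⟨i, hi, rfl⟩ := (P.mem_first (by omega)).1 h1
        exact hy ⟨P.walk.getVert_mem_support i, h2, P.maxDegTwo.getVert_ne_end (by omega)⟩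
      refine ⟨fun y hy => ⟨(mem_deletePath_verts.1 hy).1, hinner y (mem_deletePath_verts.1 hy).2⟩,
        fun y z h => ?_⟩
      obtain ⟨h1, h2, h3, -⟩ := deletePath_adj.1 h
      exact Subgraph.deleteVerts_adj.2 ⟨h1.fst_mem, hinner y h2, h1.snd_mem, hinner z h3, h1⟩
    obtain ⟨p, hp⟩ := P.mem_source_of_pos_eq_zero hR hL hx h0
    exact ⟨p, hp.trans hle⟩

theorem mem_partA_iff [Finite W] (hR : R.coe.IsTree) (hL : 1 ≤ L) {m : ℕ} (hm : 2 ≤ m)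
    (hm' : m ≤ P.walk.length) {x : W} :
    x ∈ P.partA m ↔ x ∈ R.verts ∧ P.pos x < m / 2 := by
  rw [partA, Set.mem_union, P.mem_component_deleteVerts_first hR hL hm hm',
    P.mem_first (by omega)]
  constructor
  · rintro (⟨i, hi, rfl⟩ | ⟨h1, h2⟩)
    · rw [P.pos_getVert (by omega)]
      exact ⟨P.getVert_mem i, hi⟩
    · exact ⟨h1, by omega⟩
  · rintro ⟨h1, h2⟩
    rcases Nat.eq_zero_or_pos (P.pos x) with h | h
    · exact Or.inr ⟨h1, h⟩
    · exact Or.inl ⟨_, h2, P.getVert_pos h (by omega)⟩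

theorem mem_partB_iff [Finite W] (hR : R.coe.IsTree) (hL : 1 ≤ L) {m : ℕ} (hm : 2 ≤ m)
    (hm' : m ≤ P.walk.length) {x : W} :
    x ∈ P.partB m ↔ x ∈ R.verts ∧ m ≤ P.pos x := by
  rw [partB, Set.mem_sdiff, Set.mem_union, P.mem_partA_iff hR hL hm hm', P.mem_first (by omega)]
  constructor
  · rintro ⟨h1, h2⟩
    refine ⟨h1, ?_⟩
    by_contra! h3
    refine h2 ?_
    rcases Nat.eq_zero_or_pos (P.pos x) with h | h
    · exact Or.inl ⟨h1, by omega⟩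
    · exact Or.inr ⟨_, h3, P.getVert_pos h (by omega)⟩
  · rintro ⟨h1, h2⟩
    refine ⟨h1, ?_⟩
    rintro (⟨-, h3⟩ | ⟨i, hi, rfl⟩)
    · omega
    · rw [P.pos_getVert (by omega)] at h2
      omega

/-! ### Two different paths -/

/-- An internal vertex of `P` on `Q` would make the paths equal up to direction. So positions along
`Q` are extreme, and as an edge changes them by at most one, they are constant. -/
theorem pos_getVert_of_ne [Finite W] (hR : R.coe.IsTree) (hL : 2 ≤ L) {P Q : LongPath R L}
    (h1 : Q ≠ P) (h2 : Q ≠ P.rev) :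
    (∀ j ≤ Q.walk.length, P.pos (Q.walk.getVert j) = 0) ∨
      ∀ j ≤ Q.walk.length, P.pos (Q.walk.getVert j) = P.walk.length := by
  have hP := P.long
  have hend : ∀ j ≤ Q.walk.length, P.pos (Q.walk.getVert j) = 0 ∨
      P.pos (Q.walk.getVert j) = P.walk.length := by
    intro j hj
    by_contra! hcon
    have h3 := P.getVert_pos (Nat.pos_of_ne_zero hcon.1)
      (lt_of_le_of_ne (P.pos_le _) hcon.2)
    obtain ⟨h4, h5 | h5⟩ := P.maxDegTwo.eq_or_eq_reverse Q.maxDegTwo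
      (Nat.pos_of_ne_zero hcon.1) (lt_of_le_of_ne (P.pos_le _) hcon.2) hj h3
    · exact h1 (ext_getVert h4 h5).symm
    · refine h2 ?_
      rw [ext_getVert (P := P) (Q := Q.rev) (by rw [length_rev, h4]) h5, rev_rev]
  have hstep : ∀ j ≤ Q.walk.length, P.pos (Q.walk.getVert j) = P.pos (Q.walk.getVert 0) := by
    intro j
    induction j with
    | zero => exact fun _ => rfl
    | succ j ih =>
      intro hj
      have h3 := ih (by omega)
      have h4 := hend j (by omega)
      have h5 := hend (j + 1) hj
      rcases P.pos_of_adj hR (by omega) (Q.maxDegTwo.adj (i := j) (by omega))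
        with h6 | h6 | h6 <;> omega
  rcases hend 0 (Nat.zero_le _) with h | h
  · exact Or.inl fun j hj => (hstep j hj).trans h
  · exact Or.inr fun j hj => (hstep j hj).trans h

end LongPath

end Positions

end PDP

/-! ### Middle regions: connectedness and disjointness. -/

namespace PDP

open SimpleGraph

section Regions

variable {W : Type*} {H : SimpleGraph W} {R : H.Subgraph} {L : ℕ}

/-- The hypotheses on a tree and its separators under which the middle regions of different long
paths are disjoint. -/
structure SmallSeparators (N : ℕ) (sep : LongPath R L → Finset W) : Prop where
  tree : R.coe.IsTree
  noDetour : ¬ HasDetour R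
  connected : H.Connected
  two_le : 2 ≤ N
  length_eq : L = 10000 * N
  isMin : ∀ P, IsMinSeparator H (sep P) (P.partA (100 * N)) (P.partB (100 * N))
  sep_connected : ∀ P, ∀ s ∈ sep P, ∀ t ∈ sep P, Avoid H (sep P : Set W)ᶜ s t
  card_le : ∀ P, (sep P).card ≤ 2 * N + 3

/-- The union of the two separators of a path. -/
def LongPath.seps (sep : LongPath R L → Finset W) (P : LongPath R L) : Set W :=
  {y | y ∈ sep P ∨ y ∈ sep P.rev}

theorem LongPath.seps_rev (sep : LongPath R L → Finset W) (P : LongPath R L) :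
    P.rev.seps sep = P.seps sep := by
  ext y
  simp only [seps, rev_rev]
  exact or_comm

theorem LongPath.mem_comp {sep : LongPath R L → Finset W} {P : LongPath R L} {x : W} :
    x ∈ P.comp sep ↔ Avoid H (P.seps sep) P.src x := by
  constructor
  · rintro ⟨p, hp⟩
    exact ⟨p, fun y hy h => h.elim (hp y hy).1 (hp y hy).2⟩
  · rintro ⟨p, hp⟩
    exact ⟨p, fun y hy => ⟨fun h => hp y hy (Or.inl h), fun h => hp y hy (Or.inr h)⟩⟩

theorem LongPath.midRegion_rev (sep : LongPath R L → Finset W) (P : LongPath R L) :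
    P.rev.midRegion sep = P.midRegion sep := by
  rw [midRegion, midRegion, rev_rev, Set.union_comm]

theorem LongPath.mem_midRegion {sep : LongPath R L → Finset W} {P : LongPath R L} {x : W} :
    x ∈ P.midRegion sep ↔ x ∉ P.comp sep ∧ x ∉ P.rev.comp sep := by
  simp only [midRegion, Set.mem_compl_iff, Set.mem_union, not_or]

theorem LongPath.mem_comp_of_adj {sep : LongPath R L → Finset W} {P : LongPath R L} {x y : W}
    (hx : x ∈ P.comp sep) (h : H.Adj x y) (hy : y ∉ P.seps sep) : y ∈ P.comp sep := by
  rw [mem_comp] at hx ⊢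
  exact hx.trans (.of_adj h hx.right hy)

/-- The initial part of the tree up to a given position is connected; walks in it avoid any set that
meets the tree only further along. -/
theorem LongPath.avoid_of_pos_le [Finite W] (hR : R.coe.IsTree) (hL : 1 ≤ L) (P : LongPath R L)
    {z : W} {i : ℕ} (hz : z ∈ R.verts) (hzi : P.pos z ≤ i)
    (hi : i < P.walk.length) : Avoid H {w | ¬ (w ∈ R.verts ∧ P.pos w ≤ i)} P.src z := by
  have hsrc : P.src ∉ {w | ¬ (w ∈ R.verts ∧ P.pos w ≤ i)} :=
    not_not.2 ⟨P.src_mem, by rw [P.pos_src]; omega⟩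
  rcases Nat.eq_zero_or_pos (P.pos z) with h0 | h0
  · have hc := P.mem_source_of_pos_eq_zero hR hL hz h0
    have : z ∈ component (deletePath R P.walk) P.src ∧
        Avoid H {w | ¬ (w ∈ R.verts ∧ P.pos w ≤ i)} P.src z := by
      refine component_induct (P := fun z => z ∈ component (deletePath R P.walk) P.src ∧
        Avoid H {w | ¬ (w ∈ R.verts ∧ P.pos w ≤ i)} P.src z) hc
        ⟨mem_component_self P.src_mem_deletePath, .refl hsrc⟩ ?_
      rintro x y hxy ⟨hx, hx'⟩
      have hy := mem_component_of_adj hx hxy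
      refine ⟨hy, hx'.trans (.of_adj hxy.adj_sub hx'.right (not_not.2 ⟨?_, ?_⟩))⟩
      · exact (deletePath_le.1 hxy.snd_mem)
      · rw [P.pos_eq_zero_of_mem_source hR hL hy]
        omega
    exact this.2
  · have h1 := P.getVert_pos h0 (by omega)
    have h2 := Avoid.of_getVert (S := {w | ¬ (w ∈ R.verts ∧ P.pos w ≤ i)}) P.walk
      (Nat.zero_le (P.pos z)) (P.pos_le z) fun r _ hr => not_not.2 ⟨P.getVert_mem r, by
        rw [P.pos_getVert (by omega)]; omega⟩
    rwa [h1, Walk.getVert_zero] at h2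

namespace SmallSeparators

variable {N : ℕ} {sep : LongPath R L → Finset W}

theorem one_le (h : SmallSeparators N sep) : 1 ≤ L := by
  have := h.two_le
  have := h.length_eq
  omega

theorem le_length (h : SmallSeparators N sep) (P : LongPath R L) : 10000 * N ≤ P.walk.length := by
  have := P.long
  have := h.length_eq
  omega

theorem mem_partA (h : SmallSeparators N sep) (P : LongPath R L) [Finite W] {x : W} :
    x ∈ P.partA (100 * N) ↔ x ∈ R.verts ∧ P.pos x < 50 * N := by
  have := h.two_le
  have := h.le_length P
  rw [P.mem_partA_iff h.tree h.one_le (by omega) (by omega),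
    show 100 * N / 2 = 50 * N by omega]

theorem mem_partB (h : SmallSeparators N sep) (P : LongPath R L) [Finite W] {x : W} :
    x ∈ P.partB (100 * N) ↔ x ∈ R.verts ∧ 100 * N ≤ P.pos x := by
  have := h.two_le
  have := h.le_length P
  rw [P.mem_partB_iff h.tree h.one_le (by omega) (by omega)]

theorem pos_of_mem_sep (h : SmallSeparators N sep) (P : LongPath R L) [Finite W] {s : W}
    (hs : s ∈ sep P) (hsR : s ∈ R.verts) :
    50 * N ≤ P.pos s ∧ P.pos s < 100 * N := by
  have h1 := Set.disjoint_left.1 (h.isMin P).1 (Finset.mem_coe.2 hs)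
  rw [Set.mem_union, h.mem_partA, h.mem_partB, not_or] at h1
  by_contra hcon
  rw [not_and_or] at hcon
  rcases hcon with h2 | h2
  · exact h1.1 ⟨hsR, by omega⟩
  · exact h1.2 ⟨hsR, by omega⟩

theorem not_avoid (h : SmallSeparators N sep) (P : LongPath R L) [Finite W] {x y : W}
    (hx : x ∈ R.verts) (hxp : P.pos x < 50 * N)
    (hy : y ∈ R.verts) (hyp : 100 * N ≤ P.pos y) : ¬ Avoid H (sep P : Set W) x y :=
  separates_iff.1 (h.isMin P).2.1 x ((h.mem_partA P).2 ⟨hx, hxp⟩) y ((h.mem_partB P).2 ⟨hy, hyp⟩)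

theorem exists_getVert_mem_sep (h : SmallSeparators N sep) (P : LongPath R L) [Finite W] : ∃ i ≤
    P.walk.length, P.walk.getVert i ∈ sep P := by
  have h1 := h.two_le
  have h2 := h.le_length P
  obtain ⟨s, hs, hs'⟩ := (h.isMin P).2.1 P.src
    ((h.mem_partA P).2 ⟨P.src_mem, by rw [P.pos_src]; omega⟩) P.tgt
    ((h.mem_partB P).2 ⟨P.tgt_mem, by rw [P.pos_tgt]; omega⟩) P.walk P.maxDegTwo.1
  obtain ⟨i, rfl, hi⟩ := Walk.mem_support_iff_exists_getVert.1 hs'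
  exact ⟨i, hi, hs⟩

theorem cutIdx_lt_length_support (h : SmallSeparators N sep) (P : LongPath R L) [Finite W] :
    P.cutIdx sep < P.walk.support.length := by
  obtain ⟨i, -, hi'⟩ := h.exists_getVert_mem_sep P
  exact List.findIdx_lt_length_of_exists ⟨_, P.walk.getVert_mem_support i, by simpa using hi'⟩

theorem cut_mem_sep (h : SmallSeparators N sep) (P : LongPath R L) [Finite W] : P.cut sep ∈ sep P
    := by
  have h1 := h.cutIdx_lt_length_support P
  have h2 := List.findIdx_getElem (w := h1)
  have h3 := P.walk.support_getElem_eq_getVert h1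
  rw [LongPath.cut, ← h3]
  classical
  exact of_decide_eq_true h2

theorem cutIdx_le_length (h : SmallSeparators N sep) (P : LongPath R L) [Finite W] : P.cutIdx sep
    ≤ P.walk.length := by
  have h1 := h.cutIdx_lt_length_support P
  rw [Walk.length_support] at h1
  omega

theorem pos_cut (h : SmallSeparators N sep) (P : LongPath R L) [Finite W] : P.pos (P.cut sep) =
    P.cutIdx sep :=
  P.pos_getVert (h.cutIdx_le_length P)

theorem _root_.PDP.LongPath.cut_mem_verts (P : LongPath R L) : P.cut sep ∈ R.verts :=
    P.getVert_mem _

theorem le_cutIdx (h : SmallSeparators N sep) (P : LongPath R L) [Finite W] : 50 * N ≤ P.cutIdx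
    sep := by
  have := h.pos_of_mem_sep P (h.cut_mem_sep P) (P.cut_mem_verts)
  rw [h.pos_cut] at this
  omega

theorem cutIdx_lt (h : SmallSeparators N sep) (P : LongPath R L) [Finite W] : P.cutIdx sep < 100
    * N := by
  have := h.pos_of_mem_sep P (h.cut_mem_sep P) (P.cut_mem_verts)
  rw [h.pos_cut] at this
  omega

theorem _root_.PDP.LongPath.getVert_notMem_sep (P : LongPath R L) {i : ℕ} (hi : i < P.cutIdx sep) :
    P.walk.getVert i ∉ sep P := by
  classical
  have h1 := List.not_of_lt_findIdx hi
  rw [Walk.support_getElem_eq_getVert] at h1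
  simpa using h1

theorem pos_rev (h : SmallSeparators N sep) (P : LongPath R L) [Finite W] {x : W}
    (hx : x ∈ R.verts) :
    P.rev.pos x = P.walk.length - P.pos x := P.pos_rev h.tree h.one_le hx

theorem pos_rev_cut (h : SmallSeparators N sep) (P : LongPath R L) [Finite W] : P.pos
    (P.rev.cut sep) = P.walk.length - P.rev.cutIdx sep := by
  have h1 := h.pos_cut P.rev
  rw [h.pos_rev P (P.rev.cut_mem_verts)] at h1
  have h2 := P.pos_le (P.rev.cut sep)
  omega

/-- The initial part of the tree before the cut contains no separator vertex: the cut is the first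
one near the source, and the other separator meets the tree only near the target. -/
theorem mem_comp_of_pos_lt (h : SmallSeparators N sep) (P : LongPath R L) [Finite W] {z : W}
    (hz : z ∈ R.verts)
    (hzp : P.pos z < P.cutIdx sep) : z ∈ P.comp sep := by
  have h1 := h.le_length P
  have h2 := h.two_le
  have h3 := h.cutIdx_lt P
  rw [LongPath.mem_comp]
  refine (P.avoid_of_pos_le h.tree h.one_le (i := P.cutIdx sep - 1) hz
    (by omega) (by omega)).mono ?_
  rintro w (hw | hw) ⟨hwR, hwp⟩
  · have h4 := h.pos_of_mem_sep P hw hwR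
    have h5 := P.getVert_pos (z := w) (by omega) (by omega)
    rw [← h5] at hw
    exact P.getVert_notMem_sep (by omega) hw
  · have h4 := h.pos_of_mem_sep P.rev hw hwR
    rw [h.pos_rev P hwR] at h4
    omega

theorem src_mem_comp (h : SmallSeparators N sep) (P : LongPath R L) [Finite W] : P.src ∈ P.comp
    sep :=
  h.mem_comp_of_pos_lt P P.src_mem (by
    rw [P.pos_src]
    have := h.le_cutIdx P
    have := h.two_le
    omega)

theorem notMem_comp_of_le_pos (h : SmallSeparators N sep) (P : LongPath R L) [Finite W] {z : W}
    (hz : z ∈ R.verts) (hzp : 100 * N ≤ P.pos z) :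
    z ∉ P.comp sep := by
  intro h1
  rw [LongPath.mem_comp] at h1
  have := h.two_le
  exact h.not_avoid P P.src_mem (by rw [P.pos_src]; omega) hz hzp
    (h1.mono fun x hx => Or.inl hx)

theorem mem_rev_comp_of_lt_pos (h : SmallSeparators N sep) (P : LongPath R L) [Finite W] {z : W}
    (hz : z ∈ R.verts)
    (hzp : P.walk.length - P.rev.cutIdx sep < P.pos z) : z ∈ P.rev.comp sep := by
  refine h.mem_comp_of_pos_lt P.rev hz ?_
  rw [h.pos_rev P hz]
  have := P.pos_le z
  omega

theorem disjoint_comp (h : SmallSeparators N sep) (P : LongPath R L) [Finite W] : Disjoint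
    (P.comp sep) (P.rev.comp sep) := by
  rw [Set.disjoint_left]
  intro x hx hx'
  rw [LongPath.mem_comp] at hx hx'
  rw [LongPath.seps_rev] at hx'
  refine h.notMem_comp_of_le_pos P P.tgt_mem ?_ (LongPath.mem_comp.2 (hx.trans hx'.symm))
  rw [P.pos_tgt]
  have := h.le_length P
  omega

theorem pos_of_mem_midRegion (h : SmallSeparators N sep) (P : LongPath R L) [Finite W] {x : W}
    (hx : x ∈ P.midRegion sep) (hxR : x ∈ R.verts) :
    P.cutIdx sep ≤ P.pos x ∧ P.pos x ≤ P.walk.length - P.rev.cutIdx sep := by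
  rw [LongPath.mem_midRegion] at hx
  constructor
  · by_contra! hcon
    exact hx.1 (h.mem_comp_of_pos_lt P hxR hcon)
  · by_contra! hcon
    exact hx.2 (h.mem_rev_comp_of_lt_pos P hxR hcon)

theorem _root_.PDP.LongPath.seps_subset_midRegion (P : LongPath R L) : P.seps sep ⊆ P.midRegion
    sep := by
  intro s hs
  rw [LongPath.mem_midRegion, LongPath.mem_comp, LongPath.mem_comp]
  refine ⟨fun h => h.right hs, fun h => h.right ?_⟩
  rwa [LongPath.seps_rev]

/-! ### Separators are close to their path -/

/-- A path inside the connected separator visits at most `2 * N + 3` vertices. -/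
theorem exists_short_walk (h : SmallSeparators N sep) (P : LongPath R L) [Finite W] {s : W}
    (hs : s ∈ sep P) :
    ∃ q : H.Walk (P.cut sep) s, q.length ≤ 2 * N + 2 := by
  classical
  obtain ⟨p, hp⟩ := h.sep_connected P _ (h.cut_mem_sep P) _ hs
  refine ⟨p.bypass, ?_⟩
  have h1 : p.bypass.support.toFinset ⊆ sep P := fun x hx =>
    Finset.mem_coe.1 (not_not.1 (hp x (p.support_bypass_subset_support (List.mem_toFinset.1 hx))))
  have h2 := Finset.card_le_card h1
  rw [List.toFinset_card_of_nodup p.bypass_isPath.support_nodup, Walk.length_support] at h2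
  have := h.card_le P
  omega

theorem exists_walk_cut_cut (h : SmallSeparators N sep) (P : LongPath R L) [Finite W]
    {Q : LongPath R L} {s : W} (hs : s ∈ sep P)
    (hs' : s ∈ sep Q) : ∃ q : H.Walk (P.cut sep) (Q.cut sep), q.length ≤ 4 * N + 4 := by
  obtain ⟨q, hq⟩ := h.exists_short_walk P hs
  obtain ⟨r, hr⟩ := h.exists_short_walk Q hs'
  refine ⟨q.append r.reverse, ?_⟩
  rw [Walk.length_append, Walk.length_reverse]
  omega

/-- A common vertex would put the cuts at distance at most `4 * N + 4`, although each is within `100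
* N` of its end of a path of length at least `10000 * N`. -/
theorem notMem_sep_rev (h : SmallSeparators N sep) (P : LongPath R L) [Finite W] {s : W}
    (hs : s ∈ sep P) : s ∉ sep P.rev := by
  intro hs'
  obtain ⟨q, hq⟩ := h.exists_walk_cut_cut P hs hs'
  have h1 := P.pos_le_pos_add h.tree h.one_le h.noDetour (P.cut_mem_verts)
    (P.rev.cut_mem_verts) q
  rw [h.pos_cut, h.pos_rev_cut] at h1
  have h2 := h.cutIdx_lt P
  have h3 := h.cutIdx_lt P.rev
  have h4 := h.le_length P
  have h5 := h.two_le
  omega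

theorem pos_cut_of_ne (h : SmallSeparators N sep) (P : LongPath R L) [Finite W]
    {Q : LongPath R L} (h1 : Q ≠ P) (h2 : Q ≠ P.rev) :
    P.pos (Q.cut sep) = 0 ∨ P.pos (Q.cut sep) = P.walk.length := by
  have hL : 2 ≤ L := by
    have := h.two_le
    have := h.length_eq
    omega
  rcases LongPath.pos_getVert_of_ne h.tree hL h1 h2 with h3 | h3
  · exact Or.inl (h3 _ (h.cutIdx_le_length Q))
  · exact Or.inr (h3 _ (h.cutIdx_le_length Q))

/-- Seen from `P`, the cut of `Q` is at one of the ends, at least `50 * N` positions from the cut of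
`P`; a common vertex would bring them within `4 * N + 4`. -/
theorem notMem_sep_of_ne (h : SmallSeparators N sep) (P : LongPath R L) [Finite W]
    {Q : LongPath R L} (h1 : Q ≠ P) (h2 : Q ≠ P.rev) {s : W}
    (hs : s ∈ sep P) : s ∉ sep Q := by
  intro hs'
  obtain ⟨q, hq⟩ := h.exists_walk_cut_cut P hs hs'
  have h3 := P.pos_le_pos_add h.tree h.one_le h.noDetour (P.cut_mem_verts)
    (Q.cut_mem_verts) q
  have h4 := P.pos_le_pos_add h.tree h.one_le h.noDetour (Q.cut_mem_verts)
    (P.cut_mem_verts) q.reverse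
  rw [h.pos_cut] at h3 h4
  rw [Walk.length_reverse] at h4
  have h5 := h.cutIdx_lt P
  have h6 := h.le_cutIdx P
  have h7 := h.le_length P
  have h8 := h.two_le
  rcases h.pos_cut_of_ne P h1 h2 with h9 | h9 <;> omega

theorem _root_.PDP.LongPath.ne_rev_of_ne_rev {P Q : LongPath R L} (h : Q ≠ P.rev) :
    Q.rev ≠ P := fun h1 => h (by rw [← h1, LongPath.rev_rev])

theorem _root_.PDP.LongPath.rev_ne_rev {P Q : LongPath R L} (h : Q ≠ P) : Q.rev ≠ P.rev :=
  fun h1 => h (by rw [← LongPath.rev_rev Q, h1, LongPath.rev_rev])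

theorem disjoint_seps (h : SmallSeparators N sep) (P : LongPath R L) [Finite W]
    {Q : LongPath R L} (h1 : Q ≠ P) (h2 : Q ≠ P.rev) :
    Disjoint (P.seps sep) (Q.seps sep) := by
  rw [Set.disjoint_left]
  have h3 := LongPath.ne_rev_of_ne_rev h2
  have h4 := LongPath.rev_ne_rev h1
  rintro s (hs | hs) (hs' | hs')
  · exact h.notMem_sep_of_ne P h1 h2 hs hs'
  · exact h.notMem_sep_of_ne P h3 h4 hs hs'
  · exact h.notMem_sep_of_ne P.rev h2 (by rwa [LongPath.rev_rev]) hs hs'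
  · exact h.notMem_sep_of_ne P.rev h4 (by rwa [LongPath.rev_rev]) hs hs'

/-! ### Middle regions are connected -/

/-- The last vertex of the separator on the path. -/
theorem exists_last_mem_sep (h : SmallSeparators N sep) (P : LongPath R L) [Finite W] : ∃ i < 100
    * N, P.walk.getVert i ∈ sep P ∧
    ∀ r, i < r → r ≤ P.walk.length → P.walk.getVert r ∉ P.comp sep := by
  classical
  have hlen := h.le_length P
  obtain ⟨i₀, hi₀, hi₀'⟩ := h.exists_getVert_mem_sep P
  let i := Nat.findGreatest (fun i => P.walk.getVert i ∈ sep P) P.walk.length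
  have hi : P.walk.getVert i ∈ sep P :=
    Nat.findGreatest_spec (P := fun i => P.walk.getVert i ∈ sep P) hi₀ hi₀'
  have hile : i ≤ P.walk.length := Nat.findGreatest_le _
  have hi1 := h.pos_of_mem_sep P hi (P.getVert_mem i)
  rw [P.pos_getVert hile] at hi1
  refine ⟨i, hi1.2, hi, fun r hr hr' hcomp => ?_⟩
  rcases le_total (100 * N) r with h1 | h1
  · exact h.notMem_comp_of_le_pos P (P.getVert_mem r) (by rw [P.pos_getVert hr']; exact h1) hcomp
  · rw [LongPath.mem_comp] at hcomp
    -- After the last separator vertex, `P` runs on to position `100 * N` without meeting the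
    -- separator, so a vertex of the component there would connect the source to `partB`.
    have h2 : Avoid H (sep P : Set W) P.src (P.walk.getVert r) := hcomp.mono fun x hx => Or.inl hx
    have h3 : Avoid H (sep P : Set W) (P.walk.getVert r) (P.walk.getVert (100 * N)) :=
      .of_getVert P.walk h1 (by omega) fun t ht ht' hmem =>
        Nat.findGreatest_is_greatest (P := fun i => P.walk.getVert i ∈ sep P) (n := P.walk.length)
          (lt_of_lt_of_le hr ht) (by omega) hmem
    have h4 := h.two_le
    exact h.not_avoid P P.src_mem (by rw [P.pos_src]; omega) (P.getVert_mem _)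
      (by rw [P.pos_getVert (by omega)]) (h2.trans h3)

theorem avoid_cut_of_mem_sep (h : SmallSeparators N sep) (P : LongPath R L) [Finite W] {s : W}
    (hs : s ∈ sep P) :
    Avoid H (P.midRegion sep)ᶜ (P.cut sep) s :=
  (h.sep_connected P _ (h.cut_mem_sep P) _ hs).mono
    (Set.compl_subset_compl.2 fun _ hx => P.seps_subset_midRegion (Or.inl hx))

/-- Inside the connected separator from the cut to the last separator vertex on `P`, along `P` to
its counterpart at the other end, and inside the other separator. -/
theorem avoid_cut_rev_cut (h : SmallSeparators N sep) (P : LongPath R L) [Finite W] :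
    Avoid H (P.midRegion sep)ᶜ (P.cut sep) (P.rev.cut sep) := by
  obtain ⟨i, hi, his, hi'⟩ := h.exists_last_mem_sep P
  obtain ⟨j, hj, hjs, hj'⟩ := h.exists_last_mem_sep P.rev
  have hlen := h.le_length P
  have h2 := h.two_le
  have h3 := h.avoid_cut_of_mem_sep P his
  have h4 := h.avoid_cut_of_mem_sep P.rev hjs
  rw [LongPath.midRegion_rev, LongPath.getVert_rev] at h4
  refine h3.trans (Avoid.trans ?_ h4.symm)
  refine .of_getVert P.walk (by omega) (by omega) fun r hr hr' => not_not.2 ?_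
  rcases hr.eq_or_lt with rfl | hr1
  · exact P.seps_subset_midRegion (Or.inl his)
  rcases hr'.eq_or_lt with rfl | hr2
  · rw [← LongPath.getVert_rev]
    exact P.seps_subset_midRegion (Or.inr hjs)
  rw [LongPath.mem_midRegion]
  refine ⟨hi' r hr1 (by omega), ?_⟩
  have := hj' (P.walk.length - r) (by omega) (by rw [LongPath.length_rev]; omega)
  rwa [LongPath.getVert_rev, Nat.sub_sub_self (by omega)] at this

theorem avoid_cut_of_mem_seps (h : SmallSeparators N sep) (P : LongPath R L) [Finite W] {s : W}
    (hs : s ∈ P.seps sep) :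
    Avoid H (P.midRegion sep)ᶜ (P.cut sep) s := by
  rcases hs with hs | hs
  · exact h.avoid_cut_of_mem_sep P hs
  · have := h.avoid_cut_of_mem_sep P.rev hs
    rw [LongPath.midRegion_rev] at this
    exact (h.avoid_cut_rev_cut P).trans this

theorem avoid_cut (h : SmallSeparators N sep) (P : LongPath R L) [Finite W] {x : W}
    (hx : x ∈ P.midRegion sep) :
    Avoid H (P.midRegion sep)ᶜ (P.cut sep) x := by
  -- A vertex of the region that is in neither separator has no neighbour in the two outer
  -- components, so a walk to the source meets a separator before leaving the region.
  have key : ∀ x y (p : H.Walk x y), y = P.src → x ∈ P.midRegion sep →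
      ∃ s ∈ P.seps sep, Avoid H (P.midRegion sep)ᶜ x s := by
    intro x y p
    induction p with
    | nil =>
      rintro rfl hx
      exact absurd (h.src_mem_comp P) (LongPath.mem_midRegion.1 hx).1
    | @cons x y z hxy q ih =>
      intro hz hx
      by_cases hxs : x ∈ P.seps sep
      · exact ⟨x, hxs, .refl (not_not.2 hx)⟩
      by_cases hy : y ∈ P.midRegion sep
      · obtain ⟨s, hs, hs'⟩ := ih hz hy
        exact ⟨s, hs, (Avoid.of_adj hxy (not_not.2 hx) (not_not.2 hy)).trans hs'⟩
      · rw [LongPath.mem_midRegion] at hx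
        rw [LongPath.mem_midRegion, not_and_or, not_not, not_not] at hy
        rcases hy with hy | hy
        · exact absurd (LongPath.mem_comp_of_adj hy hxy.symm hxs) hx.1
        · exact absurd (LongPath.mem_comp_of_adj hy hxy.symm
            (by rwa [LongPath.seps_rev])) hx.2
  obtain ⟨p⟩ := h.connected.preconnected x P.src
  obtain ⟨s, hs, hs'⟩ := key x _ p rfl hx
  exact (h.avoid_cut_of_mem_seps P hs).trans hs'.symm

/-! ### Middle regions are disjoint -/

theorem cut_mem_comp_or (h : SmallSeparators N sep) (P : LongPath R L) [Finite W]
    {Q : LongPath R L} (h1 : Q ≠ P) (h2 : Q ≠ P.rev) :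
    Q.cut sep ∈ P.comp sep ∨ Q.cut sep ∈ P.rev.comp sep := by
  have h3 := h.two_le
  have h4 := h.le_cutIdx P
  have h5 := h.le_cutIdx P.rev
  have h6 := h.le_length P
  rcases h.pos_cut_of_ne P h1 h2 with h7 | h7
  · exact Or.inl (h.mem_comp_of_pos_lt P (Q.cut_mem_verts) (by omega))
  · exact Or.inr (h.mem_rev_comp_of_lt_pos P (Q.cut_mem_verts) (by omega))

/-- The separator of `Q` is connected and disjoint from those of `P`, so it stays in the component
of its cut, which is an outer component of `P`. -/
theorem notMem_midRegion_of_mem_sep (h : SmallSeparators N sep) (P : LongPath R L) [Finite W]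
    {Q : LongPath R L} (h1 : Q ≠ P) (h2 : Q ≠ P.rev)
    {s : W} (hs : s ∈ sep Q) : s ∉ P.midRegion sep := by
  have h3 : Avoid H (P.seps sep) (Q.cut sep) s :=
    (h.sep_connected Q _ (h.cut_mem_sep Q) _ hs).mono fun x hx hx' =>
      Set.disjoint_left.1 (h.disjoint_seps P h1 h2) hx (Or.inl hx')
  rw [LongPath.mem_midRegion]
  rintro ⟨h4, h5⟩
  rcases h.cut_mem_comp_or P h1 h2 with h6 | h6
  · rw [LongPath.mem_comp] at h4 h6
    exact h4 (h6.trans h3)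
  · rw [LongPath.mem_comp, LongPath.seps_rev] at h5 h6
    exact h5 (h6.trans h3)

/-- The region is connected, misses the separators of `Q`, and contains the cut of `P`, which lies
in an outer component of `Q`. -/
theorem midRegion_subset_comp (h : SmallSeparators N sep) (P : LongPath R L) [Finite W]
    {Q : LongPath R L} (h1 : Q ≠ P) (h2 : Q ≠ P.rev) :
    P.midRegion sep ⊆ Q.comp sep ∨ P.midRegion sep ⊆ Q.rev.comp sep := by
  have h3 : Q.seps sep ⊆ (P.midRegion sep)ᶜ := by
    rintro s (hs | hs)
    · exact h.notMem_midRegion_of_mem_sep P h1 h2 hs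
    · exact h.notMem_midRegion_of_mem_sep P (LongPath.ne_rev_of_ne_rev h2)
        (LongPath.rev_ne_rev h1) hs
  rcases h.cut_mem_comp_or Q h1.symm (LongPath.ne_rev_of_ne_rev h2).symm with h4 | h4
  · left
    intro x hx
    rw [LongPath.mem_comp] at h4 ⊢
    exact h4.trans ((h.avoid_cut P hx).mono h3)
  · right
    intro x hx
    rw [LongPath.mem_comp, LongPath.seps_rev] at h4 ⊢
    exact h4.trans ((h.avoid_cut P hx).mono h3)

theorem disjoint_midRegion (h : SmallSeparators N sep) (P : LongPath R L) [Finite W]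
    {Q : LongPath R L} (h1 : Q ≠ P) (h2 : Q ≠ P.rev) :
    Disjoint (P.midRegion sep) (Q.midRegion sep) := by
  rw [Set.disjoint_left]
  intro x hx hx'
  rw [LongPath.mem_midRegion] at hx'
  rcases h.midRegion_subset_comp P h1 h2 with h3 | h3
  · exact hx'.1 (h3 hx)
  · exact hx'.2 (h3 hx)

/-- The component around the source does not change if only the separator of the source is
deleted. -/
theorem mem_comp_of_avoid_sep (h : SmallSeparators N sep) (P : LongPath R L) [Finite W] {x : W}
    (hx : Avoid H (sep P : Set W) P.src x) :
    x ∈ P.comp sep := by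
  rw [LongPath.mem_comp]
  refine hx.mem_of_disjoint ?_
  rintro y hy (hy' | hy')
  · exact hy.right hy'
  -- The other separator is connected and disjoint from this one, so reaching it means reaching its
  -- cut, which lies in `partB`.
  · have h1 : Avoid H (sep P : Set W) (P.rev.cut sep) y :=
      (h.sep_connected P.rev _ (h.cut_mem_sep P.rev) _ hy').mono fun z hz hz' =>
        h.notMem_sep_rev P hz hz'
    have h2 := h.two_le
    have h3 := h.le_length P
    have h4 := h.cutIdx_lt P.rev
    exact h.not_avoid P P.src_mem (by rw [P.pos_src]; omega) (P.rev.cut_mem_verts)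
      (by rw [h.pos_rev_cut]; omega) (hy.trans h1.symm)

end SmallSeparators

end Regions

end PDP

/-! ### The rerouted graph and its connectedness. -/

namespace PDP

open SimpleGraph

section Reroute

variable {W : Type*} {H : SimpleGraph W} {R : H.Subgraph} {L N : ℕ}
  {sep : LongPath R L → Finset W} {star : LongPath R L → H.Subgraph}

/-- The subgraph obtained from `R` by replacing the middle part of every long path `P` by
`star P`. -/
def reroute (sep : LongPath R L → Finset W) (star : LongPath R L → H.Subgraph) : H.Subgraph :=
  (R.deleteVerts (⋃ P, LongPath.midInternal sep P)).deleteEdges (⋃ P, LongPath.midEdges sep P) ⊔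
    ⨆ P, star P

/-- The position on `P` of the first vertex of the separator around the target, seen from the
target. -/
noncomputable def LongPath.endIdx (sep : LongPath R L → Finset W) (P : LongPath R L) : ℕ :=
  P.walk.length - P.rev.cutIdx sep

/-- Small separators together with a path through the middle region of every long path. -/
structure ReroutingPaths (N : ℕ) (sep : LongPath R L → Finset W)
    (star : LongPath R L → H.Subgraph) : Prop extends SmallSeparators N sep where
  star_rev : ∀ P, star P.rev = star P
  star_spec : ∀ P, ∃ p : H.Walk (P.cut sep) (P.rev.cut sep),
    p.IsPath ∧ star P = p.toSubgraph ∧ ∀ x ∈ p.support, x ∈ P.midRegion sep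

namespace SmallSeparators

theorem bounds [Finite W] (h : SmallSeparators N sep) (P : LongPath R L) :
    2 ≤ N ∧ 50 * N ≤ P.cutIdx sep ∧ P.cutIdx sep < 100 * N ∧ 10000 * N ≤ P.walk.length ∧
      P.endIdx sep + 50 * N ≤ P.walk.length ∧ P.walk.length < P.endIdx sep + 100 * N ∧
      P.endIdx sep + P.rev.cutIdx sep = P.walk.length := by
  have h1 := h.cutIdx_lt P.rev
  have h2 := h.le_cutIdx P.rev
  have h3 := h.le_length P
  have h4 := h.two_le
  exact ⟨h4, h.le_cutIdx P, h.cutIdx_lt P, h3, by unfold LongPath.endIdx; omega,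
    by unfold LongPath.endIdx; omega, by unfold LongPath.endIdx; omega⟩

theorem pos_rev_cut' [Finite W] (h : SmallSeparators N sep) (P : LongPath R L) :
    P.pos (P.rev.cut sep) = P.endIdx sep := h.pos_rev_cut P

theorem getVert_endIdx [Finite W] (h : SmallSeparators N sep) (P : LongPath R L) :
    P.walk.getVert (P.endIdx sep) = P.rev.cut sep := by
  rw [← h.pos_rev_cut' P, P.getVert_pos] <;> rw [h.pos_rev_cut'] <;> have := h.bounds P <;> omega

theorem mid_getVert [Finite W] (h : SmallSeparators N sep) (P : LongPath R L) (i : ℕ) :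
    (P.midPath sep).getVert i = P.walk.getVert (min (P.cutIdx sep + i) (P.endIdx sep)) := by
  have := h.bounds P
  rw [LongPath.midPath, Walk.take_getVert, Walk.drop_getVert]
  congr 1
  omega

theorem mid_length [Finite W] (h : SmallSeparators N sep) (P : LongPath R L) :
    (P.midPath sep).length = P.endIdx sep - P.cutIdx sep := by
  have := h.bounds P
  rw [LongPath.midPath, Walk.take_length, Walk.drop_length]
  omega

theorem mem_midInternal [Finite W] (h : SmallSeparators N sep) (P : LongPath R L) {x : W} :
    x ∈ P.midInternal sep ↔ P.cutIdx sep < P.pos x ∧ P.pos x < P.endIdx sep := by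
  have hb := h.bounds P
  have hc := h.pos_cut P
  have he := h.pos_rev_cut' P
  constructor
  · rintro ⟨h1, h2, h3⟩
    obtain ⟨i, rfl, hi⟩ := Walk.mem_support_iff_exists_getVert.1 h1
    rw [h.mid_length] at hi
    rw [h.mid_getVert] at h2 h3 ⊢
    rw [P.pos_getVert (by omega)]
    have h4 : i ≠ 0 := by
      rintro rfl
      refine h2 ?_
      rw [Nat.add_zero, min_eq_left (by omega)]
      rfl
    have h5 : P.cutIdx sep + i ≠ P.endIdx sep := by
      intro h5
      refine h3 ?_
      rw [h5, min_self, h.getVert_endIdx]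
    omega
  · rintro ⟨h1, h2⟩
    refine ⟨Walk.mem_support_iff_exists_getVert.2 ⟨P.pos x - P.cutIdx sep, ?_, ?_⟩, ?_, ?_⟩
    · rw [h.mid_getVert, min_eq_left (by omega), Nat.add_sub_cancel' h1.le,
        P.getVert_pos (by omega) (by omega)]
    · rw [h.mid_length]
      omega
    · rintro rfl
      omega
    · rintro rfl
      omega

theorem mem_midEdges [Finite W] (h : SmallSeparators N sep) (P : LongPath R L) {x y : W}
    (hxy : R.Adj x y) :
    s(x, y) ∈ P.midEdges sep ↔ (P.cutIdx sep ≤ P.pos x ∧ P.pos x ≤ P.endIdx sep) ∧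
      P.cutIdx sep ≤ P.pos y ∧ P.pos y ≤ P.endIdx sep := by
  have hb := h.bounds P
  have key : s(x, y) ∈ P.midEdges sep ↔ ∃ i < P.endIdx sep - P.cutIdx sep,
      s(P.walk.getVert (P.cutIdx sep + i), P.walk.getVert (P.cutIdx sep + i + 1)) = s(x, y) := by
    rw [LongPath.midEdges, Set.mem_ofPred_eq, ← Walk.mem_edges_toSubgraph, Subgraph.mem_edgeSet,
      Walk.toSubgraph_adj_iff, h.mid_length]
    have h3 : ∀ i < P.endIdx sep - P.cutIdx sep, (P.midPath sep).getVert i =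
        P.walk.getVert (P.cutIdx sep + i) ∧ (P.midPath sep).getVert (i + 1) =
        P.walk.getVert (P.cutIdx sep + i + 1) := fun i hi => by
      rw [h.mid_getVert, h.mid_getVert, ← add_assoc, min_eq_left (by omega),
        min_eq_left (by omega)]
      exact ⟨rfl, rfl⟩
    refine ⟨fun ⟨i, h1, h2⟩ => ⟨i, h2, ?_⟩, fun ⟨i, h1, h2⟩ => ⟨i, ?_, h1⟩⟩
    · rwa [(h3 i h2).1, (h3 i h2).2] at h1
    · rwa [(h3 i h1).1, (h3 i h1).2]
  rw [key]
  constructor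
  · rintro ⟨i, hi, hi'⟩
    replace hi : P.cutIdx sep + i < P.endIdx sep := by
      rw [add_comm]
      exact Nat.add_lt_of_lt_sub hi
    have h1 : P.pos (P.walk.getVert (P.cutIdx sep + i)) = P.cutIdx sep + i :=
      P.pos_getVert (by omega)
    have h2 : P.pos (P.walk.getVert (P.cutIdx sep + i + 1)) = P.cutIdx sep + i + 1 :=
      P.pos_getVert (by omega)
    rcases Sym2.eq_iff.1 hi' with ⟨rfl, rfl⟩ | ⟨rfl, rfl⟩ <;> omega
  · rintro ⟨h1, h2⟩
    rcases P.pos_of_adj h.tree h.one_le hxy with h3 | ⟨h3, h4, h5⟩ | ⟨h3, h4, h5⟩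
    · omega
    · refine ⟨P.pos x - P.cutIdx sep, by omega, ?_⟩
      rw [Nat.add_sub_cancel' h1.1, ← h3, h4, h5]
    · refine ⟨P.pos y - P.cutIdx sep, by omega, ?_⟩
      rw [Nat.add_sub_cancel' h2.1, ← h3, h4, h5, Sym2.eq_swap]

/-- Two long paths with a common internal vertex are equal up to their direction. -/
theorem eq_or_eq_rev [Finite W] (h : SmallSeparators N sep) {P Q : LongPath R L} {x : W}
    (h1 : 0 < P.pos x) (h2 : P.pos x < P.walk.length) (h3 : 0 < Q.pos x)
    (h4 : Q.pos x < Q.walk.length) : Q = P ∨ Q = P.rev := by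
  by_contra! hcon
  have hL : 2 ≤ L := by
    have := h.two_le
    have := h.length_eq
    omega
  have h5 := Q.getVert_pos h3 h4
  rcases LongPath.pos_getVert_of_ne h.tree hL hcon.1 hcon.2 with h6 | h6
  · have := h6 _ h4.le
    rw [h5] at this
    omega
  · have := h6 _ h4.le
    rw [h5] at this
    omega

theorem _root_.PDP.LongPath.pos_src_of [Finite W] (P Q : LongPath R L) :
    P.pos Q.src = 0 ∨ P.pos Q.src = P.walk.length := by
  have h1 := Q.maxDegTwo.deg_start
  by_contra! hcon
  have h2 := P.getVert_pos (Nat.pos_of_ne_zero hcon.1) (lt_of_le_of_ne (P.pos_le _) hcon.2)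
  have h3 := P.maxDegTwo.deg_getVert (Nat.pos_of_ne_zero hcon.1)
    (lt_of_le_of_ne (P.pos_le _) hcon.2)
  rw [h2] at h3
  exact h1 h3

/-- An edge of the tree with an end on the middle part of a long path, but not both, is kept. -/
theorem notMem_midEdges [Finite W] (h : SmallSeparators N sep) (P : LongPath R L) {x y : W}
    (hxy : R.Adj x y) (hx : P.cutIdx sep ≤ P.pos x ∧ P.pos x ≤ P.endIdx sep)
    (hy : ¬ (P.cutIdx sep ≤ P.pos y ∧ P.pos y ≤ P.endIdx sep)) (Q : LongPath R L) :
    s(x, y) ∉ Q.midEdges sep := by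
  intro hQ
  have hQ' := (h.mem_midEdges Q hxy).1 hQ
  have h1 := h.bounds P
  have h2 := h.bounds Q
  rcases h.eq_or_eq_rev (P := P) (Q := Q) (x := x) (by omega) (by omega) (by omega) (by omega)
    with rfl | rfl
  · exact hy hQ'.2
  · have h3 := h.bounds P.rev
    have h4 := h.pos_rev P hxy.snd_mem
    have h5 := P.pos_le y
    rw [LongPath.rev_rev, LongPath.length_rev] at h3
    omega

/-- Every tree edge at an internal vertex of the middle part is itself a middle edge. Hence deleting
these vertices removes no edges beyond the middle ones, and adjacency is described by `reroute_adj`.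
-/
theorem notMem_midInternal_of_adj [Finite W] (h : SmallSeparators N sep) (P : LongPath R L)
    {x y : W} (hxy : R.Adj x y) (hP : s(x, y) ∉ P.midEdges sep) : x ∉ P.midInternal sep := by
  rw [h.mem_midInternal]
  intro hx
  rw [h.mem_midEdges P hxy] at hP
  have := h.bounds P
  rcases P.pos_of_adj h.tree h.one_le hxy with h3 | h3 | h3 <;> omega

theorem reroute_adj [Finite W] (h : SmallSeparators N sep) {x y : W} :
    (reroute sep star).Adj x y ↔
      (R.Adj x y ∧ ∀ P : LongPath R L, s(x, y) ∉ P.midEdges sep) ∨ ∃ P, (star P).Adj x y := by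
  rw [reroute, Subgraph.sup_adj, Subgraph.iSup_adj, Subgraph.deleteEdges_adj,
    Subgraph.deleteVerts_adj]
  simp only [Set.mem_iUnion, not_exists]
  refine or_congr_left ⟨fun h1 => ⟨h1.1.2.2.2.2, h1.2⟩, fun ⟨h1, h2⟩ => ⟨⟨h1.fst_mem, ?_,
    h1.snd_mem, ?_, h1⟩, h2⟩⟩
  · exact fun P => h.notMem_midInternal_of_adj P h1 (h2 P)
  · exact fun P => h.notMem_midInternal_of_adj P h1.symm (by rw [Sym2.eq_swap]; exact h2 P)

theorem mem_reroute_verts {x : W} : x ∈ (reroute sep star).verts ↔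
    (x ∈ R.verts ∧ ∀ P : LongPath R L, x ∉ P.midInternal sep) ∨ ∃ P, x ∈ (star P).verts := by
  rw [reroute, Subgraph.verts_sup, Subgraph.verts_iSup, Subgraph.deleteEdges_verts,
    Subgraph.deleteVerts_verts]
  simp only [Set.mem_union, Set.mem_sdiff, Set.mem_iUnion, not_exists]

/-- A kept edge lies on one side of the middle part of a long path. -/
theorem pos_of_kept [Finite W] (h : SmallSeparators N sep) (P : LongPath R L) {x y : W}
    (hxy : R.Adj x y) (hP : s(x, y) ∉ P.midEdges sep) :
    (P.pos x < P.cutIdx sep ∧ P.pos y < P.cutIdx sep) ∨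
    (P.endIdx sep < P.pos x ∧ P.endIdx sep < P.pos y) ∨
    (x = P.cut sep ∧ y = P.walk.getVert (P.cutIdx sep - 1)) ∨
    (y = P.cut sep ∧ x = P.walk.getVert (P.cutIdx sep - 1)) ∨
    (x = P.rev.cut sep ∧ y = P.walk.getVert (P.endIdx sep + 1)) ∨
    (y = P.rev.cut sep ∧ x = P.walk.getVert (P.endIdx sep + 1)) := by
  rw [h.mem_midEdges P hxy] at hP
  have hb := h.bounds P
  rcases P.pos_of_adj h.tree h.one_le hxy with h3 | ⟨h3, h4, h5⟩ | ⟨h3, h4, h5⟩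
  · omega
  · by_cases h6 : P.pos y = P.cutIdx sep
    · refine Or.inr (Or.inr (Or.inr (Or.inl ⟨?_, ?_⟩)))
      · rw [← h5, h6]; rfl
      · rw [← h4]; congr 1; omega
    by_cases h7 : P.pos x = P.endIdx sep
    · refine Or.inr (Or.inr (Or.inr (Or.inr (Or.inl ⟨?_, ?_⟩))))
      · rw [← h4, h7, h.getVert_endIdx]
      · rw [← h5]; congr 1; omega
    omega
  · by_cases h6 : P.pos x = P.cutIdx sep
    · refine Or.inr (Or.inr (Or.inl ⟨?_, ?_⟩))
      · rw [← h4, h6]; rfl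
      · rw [← h5]; congr 1; omega
    by_cases h7 : P.pos y = P.endIdx sep
    · refine Or.inr (Or.inr (Or.inr (Or.inr (Or.inr ⟨?_, ?_⟩))))
      · rw [← h5, h7, h.getVert_endIdx]
      · rw [← h4]; congr 1; omega
    omega

end SmallSeparators

namespace ReroutingPaths

theorem star_subset (h : ReroutingPaths N sep star) (P : LongPath R L) :
    (star P).verts ⊆ P.midRegion sep := by
  obtain ⟨p, -, hp, hp'⟩ := h.star_spec P
  intro x hx
  rw [hp, Walk.mem_verts_toSubgraph] at hx
  exact hp' x hx

theorem cut_mem_star (h : ReroutingPaths N sep star) (P : LongPath R L) :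
    P.cut sep ∈ (star P).verts := by
  obtain ⟨p, -, hp, -⟩ := h.star_spec P
  rw [hp]
  exact p.start_mem_verts_toSubgraph

theorem rev_cut_mem_star (h : ReroutingPaths N sep star) (P : LongPath R L) :
    P.rev.cut sep ∈ (star P).verts := by
  rw [← h.star_rev]
  exact h.cut_mem_star P.rev

theorem pos_of_mem_star [Finite W] (h : ReroutingPaths N sep star) {P : LongPath R L} {x : W}
    (hx : x ∈ (star P).verts) (hxR : x ∈ R.verts) :
    P.cutIdx sep ≤ P.pos x ∧ P.pos x ≤ P.endIdx sep :=
  h.pos_of_mem_midRegion P (h.star_subset P hx) hxR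

/-- The rerouting paths of different long paths are disjoint. -/
theorem eq_or_eq_rev_of_mem_star [Finite W] (h : ReroutingPaths N sep star) {P Q : LongPath R L}
    {x : W} (hP : x ∈ (star P).verts) (hQ : x ∈ (star Q).verts) : Q = P ∨ Q = P.rev := by
  by_contra! hcon
  exact Set.disjoint_left.1 (h.disjoint_midRegion P hcon.1 hcon.2) (h.star_subset P hP)
    (h.star_subset Q hQ)

theorem star_eq [Finite W] (h : ReroutingPaths N sep star) {P Q : LongPath R L}
    {x : W} (hP : x ∈ (star P).verts) (hQ : x ∈ (star Q).verts) : star Q = star P := by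
  rcases h.eq_or_eq_rev_of_mem_star hP hQ with rfl | rfl
  · rfl
  · exact h.star_rev P

/-- A tree vertex on the new path has its position between the cuts, so a kept edge there can only
be one of the two that attach the cuts to the ends of `P`. -/
theorem kept_of_mem_star [Finite W] (h : ReroutingPaths N sep star) {P : LongPath R L} {x y : W}
    (hx : x ∈ (star P).verts) (hxy : R.Adj x y) (hP : s(x, y) ∉ P.midEdges sep) :
    (x = P.cut sep ∧ y = P.walk.getVert (P.cutIdx sep - 1)) ∨
      (x = P.rev.cut sep ∧ y = P.walk.getVert (P.endIdx sep + 1)) := by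
  have h1 := h.pos_of_mem_star hx hxy.fst_mem
  have hb := h.bounds P
  rcases h.pos_of_kept P hxy hP with h2 | h2 | h2 | h2 | h2 | h2
  · omega
  · omega
  · exact Or.inl h2
  · rw [h2.2, P.pos_getVert (by omega)] at h1
    omega
  · exact Or.inr h2
  · rw [h2.2, P.pos_getVert (by omega)] at h1
    omega

/-- The only way to leave the component around the source is through the start of the
rerouting path. -/
theorem mem_comp_of_adj [Finite W] (h : ReroutingPaths N sep star) (P : LongPath R L) {x y : W}
    (hx : x ∈ P.comp sep) (hxy : (reroute sep star).Adj x y) :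
    y ∈ P.comp sep ∨ (x = P.walk.getVert (P.cutIdx sep - 1) ∧ y = P.cut sep) := by
  have hb := h.bounds P
  rcases h.reroute_adj.1 hxy with ⟨h1, h2⟩ | ⟨Q, hQ⟩
  · have h3 : P.pos x < 100 * N := by
      by_contra! h3
      exact h.notMem_comp_of_le_pos P h1.fst_mem h3 hx
    have h4 : x ∉ P.midRegion sep := fun h4 => (LongPath.mem_midRegion.1 h4).1 hx
    rcases h.pos_of_kept P h1 (h2 P) with h5 | h5 | h5 | h5 | h5 | h5
    · exact Or.inl (h.mem_comp_of_pos_lt P h1.snd_mem h5.2)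
    · omega
    · exact absurd (h.star_subset P (h5.1 ▸ h.cut_mem_star P)) h4
    · exact Or.inr h5.symm
    · exact absurd (h.star_subset P (h5.1 ▸ h.rev_cut_mem_star P)) h4
    · rw [h5.2, P.pos_getVert (by omega)] at h3
      omega
  · have hxQ := h.star_subset Q hQ.fst_mem
    have hyQ := h.star_subset Q hQ.snd_mem
    by_cases hne : P ≠ Q ∧ P ≠ Q.rev
    · rcases h.midRegion_subset_comp Q hne.1 hne.2 with h3 | h3
      · exact Or.inl (h3 hyQ)
      · exact absurd (h3 hxQ) (Set.disjoint_left.1 (h.disjoint_comp P) hx)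
    · have : Q.midRegion sep = P.midRegion sep := by
        rw [not_and_or, not_not, not_not] at hne
        rcases hne with rfl | rfl
        · rfl
        · exact (LongPath.midRegion_rev sep Q).symm
      rw [this] at hxQ
      exact absurd hx (LongPath.mem_midRegion.1 hxQ).1

/-! ### The rerouted graph is a tree -/

theorem reachable_of_mem_star [Finite W] (h : ReroutingPaths N sep star) {P : LongPath R L}
    {a x : W} (ha : Relation.ReflTransGen (reroute sep star).Adj a (P.cut sep))
    (hx : x ∈ (star P).verts) : Relation.ReflTransGen (reroute sep star).Adj a x := by
  obtain ⟨p, -, hp, -⟩ := h.star_spec P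
  rw [hp, Walk.mem_verts_toSubgraph, Walk.mem_support_iff_exists_getVert] at hx
  obtain ⟨i, rfl, hi⟩ := hx
  refine ha.trans ?_
  induction i with
  | zero =>
    rw [Walk.getVert_zero]
  | succ i ih =>
    refine (ih (by omega)).tail (h.reroute_adj.2 (Or.inr ⟨P, ?_⟩))
    rw [hp]
    exact p.toSubgraph_adj_getVert (by omega)

/-- An endpoint of a long path does not have degree two, so it is internal to no long path; if there
is no long path, any vertex will do. -/
theorem exists_notMem_mid [Finite W] (h : ReroutingPaths N sep star) : ∃ a ∈ R.verts,
    ∀ P : LongPath R L, ¬ (P.cutIdx sep ≤ P.pos a ∧ P.pos a ≤ P.endIdx sep) := by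
  obtain ⟨⟨r, hr⟩⟩ := h.tree.connected.nonempty
  by_cases h1 : ∀ P : LongPath R L, ¬ (P.cutIdx sep ≤ P.pos r ∧ P.pos r ≤ P.endIdx sep)
  · exact ⟨r, hr, h1⟩
  · push Not at h1
    obtain ⟨P, -⟩ := h1
    refine ⟨P.src, P.src_mem, fun Q => ?_⟩
    have h2 := h.bounds Q
    rcases Q.pos_src_of P with h3 | h3 <;> omega

theorem reachable [Finite W] (h : ReroutingPaths N sep star) {a : W}
    (haR : a ∈ R.verts)
    (ha : ∀ P : LongPath R L, ¬ (P.cutIdx sep ≤ P.pos a ∧ P.pos a ≤ P.endIdx sep)) {x : W}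
    (hx : x ∈ (reroute sep star).verts) : Relation.ReflTransGen (reroute sep star).Adj a x := by
  -- Induction along a walk of the old tree. While it runs through a middle part, the invariant
  -- records that both cuts are reachable in the new graph, so the walk can resume at either end.
  have key : ∀ z, Relation.ReflTransGen R.Adj a z →
      ((∀ P : LongPath R L, z ∉ P.midInternal sep) →
        Relation.ReflTransGen (reroute sep star).Adj a z) ∧
      ∀ P : LongPath R L, P.cutIdx sep ≤ P.pos z ∧ P.pos z ≤ P.endIdx sep →
        Relation.ReflTransGen (reroute sep star).Adj a (P.cut sep) ∧
        Relation.ReflTransGen (reroute sep star).Adj a (P.rev.cut sep) := by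
    intro z hz
    induction hz with
    | refl => exact ⟨fun _ => .refl, fun P hP => absurd hP (ha P)⟩
    | @tail z w _ hzw ih =>
      have hkept : (∀ Q : LongPath R L, s(z, w) ∉ Q.midEdges sep) →
          Relation.ReflTransGen (reroute sep star).Adj a w := fun h1 =>
        (ih.1 fun P => h.notMem_midInternal_of_adj P hzw (h1 P)).tail
          (h.reroute_adj.2 (Or.inl ⟨hzw, h1⟩))
      refine ⟨fun hw => ?_, fun P hP => ?_⟩
      · by_cases h1 : ∀ Q : LongPath R L, s(z, w) ∉ Q.midEdges sep
        · exact hkept h1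
        · push Not at h1
          obtain ⟨Q, hQ⟩ := h1
          have hQ' := (h.mem_midEdges Q hzw).1 hQ
          have hwQ := hw Q
          rw [h.mem_midInternal] at hwQ
          have hb := h.bounds Q
          have h2 := Q.getVert_pos (z := w) (by omega) (by omega)
          by_cases h3 : Q.pos w = Q.cutIdx sep
          · rw [← h2, h3]
            exact (ih.2 Q hQ'.1).1
          · rw [← h2, show Q.pos w = Q.endIdx sep by omega, h.getVert_endIdx]
            exact (ih.2 Q hQ'.1).2
      · by_cases h1 : P.cutIdx sep ≤ P.pos z ∧ P.pos z ≤ P.endIdx sep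
        · exact ih.2 P h1
        have h2 : ∀ Q : LongPath R L, s(z, w) ∉ Q.midEdges sep := fun Q => by
          rw [Sym2.eq_swap]
          exact h.notMem_midEdges P hzw.symm hP h1 Q
        have h3 := hkept h2
        have hb := h.bounds P
        have key' : Relation.ReflTransGen (reroute sep star).Adj a (P.cut sep) →
          Relation.ReflTransGen (reroute sep star).Adj a (P.rev.cut sep) := fun h4 =>
            h.reachable_of_mem_star h4 (h.rev_cut_mem_star P)
        rcases h.pos_of_kept P hzw (h2 P) with h5 | h5 | h5 | h5 | h5 | h5
        · omega
        · omega
        · rw [h5.1, h.pos_cut] at h1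
          omega
        · rw [h5.1] at h3
          exact ⟨h3, key' h3⟩
        · rw [h5.1, h.pos_rev_cut'] at h1
          omega
        · rw [h5.1] at h3
          have h6 := h.reachable_of_mem_star (P := P.rev) h3
            (by rw [h.star_rev]; exact h.cut_mem_star P)
          exact ⟨h6, h3⟩
  rcases SmallSeparators.mem_reroute_verts.1 hx with ⟨h1, h2⟩ | ⟨P, hP⟩
  · exact (key x (reflTransGen_of_isTree h.tree haR h1)).1 h2
  · have h1 := h.bounds P
    exact h.reachable_of_mem_star ((key _ (reflTransGen_of_isTree h.tree haR P.cut_mem_verts)).2 P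
      (by rw [h.pos_cut]; omega)).1 hP

end ReroutingPaths

end Reroute

end PDP

/-! ### The rerouted graph: acyclicity, degrees, degree-2 paths and separation. -/

namespace PDP

open SimpleGraph

section Rerouted

variable {W : Type*} {H : SimpleGraph W} {R : H.Subgraph} {L N : ℕ}
  {sep : LongPath R L → Finset W} {star : LongPath R L → H.Subgraph}

namespace ReroutingPaths

/-- A two-colouring of the tree that changes along a single edge, which is kept, has the same
value at both ends of a middle part. -/
theorem cut_iff_rev_cut [Finite W] (h : ReroutingPaths N sep star) {a b : W}
    (hab : ∀ P : LongPath R L, s(a, b) ∉ P.midEdges sep) {χ : W → Prop}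
    (hχ : ∀ x y, R.Adj x y → s(x, y) ≠ s(a, b) → χ x → χ y) (P : LongPath R L) :
    χ (P.cut sep) ↔ χ (P.rev.cut sep) := by
  have hb := h.bounds P
  have key : ∀ k, P.cutIdx sep + k ≤ P.endIdx sep →
      (χ (P.cut sep) ↔ χ (P.walk.getVert (P.cutIdx sep + k))) := by
    intro k
    induction k with
    | zero => exact fun _ => Iff.rfl
    | succ k ih =>
      intro hk
      rw [ih (by omega)]
      have h1 := P.maxDegTwo.adj (i := P.cutIdx sep + k) (by omega)
      have h2 : s(P.walk.getVert (P.cutIdx sep + k), P.walk.getVert (P.cutIdx sep + k + 1)) ≠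
          s(a, b) := by
        intro h2
        refine hab P ?_
        rw [← h2, h.mem_midEdges P h1, P.pos_getVert (by omega), P.pos_getVert (by omega)]
        omega
      exact ⟨hχ _ _ h1 h2, hχ _ _ h1.symm (by rwa [Sym2.eq_swap])⟩
  have := key (P.endIdx sep - P.cutIdx sep) (by omega)
  rwa [Nat.add_sub_cancel' (by omega), h.getVert_endIdx] at this

/-- Take the colouring of the old tree for this edge and give each new path the colour of its cuts.
They agree because the old middle part between them does not contain the edge. -/
theorem exists_cut_of_kept [Finite W] (h : ReroutingPaths N sep star) {a b : W}
    (hadj : R.Adj a b) (hab : ∀ P : LongPath R L, s(a, b) ∉ P.midEdges sep) :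
    ∃ χ : W → Prop, (χ a ↔ ¬ χ b) ∧
      ∀ x y, (reroute sep star).Adj x y → s(x, y) ≠ s(a, b) → χ x → χ y := by
  obtain ⟨χ, ha, hb, hχ⟩ := exists_cut_of_isTree h.tree hadj
  let χ' : W → Prop := fun z => (∀ P, z ∈ (star P).verts → χ (P.cut sep)) ∧
    ((∀ P, z ∉ (star P).verts) → χ z)
  have hcut := h.cut_iff_rev_cut hab hχ
  have h1 : ∀ {P z}, z ∈ (star P).verts → (χ' z ↔ χ (P.cut sep)) := by
    intro P z hz
    refine ⟨fun h2 => h2.1 P hz, fun h2 => ⟨fun Q hQ => ?_, fun h3 => absurd hz (h3 P)⟩⟩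
    rcases h.eq_or_eq_rev_of_mem_star hz hQ with rfl | rfl
    · exact h2
    · exact (hcut P).1 h2
  have h2 : ∀ {x y}, R.Adj x y → (∀ P : LongPath R L, s(x, y) ∉ P.midEdges sep) →
      (χ' x ↔ χ x) := by
    intro x y hxy hkept
    by_cases hx : ∃ P, x ∈ (star P).verts
    · obtain ⟨P, hP⟩ := hx
      rw [h1 hP]
      rcases h.kept_of_mem_star hP hxy (hkept P) with h3 | h3
      · rw [h3.1]
      · rw [h3.1, hcut P]
    · rw [not_exists] at hx
      exact ⟨fun h3 => h3.2 hx, fun h3 => ⟨fun P hP => absurd hP (hx P), fun _ => h3⟩⟩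
  refine ⟨χ', ?_, fun x y hxy hne hx => ?_⟩
  · rw [h2 hadj hab, h2 hadj.symm (fun P => by rw [Sym2.eq_swap]; exact hab P)]
    exact ⟨fun _ => hb, fun _ => ha⟩
  · rcases h.reroute_adj.1 hxy with ⟨h3, h4⟩ | ⟨P, hP⟩
    · rw [h2 h3.symm (fun P => by rw [Sym2.eq_swap]; exact h4 P)]
      exact hχ x y h3 hne ((h2 h3 h4).1 hx)
    · rw [h1 hP.snd_mem]
      rwa [h1 hP.fst_mem] at hx

theorem exists_cut_of_star [Finite W] (h : ReroutingPaths N sep star) {a b : W}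
    {P : LongPath R L} (hadj : (star P).Adj a b) :
    ∃ χ : W → Prop, (χ a ↔ ¬ χ b) ∧
      ∀ x y, (reroute sep star).Adj x y → s(x, y) ≠ s(a, b) → χ x → χ y := by
  obtain ⟨p, hpath, hp, hp'⟩ := h.star_spec P
  have hmid : ∀ i, p.getVert i ∉ P.comp sep := fun i =>
    (LongPath.mem_midRegion.1 (hp' _ (p.getVert_mem_support i))).1
  have hmem : ∀ i, p.getVert i ∈ (star P).verts := fun i => by
    rw [hp, Walk.mem_verts_toSubgraph]
    exact p.getVert_mem_support i
  have hbd := h.bounds P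
  have hadj' := hadj
  rw [hp, Walk.toSubgraph_adj_iff] at hadj'
  obtain ⟨j, hj, hj'⟩ := hadj'
  -- The component of the source and the new path up to the edge. No other edge of the new graph
  -- leaves this set, since that component can only be left into the start of the new path.
  let χ : W → Prop := fun z => (∃ i ≤ j, p.getVert i = z) ∨ z ∈ P.comp sep
  have hχ : χ (p.getVert j) ∧ ¬ χ (p.getVert (j + 1)) := by
    refine ⟨Or.inl ⟨j, le_rfl, rfl⟩, ?_⟩
    rintro (⟨i, hi, hi'⟩ | h1)
    · have := getVert_inj hpath (by omega) (by omega) hi'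
      omega
    · exact hmid _ h1
  refine ⟨χ, ?_, ?_⟩
  · rcases Sym2.eq_iff.1 hj with ⟨rfl, rfl⟩ | ⟨rfl, rfl⟩
    · exact ⟨fun _ => hχ.2, fun _ => hχ.1⟩
    · exact ⟨fun h1 => absurd h1 hχ.2, fun h1 => absurd hχ.1 h1⟩
  · rintro x y hxy hne (⟨i, hi, rfl⟩ | hx)
    · rcases h.reroute_adj.1 hxy with ⟨h1, h2⟩ | ⟨Q, hQ⟩
      · rcases h.kept_of_mem_star (hmem i) h1 (h2 P) with h3 | h3
        · right
          rw [h3.2]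
          refine h.mem_comp_of_pos_lt P (P.getVert_mem _) ?_
          rw [P.pos_getVert (by omega)]
          omega
        · have := getVert_inj hpath (by omega) le_rfl (h3.1.trans p.getVert_length.symm)
          omega
      · rw [h.star_eq (hmem i) hQ.fst_mem, hp, Walk.toSubgraph_adj_iff] at hQ
        obtain ⟨r, hr, hr'⟩ := hQ
        left
        rcases Sym2.eq_iff.1 hr with ⟨h3, rfl⟩ | ⟨rfl, h3⟩
        · obtain rfl := getVert_inj hpath (by omega) (by omega) h3
          rcases hi.eq_or_lt with rfl | hi
          · exact absurd hj hne
          · exact ⟨r + 1, hi, rfl⟩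
        · have := getVert_inj hpath (by omega) (by omega) h3
          exact ⟨r, by omega, rfl⟩
    · rcases h.mem_comp_of_adj P hx hxy with h1 | h1
      · exact Or.inr h1
      · exact Or.inl ⟨0, Nat.zero_le _, by rw [Walk.getVert_zero, h1.2]⟩

theorem isTree [Finite W] (h : ReroutingPaths N sep star) :
    (reroute sep star).coe.IsTree := by
  obtain ⟨a, haR, ha⟩ := h.exists_notMem_mid
  refine isTree_coe_of_cuts (r := a) ?_ (fun x hx => h.reachable haR ha hx) fun x y hxy => ?_
  · refine SmallSeparators.mem_reroute_verts.2 (Or.inl ⟨haR, fun P hP => ha P ?_⟩)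
    rw [h.mem_midInternal] at hP
    omega
  · rcases h.reroute_adj.1 hxy with ⟨h1, h2⟩ | ⟨P, hP⟩
    · exact h.exists_cut_of_kept h1 h2
    · exact h.exists_cut_of_star hP

/-! ### Degrees -/

theorem adj_of_far [Finite W] (h : ReroutingPaths N sep star) {x y : W}
    (hx : ∀ P : LongPath R L, ¬ (P.cutIdx sep ≤ P.pos x ∧ P.pos x ≤ P.endIdx sep))
    (hx' : ∀ P, x ∉ (star P).verts) : (reroute sep star).Adj x y ↔ R.Adj x y := by
  rw [h.reroute_adj]
  constructor
  · rintro (h1 | ⟨P, hP⟩)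
    · exact h1.1
    · exact absurd hP.fst_mem (hx' P)
  · intro h1
    refine Or.inl ⟨h1, fun P hP => hx P ?_⟩
    exact ((h.mem_midEdges P h1).1 hP).1

theorem deg_of_far [Finite W] (h : ReroutingPaths N sep star) {x : W}
    (hx : ∀ P : LongPath R L, ¬ (P.cutIdx sep ≤ P.pos x ∧ P.pos x ≤ P.endIdx sep))
    (hx' : ∀ P, x ∉ (star P).verts) : deg (reroute sep star) x = deg R x := by
  have : (reroute sep star).neighborSet x = R.neighborSet x := by
    ext y
    rw [Subgraph.mem_neighborSet, Subgraph.mem_neighborSet, h.adj_of_far hx hx']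
  rw [deg, deg, this]

theorem exists_neighborSet_subset_pair [Finite W] (h : ReroutingPaths N sep star)
    {P : LongPath R L} {x : W} (hx : x ∈ (star P).verts) :
    ∃ a b, (reroute sep star).neighborSet x ⊆ {a, b} := by
  obtain ⟨p, hpath, hp, hp'⟩ := h.star_spec P
  have hne : p.length ≠ 0 := by
    intro h0
    have h1 := Walk.eq_of_length_eq_zero h0
    have h2 := h.pos_cut P
    rw [h1, h.pos_rev_cut'] at h2
    have := h.bounds P
    omega
  have hx' := hx
  rw [hp, Walk.mem_verts_toSubgraph, Walk.mem_support_iff_exists_getVert] at hx'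
  obtain ⟨i, rfl, hi⟩ := hx'
  have hstar : ∀ Q y, (star Q).Adj (p.getVert i) y →
      (i < p.length ∧ y = p.getVert (i + 1)) ∨ (0 < i ∧ y = p.getVert (i - 1)) := by
    intro Q y hQ
    rw [h.star_eq hx hQ.fst_mem, hp, Walk.toSubgraph_adj_iff] at hQ
    obtain ⟨r, hr, hr'⟩ := hQ
    rcases Sym2.eq_iff.1 hr with ⟨h3, rfl⟩ | ⟨rfl, h3⟩
    · obtain rfl := getVert_inj hpath (by omega) (by omega) h3
      exact Or.inl ⟨hr', rfl⟩
    · obtain rfl := getVert_inj hpath (by omega) (by omega) h3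
      exact Or.inr ⟨by omega, rfl⟩
  have hkept : ∀ y, R.Adj (p.getVert i) y → s(p.getVert i, y) ∉ P.midEdges sep →
      (i = 0 ∧ y = P.walk.getVert (P.cutIdx sep - 1)) ∨
        (i = p.length ∧ y = P.walk.getVert (P.endIdx sep + 1)) := by
    intro y h1 h2
    rcases h.kept_of_mem_star hx h1 h2 with h3 | h3
    · exact Or.inl ⟨getVert_inj hpath hi (Nat.zero_le _) (h3.1.trans p.getVert_zero.symm), h3.2⟩
    · exact Or.inr ⟨getVert_inj hpath hi le_rfl (h3.1.trans p.getVert_length.symm), h3.2⟩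
  -- The predecessor and successor along the new path, which the adjacent vertices of `P` replace
  -- beyond its two ends.
  refine ⟨if i = 0 then P.walk.getVert (P.cutIdx sep - 1) else p.getVert (i - 1),
    if i = p.length then P.walk.getVert (P.endIdx sep + 1) else p.getVert (i + 1), fun y hy => ?_⟩
  rw [Set.mem_insert_iff, Set.mem_singleton_iff]
  rcases h.reroute_adj.1 hy with ⟨h1, h2⟩ | ⟨Q, hQ⟩
  · rcases hkept y h1 (h2 P) with ⟨h3, h4⟩ | ⟨h3, h4⟩
    · left; rw [if_pos h3, h4]
    · right; rw [if_pos h3, h4]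
  · rcases hstar Q y hQ with ⟨h3, h4⟩ | ⟨h3, h4⟩
    · right; rw [if_neg h3.ne, h4]
    · left; rw [if_neg h3.ne', h4]

theorem getVert_kept [Finite W] (h : ReroutingPaths N sep star) (P : LongPath R L) {i : ℕ}
    (hi : i < P.cutIdx sep) :
    (reroute sep star).Adj (P.walk.getVert i) (P.walk.getVert (i + 1)) := by
  have hb := h.bounds P
  have h1 := P.maxDegTwo.adj (i := i) (by omega)
  refine h.reroute_adj.2 (Or.inl ⟨h1, fun Q hQ => ?_⟩)
  have hQ' := (h.mem_midEdges Q h1).1 hQ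
  have hbQ := h.bounds Q
  have h2 : P.pos (P.walk.getVert (i + 1)) = i + 1 := P.pos_getVert (by omega)
  have h3 : P.pos (P.walk.getVert i) = i := P.pos_getVert (by omega)
  rcases h.eq_or_eq_rev (P := P) (Q := Q) (x := P.walk.getVert (i + 1))
    (by omega) (by omega) (by omega) (by omega) with rfl | rfl
  · omega
  · rw [h.pos_rev P (P.getVert_mem i), h3] at hQ'
    have h4 := h.bounds P.rev
    rw [LongPath.rev_rev, LongPath.length_rev] at h4
    omega

theorem length_startPath [Finite W] (h : ReroutingPaths N sep star) (P : LongPath R L) :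
    (P.startPath sep).length = P.cutIdx sep :=
  (P.walk.take_length _).trans (min_eq_left (h.cutIdx_le_length P))

theorem _root_.PDP.LongPath.getVert_startPath (P : LongPath R L) {i : ℕ}
    (hi : i ≤ P.cutIdx sep) : (P.startPath sep).getVert i = P.walk.getVert i :=
  (P.walk.take_getVert _ _).trans (by rw [min_eq_right hi])

theorem startPath_le [Finite W] (h : ReroutingPaths N sep star) (P : LongPath R L) :
    (P.startPath sep).toSubgraph ≤ reroute sep star := by
  have hb := h.bounds P
  rw [toSubgraph_le_iff_getVert]
  have key : ∀ i < (P.startPath sep).length,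
      (reroute sep star).Adj ((P.startPath sep).getVert i) ((P.startPath sep).getVert (i + 1)) := by
    intro i hi
    rw [h.length_startPath] at hi
    rw [P.getVert_startPath hi.le, P.getVert_startPath hi]
    exact h.getVert_kept P hi
  refine ⟨fun x hx => ?_, key⟩
  obtain ⟨i, rfl, hi⟩ := Walk.mem_support_iff_exists_getVert.1 hx
  have hpos : 0 < (P.startPath sep).length := by
    rw [h.length_startPath]
    omega
  rcases Nat.eq_zero_or_pos i with rfl | h0
  · exact (key 0 hpos).fst_mem
  · have := (key (i - 1) (by omega)).snd_mem
    rwa [Nat.sub_add_cancel h0] at this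

theorem mem_startPath [Finite W] (h : ReroutingPaths N sep star) (P : LongPath R L) {x : W} :
    x ∈ (P.startPath sep).support ↔ ∃ i ≤ P.cutIdx sep, P.walk.getVert i = x := by
  rw [Walk.mem_support_iff_exists_getVert, h.length_startPath]
  constructor
  · rintro ⟨i, rfl, hi⟩
    exact ⟨i, hi, (P.getVert_startPath hi).symm⟩
  · rintro ⟨i, hi, rfl⟩
    exact ⟨i, P.getVert_startPath hi, hi⟩

theorem _root_.PDP.isPath_append {a b c : W} {p : H.Walk a b} {q : H.Walk b c} (hp : p.IsPath)
    (hq : q.IsPath) (hpq : ∀ x ∈ p.support, x ∈ q.support → x = b) : (p.append q).IsPath := by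
  refine Walk.IsPath.mk' ?_
  rw [Walk.support_append, List.nodup_append']
  refine ⟨hp.support_nodup, hq.support_nodup.tail, fun x hx hx' => ?_⟩
  obtain rfl := hpq x hx (List.mem_of_mem_tail hx')
  have := hq.support_nodup
  rw [← Walk.cons_tail_support, List.nodup_cons] at this
  exact this.1 hx'

/-- The path through the rerouted graph that corresponds to a long path. -/
theorem exists_path [Finite W] (h : ReroutingPaths N sep star) (P : LongPath R L) :
    ∃ q : H.Walk P.src P.tgt, q.IsPath ∧ q.toSubgraph ≤ reroute sep star ∧
      (P.startPath sep).IsSubwalk q ∧ (P.rev.startPath sep).IsSubwalk q.reverse ∧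
      (∀ x ∈ (star P).verts, x ∈ q.support) ∧
      ∀ x ∈ q.support, x ∈ (star P).verts ∨ x ∈ P.walk.support := by
  obtain ⟨p, hpath, hp, hp'⟩ := h.star_spec P
  have hb := h.bounds P
  have hmid : ∀ x ∈ p.support, x ∈ R.verts →
      P.cutIdx sep ≤ P.pos x ∧ P.pos x ≤ P.endIdx sep := fun x hx hxR =>
    h.pos_of_mem_midRegion P (hp' x hx) hxR
  obtain ⟨s, hs⟩ : ∃ s : H.Walk (P.rev.cut sep) P.tgt, (P.rev.startPath sep) = s.reverse :=
    ⟨(P.rev.startPath sep).reverse, (Walk.reverse_reverse _).symm⟩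
  have hspath : s.IsPath := by
    rw [← Walk.isPath_reverse_iff, ← hs]
    exact P.rev.maxDegTwo.1.take _
  have hsle : s.toSubgraph ≤ reroute sep star := by
    rw [← Walk.toSubgraph_reverse, ← hs]
    exact h.startPath_le P.rev
  have hmem : ∀ x ∈ s.support, ∃ i ≤ P.rev.cutIdx sep, P.rev.walk.getVert i = x := by
    intro x hx
    rw [← h.mem_startPath P.rev, hs]
    exact (congrArg (x ∈ ·) s.support_reverse).mpr (List.mem_reverse.2 hx)
  have hrev : ∀ x ∈ s.support, x ∈ R.verts ∧ P.endIdx sep ≤ P.pos x := by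
    intro x hx
    obtain ⟨i, hi, rfl⟩ := hmem x hx
    refine ⟨P.rev.getVert_mem i, ?_⟩
    rw [P.getVert_rev, P.pos_getVert (by omega)]
    omega
  have h1 : (p.append s).IsPath := by
    refine isPath_append hpath hspath fun x hx hx' => ?_
    obtain ⟨h1, h2⟩ := hrev x hx'
    have h3 := hmid x hx h1
    rw [← P.getVert_pos (z := x) (by omega) (by omega), show P.pos x = P.endIdx sep by omega,
      h.getVert_endIdx]
  have h2 : ((P.startPath sep).append (p.append s)).IsPath := by
    refine isPath_append (P.maxDegTwo.1.take _) h1 fun x hx hx' => ?_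
    obtain ⟨i, hi, rfl⟩ := (h.mem_startPath P).1 hx
    have h3 : P.pos (P.walk.getVert i) = i := P.pos_getVert (by omega)
    rcases (Walk.mem_support_append_iff _ _).1 hx' with h4 | h4
    · have h5 := hmid _ h4 (P.getVert_mem i)
      rw [show i = P.cutIdx sep by omega]
      rfl
    · have h5 := hrev _ h4
      omega
  refine ⟨_, h2, ?_, ⟨.nil, p.append s, by simp⟩,
    ⟨.nil, p.reverse.append (P.startPath sep).reverse, ?_⟩, fun x hx => ?_, fun x hx => ?_⟩
  · rw [Walk.toSubgraph_append, Walk.toSubgraph_append]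
    refine sup_le (h.startPath_le P) (sup_le ?_ hsle)
    rw [← hp]
    exact (le_iSup star P).trans le_sup_right
  · rw [hs, Walk.reverse_append, Walk.reverse_append, Walk.append_assoc]
    rfl
  · rw [hp, Walk.mem_verts_toSubgraph] at hx
    rw [Walk.mem_support_append_iff, Walk.mem_support_append_iff]
    exact Or.inr (Or.inl hx)
  · rw [Walk.mem_support_append_iff, Walk.mem_support_append_iff] at hx
    rcases hx with hx | hx | hx
    · obtain ⟨i, -, rfl⟩ := (h.mem_startPath P).1 hx
      exact Or.inr (P.walk.getVert_mem_support i)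
    · left
      rwa [hp, Walk.mem_verts_toSubgraph]
    · obtain ⟨i, -, rfl⟩ := hmem x hx
      rw [P.getVert_rev]
      exact Or.inr (P.walk.getVert_mem_support _)

/-- There are at most two neighbours, and the vertex is internal to a path joining the endpoints of
`P`, neither of which lies in the middle region. -/
theorem deg_of_mem_star [Finite W] (h : ReroutingPaths N sep star) {P : LongPath R L} {x : W}
    (hx : x ∈ (star P).verts) : deg (reroute sep star) x = 2 := by
  obtain ⟨a, b, hab⟩ := h.exists_neighborSet_subset_pair hx
  obtain ⟨q, hq, hqle, -, -, hq1, -⟩ := h.exists_path P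
  obtain ⟨i, rfl, hi⟩ := Walk.mem_support_iff_exists_getVert.1 (hq1 x hx)
  have hmid := LongPath.mem_midRegion.1 (h.star_subset P hx)
  have h1 : i ≠ 0 := by
    rintro rfl
    rw [Walk.getVert_zero] at hmid
    exact hmid.1 (h.src_mem_comp P)
  have h2 : i ≠ q.length := by
    rintro rfl
    rw [Walk.getVert_length] at hmid
    exact hmid.2 (h.src_mem_comp P.rev)
  refine le_antisymm ((Set.ncard_le_ncard hab (Set.toFinite _)).trans
    ((Set.ncard_insert_le a {b}).trans (by
      rw [Set.ncard_singleton]))) ?_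
  exact two_le_deg hq hqle (by omega) (by omega)

/-- Only vertices of old or new middle parts are affected. In either graph they have degree 2 when
present and, by the convention for absent vertices, degree 0 otherwise. -/
theorem deg_cases [Finite W] (h : ReroutingPaths N sep star) (x : W) :
    deg (reroute sep star) x = deg R x ∨ ((deg R x = 0 ∨ deg R x = 2) ∧
      (deg (reroute sep star) x = 0 ∨ deg (reroute sep star) x = 2)) := by
  by_cases h1 : ∃ P, x ∈ (star P).verts
  · obtain ⟨P, hP⟩ := h1
    refine Or.inr ⟨?_, Or.inr (h.deg_of_mem_star hP)⟩
    by_cases hxR : x ∈ R.verts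
    · have h2 := h.pos_of_mem_star hP hxR
      have hb := h.bounds P
      have h3 := P.maxDegTwo.deg_getVert (i := P.pos x) (by omega) (by omega)
      rw [P.getVert_pos (by omega) (by omega)] at h3
      exact Or.inr h3
    · left
      rw [deg, Set.ncard_eq_zero (Set.toFinite _), Set.eq_empty_iff_forall_notMem]
      exact fun y hy => hxR (R.edge_vert hy)
  rw [not_exists] at h1
  by_cases h2 : ∃ P : LongPath R L, P.cutIdx sep ≤ P.pos x ∧ P.pos x ≤ P.endIdx sep
  · obtain ⟨P, hP⟩ := h2
    have hb := h.bounds P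
    have h3 := P.maxDegTwo.deg_getVert (i := P.pos x) (by omega) (by omega)
    have h4 := P.getVert_pos (z := x) (by omega) (by omega)
    rw [h4] at h3
    refine Or.inr ⟨Or.inr h3, Or.inl ?_⟩
    rw [deg, Set.ncard_eq_zero (Set.toFinite _), Set.eq_empty_iff_forall_notMem]
    intro y hy
    rcases h.reroute_adj.1 hy with ⟨h5, h6⟩ | ⟨Q, hQ⟩
    · have h7 := h.notMem_midInternal_of_adj P h5 (h6 P)
      rw [h.mem_midInternal] at h7
      by_cases h8 : P.pos x = P.cutIdx sep
      · refine h1 P ?_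
        rw [← h4, h8]
        exact h.cut_mem_star P
      · refine h1 P ?_
        rw [← h4, show P.pos x = P.endIdx sep by omega, h.getVert_endIdx]
        exact h.rev_cut_mem_star P
    · exact h1 Q hQ.fst_mem
  · rw [not_exists] at h2
    exact Or.inl (h.deg_of_far h2 h1)

theorem deg_eq_one_iff [Finite W] (h : ReroutingPaths N sep star) (x : W) :
    deg (reroute sep star) x = 1 ↔ deg R x = 1 := by
  have := h.deg_cases x
  omega

theorem three_le_deg_iff [Finite W] (h : ReroutingPaths N sep star) (x : W) :
    3 ≤ deg (reroute sep star) x ↔ 3 ≤ deg R x := by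
  have := h.deg_cases x
  omega

theorem isSteinerTree [Finite W] (h : ReroutingPaths N sep star) {X : Set W}
    (hX : IsSteinerTree R X) : IsSteinerTree (reroute sep star) X := by
  refine ⟨h.isTree, ?_⟩
  have key : ∀ (K : H.Subgraph) (v : W), deg K v = 1 → v ∈ K.verts := by
    intro K v hv
    obtain ⟨w, hw⟩ := Set.nonempty_of_ncard_ne_zero (s := K.neighborSet v)
      (by unfold deg at hv; omega)
    exact K.edge_vert hw
  rw [← hX.2]
  ext v
  exact ⟨fun hv => ⟨key _ _ ((h.deg_eq_one_iff v).1 hv.2), (h.deg_eq_one_iff v).1 hv.2⟩,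
    fun hv => ⟨key _ _ ((h.deg_eq_one_iff v).2 hv.2), (h.deg_eq_one_iff v).2 hv.2⟩⟩

/-! ### Maximal degree-2 paths -/

theorem isMaxDegTwoPath_iff [Finite W] (h : ReroutingPaths N sep star) {a b : W}
    {p : H.Walk a b} (hp : p.toSubgraph ≤ R) (hp' : p.toSubgraph ≤ reroute sep star) :
    IsMaxDegTwoPath (reroute sep star) p ↔ IsMaxDegTwoPath R p := by
  simp only [IsMaxDegTwoPath, h.deg_eq_one_iff, h.three_le_deg_iff, hp, hp']

/-- A vertex of it in a middle part would make it equal, up to direction, to a long path. -/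
theorem isMaxDegTwoPath_of_short [Finite W] (h : ReroutingPaths N sep star) {a b : W}
    {p : H.Walk a b} (hp : IsMaxDegTwoPath R p) (hlen : p.length < L) :
    IsMaxDegTwoPath (reroute sep star) p := by
  have hfar : ∀ i ≤ p.length, ∀ P : LongPath R L,
      ¬ (P.cutIdx sep ≤ P.pos (p.getVert i) ∧ P.pos (p.getVert i) ≤ P.endIdx sep) := by
    intro i hi P hP
    have hb := h.bounds P
    have h1 := P.maxDegTwo.eq_or_eq_reverse hp (i := P.pos (p.getVert i)) (by omega) (by omega) hi
      (P.getVert_pos (by omega) (by omega))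
    have := P.long
    omega
  refine (h.isMaxDegTwoPath_iff hp.2.1 ?_).2 hp
  rw [toSubgraph_le_iff_getVert]
  refine ⟨fun x hx => ?_, fun i hi => ?_⟩
  · obtain ⟨i, rfl, hi⟩ := Walk.mem_support_iff_exists_getVert.1 hx
    refine SmallSeparators.mem_reroute_verts.2 (Or.inl ⟨hp.getVert_mem_verts i, fun P hP => ?_⟩)
    rw [h.mem_midInternal] at hP
    exact hfar i hi P (by omega)
  · refine h.reroute_adj.2 (Or.inl ⟨hp.adj hi, fun P hP => ?_⟩)
    exact hfar i hi.le P ((h.mem_midEdges P (hp.adj hi)).1 hP).1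

theorem exists_isMaxDegTwoPath [Finite W] (h : ReroutingPaths N sep star) (P : LongPath R L) :
    ∃ q : H.Walk P.src P.tgt, IsMaxDegTwoPath (reroute sep star) q ∧
      (P.startPath sep).IsSubwalk q ∧ (P.rev.startPath sep).IsSubwalk q.reverse ∧
      ∀ x ∈ (star P).verts, x ∈ q.support := by
  obtain ⟨q, hq, hqle, h1, h2, h3, h4⟩ := h.exists_path P
  obtain ⟨-, -, h5, h6, h7⟩ := P.maxDegTwo
  refine ⟨q, ⟨hq, hqle, ?_, ?_, fun w hw ha hb => ?_⟩, h1, h2, h3⟩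
  · rwa [h.deg_eq_one_iff, h.three_le_deg_iff]
  · rwa [h.deg_eq_one_iff, h.three_le_deg_iff]
  · rcases h4 w hw with h8 | h8
    · rw [h.deg_of_mem_star h8]
      omega
    · rw [h.three_le_deg_iff]
      exact h7 w h8 ha hb

/-- If the path meets a new path, it shares an internal vertex with the rerouted version of some `P`
and coincides with it up to direction. Otherwise all its edges are old and it was already a long
path of `R`. -/
theorem exists_longPath [Finite W] (h : ReroutingPaths N sep star) {a b : W} {q : H.Walk a b}
    (hq : IsMaxDegTwoPath (reroute sep star) q) (hlen : L ≤ q.length) :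
    ∃ P : LongPath R L, P.src = a ∧ P.tgt = b := by
  by_cases h1 : ∃ P, ∃ x ∈ (star P).verts, x ∈ q.support
  · obtain ⟨P, x, hx, hxq⟩ := h1
    obtain ⟨r, hr, -, -, hr'⟩ := h.exists_isMaxDegTwoPath P
    obtain ⟨i, hi, hi'⟩ := Walk.mem_support_iff_exists_getVert.1 (hr' x hx)
    obtain ⟨j, hj, hj'⟩ := Walk.mem_support_iff_exists_getVert.1 hxq
    have hmid := LongPath.mem_midRegion.1 (h.star_subset P hx)
    have h2 : i ≠ 0 := by
      rintro rfl
      rw [Walk.getVert_zero] at hi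
      exact hmid.1 (hi ▸ h.src_mem_comp P)
    have h3 : i ≠ r.length := by
      rintro rfl
      rw [Walk.getVert_length] at hi
      exact hmid.2 (hi ▸ h.src_mem_comp P.rev)
    obtain ⟨h4, h5 | h5⟩ := hr.eq_or_eq_reverse hq (i := i) (by omega) (by omega) hj'
      (hi.trans hj.symm)
    · have h6 := h5 0 (Nat.zero_le _)
      have h7 := h5 r.length le_rfl
      rw [Walk.getVert_zero, Walk.getVert_zero] at h6
      rw [Walk.getVert_length, h4, Walk.getVert_length] at h7
      exact ⟨P, h6, h7⟩
    · have h6 := h5 0 (Nat.zero_le _)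
      have h7 := h5 r.length le_rfl
      rw [Walk.getVert_zero, Walk.getVert_zero] at h6
      rw [Walk.getVert_length, h4, ← q.length_reverse, Walk.getVert_length] at h7
      exact ⟨P.rev, h7, h6⟩
  · push Not at h1
    have hle : q.toSubgraph ≤ R := by
      have hadj : ∀ i < q.length, R.Adj (q.getVert i) (q.getVert (i + 1)) := by
        intro i hi
        rcases h.reroute_adj.1 (hq.adj hi) with h2 | ⟨P, hP⟩
        · exact h2.1
        · exact absurd (q.getVert_mem_support i) (h1 P _ hP.fst_mem)
      refine toSubgraph_le_iff_getVert.2 ⟨fun x hx => ?_, hadj⟩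
      rcases SmallSeparators.mem_reroute_verts.1 (hq.2.1.1 (q.mem_verts_toSubgraph.2 hx))
        with h2 | ⟨P, hP⟩
      · exact h2.1
      · exact absurd hx (h1 P _ hP)
    exact ⟨⟨a, b, q, (h.isMaxDegTwoPath_iff hle hq.2.1).1 hq, hlen⟩, rfl, rfl⟩

theorem _root_.PDP.LongPath.eq_of_src_tgt (hR : R.coe.IsTree) {P Q : LongPath R L}
    (h1 : P.src = Q.src) (h2 : P.tgt = Q.tgt) : P = Q := by
  obtain ⟨a, b, p, hp, hp'⟩ := P
  obtain ⟨c, d, q, hq, hq'⟩ := Q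
  simp only at h1 h2
  subst h1 h2
  obtain rfl := path_unique_of_isTree hR hp.1 hq.1 hp.2.1 hq.2.1
  rfl

theorem existsUnique_longPath [Finite W] (h : ReroutingPaths N sep star) {a b : W}
    {q : H.Walk a b} (hq : IsMaxDegTwoPath (reroute sep star) q) (hlen : L ≤ q.length) :
    ∃! P : LongPath R L, P.src = a ∧ P.tgt = b := by
  obtain ⟨P, h1, h2⟩ := h.exists_longPath hq hlen
  exact ⟨P, ⟨h1, h2⟩, fun Q hQ =>
    LongPath.eq_of_src_tgt h.tree (hQ.1.trans h1.symm) (hQ.2.trans h2.symm)⟩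

/-! ### Separation -/

/-- The part of the rerouted tree around the source of a long path. -/
def _root_.PDP.LongPath.startPart (sep : LongPath R L → Finset W) (R' : H.Subgraph)
    (P : LongPath R L) : Set W :=
  {w | w ∈ (P.startPath sep).support} ∪
    component (R'.deleteVerts ({w | w ∈ (P.startPath sep).support} \ {P.src})) P.src

theorem getVert_mem_comp [Finite W] (h : ReroutingPaths N sep star) (P : LongPath R L) {i : ℕ}
    (hi : i < P.cutIdx sep) : P.walk.getVert i ∈ P.comp sep := by
  have hb := h.bounds P
  refine h.mem_comp_of_pos_lt P (P.getVert_mem i) ?_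
  rwa [P.pos_getVert (by omega)]

theorem cut_notMem_comp [Finite W] (h : ReroutingPaths N sep star) (P : LongPath R L) :
    P.cut sep ∉ P.comp sep :=
  (LongPath.mem_midRegion.1 (h.star_subset P (h.cut_mem_star P))).1

/-- A walk of the new tree leaves the component of the source only through the cut, and the cut is
among the deleted vertices. -/
theorem startPart_subset [Finite W] (h : ReroutingPaths N sep star) (P : LongPath R L) {x : W}
    (hx : x ∈ P.startPart sep (reroute sep star)) : x = P.cut sep ∨ x ∈ P.comp sep := by
  have hb := h.bounds P
  rcases hx with hx | hx
  · obtain ⟨i, hi, rfl⟩ := (h.mem_startPath P).1 hx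
    rcases hi.eq_or_lt with rfl | hi
    · exact Or.inl rfl
    · exact Or.inr (h.getVert_mem_comp P hi)
  · refine Or.inr (component_induct (P := fun y => y ∈ P.comp sep) hx (h.src_mem_comp P)
      fun y z hyz hy => ?_)
    rw [Subgraph.deleteVerts_adj] at hyz
    rcases h.mem_comp_of_adj P hy hyz.2.2.2.2 with h1 | ⟨-, h1⟩
    · exact h1
    · refine absurd ⟨?_, ?_⟩ hyz.2.2.2.1
      · rw [h1]
        exact Walk.end_mem_support _
      · rintro rfl
        exact h.cut_notMem_comp P (h1 ▸ h.src_mem_comp P)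

theorem src_mem_reroute [Finite W] (h : ReroutingPaths N sep star) (P : LongPath R L) :
    P.src ∈ (reroute sep star).verts :=
  (h.startPath_le P).1 (Walk.start_mem_verts_toSubgraph _)

/-- Follow a walk of the new tree from the source: at a vertex of `P` strictly between the source
and the cut, all edges are those of the start path, so leaving that path is possible only at the
source. -/
theorem mem_startPart [Finite W] (h : ReroutingPaths N sep star) (P : LongPath R L) {x : W}
    (hx : x ∈ (reroute sep star).verts) (hxP : x ∈ P.comp sep) :
    x ∈ P.startPart sep (reroute sep star) := by
  have hb := h.bounds P
  have hsrc : P.src ∈ ((reroute sep star).deleteVerts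
      ({w | w ∈ (P.startPath sep).support} \ {P.src})).verts :=
    ⟨h.src_mem_reroute P, fun h1 => h1.2 rfl⟩
  have hreach := reflTransGen_of_isTree h.isTree (h.src_mem_reroute P) hx
  clear hx
  induction hreach with
  | refl => exact Or.inl (Walk.start_mem_support _)
  | @tail y z _ hyz ih =>
    by_cases hz : z ∈ (P.startPath sep).support
    · exact Or.inl hz
    rcases h.mem_comp_of_adj P hxP hyz.symm with h1 | ⟨h1, -⟩
    · refine Or.inr ?_
      have hstep : ∀ y' ∈ component ((reroute sep star).deleteVerts
          ({w | w ∈ (P.startPath sep).support} \ {P.src})) P.src, y' = y →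
          z ∈ component ((reroute sep star).deleteVerts
          ({w | w ∈ (P.startPath sep).support} \ {P.src})) P.src := by
        rintro _ hy' rfl
        refine mem_component_of_adj hy' (Subgraph.deleteVerts_adj.2 ⟨hyz.fst_mem,
          (component_subset_verts hy').2, hyz.snd_mem, fun h2 => hz h2.1, hyz⟩)
      rcases ih h1 with h2 | h2
      · obtain ⟨i, hi, hi'⟩ := (h.mem_startPath P).1 h2
        rcases Nat.eq_zero_or_pos i with rfl | h0
        · rw [Walk.getVert_zero] at hi'
          exact hstep _ (mem_component_self hsrc) hi'
        · exfalso
          have hi1 : i < P.cutIdx sep := by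
            refine lt_of_le_of_ne hi ?_
            rintro rfl
            exact h.cut_notMem_comp P (by rw [LongPath.cut, hi']; exact h1)
          rcases h.reroute_adj.1 hyz with ⟨h3, -⟩ | ⟨Q, hQ⟩
          · rw [← hi'] at h3
            rcases P.maxDegTwo.eq_or_eq_of_adj h0 (by omega) h3 with h4 | h4
            · exact hz ((h.mem_startPath P).2 ⟨i - 1, by omega, h4.symm⟩)
            · exact hz ((h.mem_startPath P).2 ⟨i + 1, by omega, h4.symm⟩)
          · have h3 := h.pos_of_mem_star hQ.fst_mem (hi' ▸ P.getVert_mem i)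
            have hbQ := h.bounds Q
            have h4 : P.pos y = i := by rw [← hi', P.pos_getVert (by omega)]
            rcases h.eq_or_eq_rev (P := P) (Q := Q) (x := y) (by omega) (by omega) (by omega)
              (by omega) with rfl | rfl
            · omega
            · have h5 := h.pos_of_mem_star (P := P) (x := y)
                (by rw [← h.star_rev]; exact hQ.fst_mem) (hi' ▸ P.getVert_mem i)
              omega
      · exact hstep _ h2 rfl
    · exact absurd ((h.mem_startPath P).2 ⟨_, Nat.sub_le _ _, h1.symm⟩) hz

/-- A walk off the separator that starts in the start part begins and stays in the component of the
source, whose tree vertices all belong to the start part. -/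
theorem separates [Finite W] (h : ReroutingPaths N sep star) (P : LongPath R L) :
    Separates H (sep P) (P.startPart sep (reroute sep star))
      ((reroute sep star).verts \ P.startPart sep (reroute sep star)) := by
  rw [separates_iff]
  rintro a ha b ⟨hb, hb'⟩ hab
  rcases h.startPart_subset P ha with rfl | h1
  · exact hab.left (h.cut_mem_sep P)
  · rw [LongPath.mem_comp] at h1
    exact hb' (h.mem_startPart P hb (h.mem_comp_of_avoid_sep P
      ((h1.mono fun x hx => Or.inl hx).trans hab)))

end ReroutingPaths

end Rerouted

end PDP

/-! ### Minimum separators in good instances, and the theorem. -/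

namespace PDP

open SimpleGraph

section MinimumSeparators

variable {W : Type*} {H : SimpleGraph W} {R : H.Subgraph} {L : ℕ}

theorem IsMinSeparator.isMinimalSeparator {S : Finset W} {A B : Set W}
    (h : IsMinSeparator H S A B) (hA : ∀ a ∈ A, ∀ a' ∈ A, Avoid H Aᶜ a a')
    (hB : ∀ b ∈ B, ∀ b' ∈ B, Avoid H Bᶜ b b') : IsMinimalSeparator H S A B where
  separates := separates_iff.1 h.2.1
  minimal s hs := by
    classical
    by_contra! hcon
    have h1 := h.2.2 (S.erase s)
      (h.1.mono_left (by rw [Finset.coe_erase]; exact Set.sdiff_subset))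
      (separates_iff.2 (by rw [Finset.coe_erase]; exact hcon))
    have h2 := Finset.card_erase_lt_of_mem (Finset.mem_coe.1 hs)
    omega
  left a ha a' ha' := (hA a ha a' ha').mono fun _ hx hx' =>
    Set.disjoint_left.1 h.1 hx (Or.inl hx')
  right b hb b' hb' := (hB b hb b' hb').mono fun _ hx hx' =>
    Set.disjoint_left.1 h.1 hx (Or.inr hx')

namespace LongPath

theorem partA_connected [Finite W] (hR : R.coe.IsTree) (hL : 1 ≤ L) (P : LongPath R L) {m : ℕ}
    (hm : 2 ≤ m) (hm' : m ≤ P.walk.length) :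
    ∀ a ∈ P.partA m, ∀ a' ∈ P.partA m, Avoid H (P.partA m)ᶜ a a' := by
  have key : ∀ a ∈ P.partA m, Avoid H (P.partA m)ᶜ P.src a := by
    intro a ha
    rw [P.mem_partA_iff hR hL hm hm'] at ha
    refine (P.avoid_of_pos_le hR hL ha.1 (i := m / 2 - 1) (by omega) (by omega)).mono ?_
    intro x hx hx'
    rw [Set.mem_compl_iff, P.mem_partA_iff hR hL hm hm'] at hx
    exact hx ⟨hx'.1, by omega⟩
  exact fun a ha a' ha' => (key a ha).symm.trans (key a' ha')

theorem partB_connected [Finite W] (hR : R.coe.IsTree) (hL : 1 ≤ L) (P : LongPath R L) {m : ℕ}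
    (hm : 2 ≤ m) (hm' : m ≤ P.walk.length) :
    ∀ b ∈ P.partB m, ∀ b' ∈ P.partB m, Avoid H (P.partB m)ᶜ b b' := by
  have key : ∀ b ∈ P.partB m, Avoid H (P.partB m)ᶜ P.tgt b := by
    intro b hb
    rw [P.mem_partB_iff hR hL hm hm'] at hb
    have hpos := P.pos_rev hR hL hb.1
    refine (P.rev.avoid_of_pos_le hR hL hb.1 (i := P.walk.length - m) (by omega)
      (by rw [length_rev]; omega)).mono ?_
    rintro x hx ⟨hx1, hx2⟩
    rw [Set.mem_compl_iff, P.mem_partB_iff hR hL hm hm'] at hx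
    rw [P.pos_rev hR hL hx1] at hx2
    have := P.pos_le x
    exact hx ⟨hx1, by omega⟩
  exact fun b hb b' hb' => (key b hb).symm.trans (key b' hb')

end LongPath

/-- The distance to a nonempty set in a connected graph. -/
theorem exists_dist_to_set (hH : H.Connected) {A : Set W} (hA : A.Nonempty) : ∃ d : W → ℕ,
    (∀ x y, H.Adj x y → d y ≤ d x + 1) ∧ (∀ a ∈ A, d a = 0) ∧
      ∀ x, ∃ a ∈ A, ∃ q : H.Walk a x, q.length = d x := by
  let D : W → Set ℕ := fun x => {l | ∃ a ∈ A, ∃ q : H.Walk a x, q.length = l}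
  have hD : ∀ x, sInf (D x) ∈ D x := by
    intro x
    obtain ⟨a, ha⟩ := hA
    obtain ⟨q⟩ := hH.preconnected a x
    exact Nat.sInf_mem ⟨_, a, ha, q, rfl⟩
  refine ⟨fun x => sInf (D x), fun x y hxy => ?_, fun a ha => ?_, hD⟩
  · obtain ⟨a, ha, q, hq⟩ := hD x
    exact Nat.sInf_le ⟨a, ha, q.concat hxy, by rw [Walk.length_concat, hq]⟩
  · exact Nat.le_zero.1 (Nat.sInf_le ⟨a, ha, .nil, rfl⟩)

end MinimumSeparators

/-- The terminal on the outer face shows that there is at least one pair, so the exponent is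
positive. -/
theorem PDPInstance.Good.two_le {V D F : Type*} {I : PDPInstance V D F} {c : ℕ}
    (hI : I.Good c) (hc : 1 ≤ c) :
    2 ≤ 2 ^ (c * I.k) := by
  obtain ⟨t, ht, -⟩ := hI.outer
  have h1 : 0 < I.k := Finset.card_pos.2 ⟨_, (I.g.symm ⟨t, ht⟩).2⟩
  exact Nat.le_self_pow (Nat.mul_pos hc h1).ne' 2

section Instances

variable {V D F : Type*} [Finite V] [Finite D] [Finite F]

theorem PlaneGraph.card_minSeparator_le (G : PlaneGraph V D F) {N L : ℕ}
    (htw : TreewidthLE G.graph N) (hN : 2 ≤ N) {R : G.radial.Subgraph} (hR : R.coe.IsTree)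
    (hdet : ¬ HasDetour R) (hL : 100 * N ≤ L) (P : LongPath R L) {S : Finset (V ⊕ F)}
    (hS : IsMinSeparator G.radial S (P.partA (100 * N)) (P.partB (100 * N))) :
    S.card ≤ 2 * N + 3 := by
  have hlen := P.long
  have hA : ∀ {x}, x ∈ P.partA (100 * N) ↔ x ∈ R.verts ∧ P.pos x < 100 * N / 2 :=
    P.mem_partA_iff hR (by omega) (by omega) (by omega)
  have hB : ∀ {x}, x ∈ P.partB (100 * N) ↔ x ∈ R.verts ∧ 100 * N ≤ P.pos x :=
    P.mem_partB_iff hR (by omega) (by omega) (by omega)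
  have hne : (P.partA (100 * N)).Nonempty := ⟨P.src, hA.2 ⟨P.src_mem, by rw [P.pos_src]; omega⟩⟩
  obtain ⟨d, hd, hdA, hd'⟩ := exists_dist_to_set G.connected hne
  -- `partA` has positions below `50 * N` and `partB` positions from `100 * N` on. Without detours
  -- the distance exceeds `50 * N`, and `50 * N` is at least the required `6 * N + 8`.
  obtain ⟨Z, hZ, hZ', hcard⟩ := G.exists_small_separator htw (M := 50 * N)
    (B := P.partB (100 * N)) (by omega) hne
    (P.partA_connected hR (by omega) (by omega) (by omega))
    (P.partB_connected hR (by omega) (by omega) (by omega)) d hd hdA fun b hb => by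
      obtain ⟨a, ha, q, hq⟩ := hd' b
      have h1 := P.pos_le_pos_add hR (by omega) hdet (hA.1 ha).1 (hB.1 hb).1 q
      have h2 := (hA.1 ha).2
      have h3 := (hB.1 hb).2
      omega
  have hfin := Set.toFinite Z
  have h1 := hS.2.2 hfin.toFinset (by rwa [hfin.coe_toFinset])
    (separates_iff.2 (by rwa [hfin.coe_toFinset]))
  rw [Set.ncard_eq_toFinset_card Z hfin] at hcard
  omega

theorem PDPInstance.Good.smallSeparators {I : PDPInstance V D F} {c : ℕ} (hI : I.Good c)
    (hc : 1 ≤ c) {R : I.H.Subgraph} (hR : R.coe.IsTree) (hdet : ¬ HasDetour R)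
    {sep : LongPath R (I.alphaLong c) → Finset (V ⊕ F)} (hsep : IsSeparatorChoice c sep) :
    SmallSeparators (2 ^ (c * I.k)) sep := by
  have hN := hI.two_le hc
  have hL : I.alphaLong c = 10000 * 2 ^ (c * I.k) := rfl
  refine ⟨hR, hdet, I.G.connected, hN, hL, hsep, fun P s hs t ht => ?_, fun P => ?_⟩
  · have hlen := P.long
    have hm : 2 ≤ I.alphaPat c ∧ I.alphaPat c ≤ P.walk.length := by
      unfold alphaPat
      omega
    exact ((hsep P).isMinimalSeparator (P.partA_connected hR (by omega) hm.1 hm.2)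
      (P.partB_connected hR (by omega) hm.1 hm.2)).connected I.G.triangleExact hs ht
  · exact I.G.card_minSeparator_le hI.treewidth hN hR hdet (by omega) P (hsep P)

end Instances

end PDP

theorem mainTheorem9 {V D F : Type*} [Finite V] [Finite D] [Finite F]
    (c : ℕ) (hc : 1 ≤ c)
    (I : PDP.PDPInstance V D F) (hI : I.Good c)
    (R₂ : I.H.Subgraph) (hR₂ : I.IsSteiner R₂) (hdet : ¬ PDP.HasDetour R₂)
    (sep : PDP.LongPath R₂ (I.alphaLong c) → Finset (V ⊕ F))
    (hsep : PDP.PDPInstance.IsSeparatorChoice c sep) :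
    -- the middle regions of distinct long paths
    (∀ P Q : PDP.LongPath R₂ (I.alphaLong c), Q ≠ P → Q ≠ P.rev →
      Disjoint (P.midRegion sep) (Q.midRegion sep) ∧
      (P.midRegion sep ⊆ Q.comp sep ∨ P.midRegion sep ⊆ Q.rev.comp sep)) ∧
    ∀ X : PDP.PDPInstance.Rerouting sep,
      -- the result of the replacements is a Steiner tree
      I.IsSteiner X.result ∧
      -- with the same vertices of degree at least three
      {w | 3 ≤ PDP.deg X.result w} = {w | 3 ≤ PDP.deg R₂ w} ∧
      -- in which all short maximal degree-2 paths persist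
      (∀ (a b : V ⊕ F) (p : I.H.Walk a b), PDP.IsMaxDegTwoPath R₂ p →
        p.length < I.alphaLong c → PDP.IsMaxDegTwoPath X.result p) ∧
      -- and so do the two end parts of every long one
      (∀ P : PDP.LongPath R₂ (I.alphaLong c), ∃ q : I.H.Walk P.src P.tgt,
        PDP.IsMaxDegTwoPath X.result q ∧
        (P.startPath sep).IsSubwalk q ∧ (P.rev.startPath sep).IsSubwalk q.reverse) ∧
      -- and the separators of the original tree separate the corresponding parts
      (∀ (a b : V ⊕ F) (q : I.H.Walk a b), PDP.IsMaxDegTwoPath X.result q →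
        I.alphaLong c ≤ q.length →
        (∃! P : PDP.LongPath R₂ (I.alphaLong c), P.src = a ∧ P.tgt = b) ∧
        ∀ P : PDP.LongPath R₂ (I.alphaLong c), P.src = a → P.tgt = b →
          PDP.Separates I.H (sep P) (PDP.PDPInstance.partAStar sep X.result P)
            (X.result.verts \ PDP.PDPInstance.partAStar sep X.result P)) := by
  have h := hI.smallSeparators hc hR₂.1 hdet hsep
  refine ⟨fun P Q h1 h2 => ⟨h.disjoint_midRegion P h1 h2, h.midRegion_subset_comp P h1 h2⟩,
    fun X => ?_⟩
  have hX : PDP.ReroutingPaths (2 ^ (c * I.k)) sep X.star :=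
    ⟨h, X.star_rev, fun P => by
      obtain ⟨p, h1, h2, h3, -⟩ := X.star_spec P
      exact ⟨p, h1, h2, h3⟩⟩
  refine ⟨hX.isSteinerTree hR₂, Set.ext hX.three_le_deg_iff,
    fun a b p hp hlen => hX.isMaxDegTwoPath_of_short hp hlen, fun P => ?_,
    fun a b q hq hlen => ⟨hX.existsUnique_longPath hq hlen, fun P _ _ => hX.separates P⟩⟩
  obtain ⟨q, h1, h2, h3, -⟩ := hX.exists_isMaxDegTwoPath P
  exact ⟨q, h1, h2, h3⟩
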